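/- **Setting.** Fix an infinite set $\mathcal N$ of names and a finite forest $(\mathcal T,\prec)$ of *base types*, where $s\prec t$ means that $s$ is the parent of $t$; let $<$ and $\le$ be the transitive and the reflexive transitive closure of $\prec$. *Types* are $\tau ::= t \mid t[\tau]$ with $t\in\mathcal T$, and $\mathrm{base}(t)=\mathrm{base}(t[\tau])=t$. *Annotated terms* are given by $$P ::= \nu x{:}\tau.P \mid P\parallel P\mid M\mid\, !M,\qquad M ::= \mathbf 0\mid M+M\mid \pi.P,\qquad \pi ::= a(x)\mid \bar a\langle b\rangle\mid\boldsymbol\tau,$$ where $x$ is bound in $\nu x{:}\tau.P$ and in $a(x).P$. Terms $M$ and $!M$ are *sequential*. *Structural congruence* $\equiv$ is the smallest congruence containing $\alpha$-conversion (annotations are kept), commutativity and associativity of $+$ and $\parallel$ with neutral element $\mathbf 0$, and the laws $\nu x{:}\tau.\mathbf 0\equiv\mathbf 0$; $\nu x{:}\tau.\nu y{:}\sigma.P\equiv\nu y{:}\sigma.\nu x{:}\tau.P$ for $x\neq y$; $!\mathbf 0\equiv\mathbf 0$; $!M\equiv M\parallel{!M}$; and $P\parallel\nu a{:}\tau.Q\equiv\nu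 a{:}\tau.(P\parallel Q)$ if $a\notin\mathrm{fn}(P)$. A *normal form* is a term generated by $N ::= \nu x_1{:}\tau_1\cdots\nu x_n{:}\tau_n.(A_1\parallel\cdots\parallel A_m)$ with $n,m\ge 0$ (the composition being $\mathbf 0$ if $m=0$), where each $A_i$ is $\Sigma$ or $!\Sigma$ with $\Sigma=\pi_1.N_1+\dots+\pi_k.N_k$, $k\ge1$, such that each name is bound at most once and no name is both free and bound. We write it $\nu X.\prod_{i\in I}A_i$. **Reduction.** $P\to Q$ if either $P\equiv\nu W.(S\parallel R\parallel C)$, a normal form, with $S=\bar a\langle b\rangle.\nu Y_s.S'+M_s$ and $R=a(x).\nu Y_r.R'+M_r$, and $Q\equiv\nu W\,Y_s\,Y_r.(S'\parallel R'\{b/x\}\parallel C)$; or $P\equiv\nu W.(\boldsymbol\tau.\nu Y.P'\parallel C)$, a normal form, and $Q\equiv\nu W\,Y.(P'\parallel C)$. (Here $M_s$, $M_r$, $C$ may be empty, and $\nu Y_s.S'$, $\nu Y_r.R'$, $\nu Y.P'$ are the normal-form continuations, with $S',R',P'$ parallel compositions of sequential terms.) **$\mathcal T$-shapedness.** The labelled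 forest $\mathrm{forest}(P)$ is defined by: $\mathrm{forest}(\nu x{:}\tau.P)$ is $\mathrm{forest}(P)$ under a new root labelled $(x,\mathrm{base}(\tau))$; $\mathrm{forest}(P_1\parallel P_2)=\mathrm{forest}(P_1)\uplus\mathrm{forest}(P_2)$; $\mathrm{forest}(\mathbf 0)=\emptyset$; and $\mathrm{forest}(A)$ is a single node labelled $A$ for any other sequential $A$. A term $P$ is *$\mathcal T$-compatible* if there is $P'\equiv P$ such that, for every path of $\mathrm{forest}(P')$, oriented from parent to child and with label sequence $(x_1,t_1)\cdots(x_k,t_k)\,A$ where $A$ is sequential, $t_1<t_2<\dots<t_k$. A term is *$\mathcal T$-shaped* if each of its subterms, including those under prefixes, is $\mathcal T$-compatible. **Typing.** In $P=\nu X.\prod_{i\in I}A_i$, indices $i,j$ are *linked* if some name restricted in $X$ is free in both $A_i$ and $A_j$; $i$ is *tied to* $j$ if they are related by the reflexive transitive closure of linkedness; a name $y$ is *tied to $A_i$ in $P$* if $y\in\mathrm{fn}(A_j)$ for some $j$ tied to $i$. An *environment* $\Gamma$ is a partial map from names to types; $\Gamma,X$ is the union, defined only when the domains are disjoint. $\mathrm{base}(\Gamma(S))<t$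 means that $\mathrm{base}(\Gamma(z))<t$ for all $z\in S\cap\mathrm{dom}(\Gamma)$. The judgement $\Gamma\vdash P$ on normal forms, together with $\Gamma \vdash A$ on their sequential terms, is defined inductively by: * $\Gamma\vdash\nu X.\prod_{i\in I}A_i$ if, for all $i\in I$, $\Gamma,X\vdash A_i$ and, for each $(x{:}\tau)\in X$ with $x$ tied to $A_i$, $\mathrm{base}(\Gamma(\mathrm{fn}(A_i)))<\mathrm{base}(\tau)$; * $\Gamma\vdash\sum_i\pi_i.P_i$ if $\Gamma\vdash\pi_i.P_i$ for all $i$; $\Gamma\vdash{!A}$ if $\Gamma\vdash A$; $\Gamma\vdash\boldsymbol\tau.P$ if $\Gamma\vdash P$; * $\Gamma\vdash\bar a\langle b\rangle.P$ if $\Gamma(a)=t[\sigma]$ and $\Gamma(b)=\sigma$ for some $t,\sigma$, and $\Gamma\vdash P$; * $\Gamma\vdash a(x).P$, with $P=\nu X.\prod_{i\in I}A_i$, if $\Gamma(a)=t[\sigma]$ for some $t,\sigma$ such that $\Gamma,x{:}\sigma\vdash P$ and either $\mathrm{base}(\sigma)\le t$, or $\mathrm{base}(\Gamma(\mathrm{fn}(A_i)\setminus\{a\}))<t$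 for every $i\in I$ such that $x$ is tied to $A_i$ in $P$ (that is, $A_i$ is *migratable* in $a(x).P$). $\Gamma$ is *$P$-safe* if $\mathrm{base}(\Gamma(x))<\mathrm{base}(\tau)$ for each $x\in\mathrm{fn}(P)$ and each restriction $\nu y{:}\tau$ occurring anywhere in $P$. **Theorem (Invariance of $\mathcal T$-shapedness).** Let $P$ and $Q$ be annotated normal forms with $P\to Q$, and let $\Gamma$ be a $P$-safe environment with $\Gamma\vdash P$. If $P$ is $\mathcal T$-shaped, then $Q$ is $\mathcal T$-shaped. -/

import Mathlib

namespace HPi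

universe u v

/-! Base types and types -/

/-- A rooted forest on the set of nodes `𝒯`: `parent t` is the parent of `t`, undefined on roots. -/
structure RootedForest (𝒯 : Type v) where
  parent : 𝒯 → Option 𝒯
  acyclic : ∀ t, ¬ Relation.TransGen (fun s u => parent u = some s) t t

/-- `s` is the parent of `t`. -/
def RootedForest.IsParent {𝒯 : Type v} (F : RootedForest 𝒯) (s t : 𝒯) : Prop :=
  F.parent t = some s

/-- The transitive closure of the parent relation (ancestors are smaller). -/
def RootedForest.lt {𝒯 : Type v} (F : RootedForest 𝒯) : 𝒯 → 𝒯 → Prop :=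
  Relation.TransGen F.IsParent

/-- The reflexive transitive closure of the parent relation. -/
def RootedForest.le {𝒯 : Type v} (F : RootedForest 𝒯) : 𝒯 → 𝒯 → Prop :=
  Relation.ReflTransGen F.IsParent

/-- Types `τ ::= t | t[τ]` over the base types `t : 𝒯`. -/
inductive Ty (𝒯 : Type v) : Type v
  | name (t : 𝒯) : Ty 𝒯
  | chan (t : 𝒯) (τ : Ty 𝒯) : Ty 𝒯

def Ty.base {𝒯 : Type v} : Ty 𝒯 → 𝒯
  | .name t => t
  | .chan t _ => t

/-! Annotated terms of the π-calculus with guarded replication -/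

/-- Prefixes: input `a(x)`, output `a⟨b⟩` and the silent action. -/
inductive Prefix (𝒩 : Type u) : Type u
  | inp (a x : 𝒩) : Prefix 𝒩
  | out (a b : 𝒩) : Prefix 𝒩
  | tau : Prefix 𝒩

mutual

/-- Processes `P ::= νx:τ.P | P ∥ P | M | !M`. -/
inductive Proc (𝒩 : Type u) (𝒯 : Type v) : Type (max u v)
  | res (x : 𝒩) (τ : Ty 𝒯) (P : Proc 𝒩 𝒯) : Proc 𝒩 𝒯
  | par (P Q : Proc 𝒩 𝒯) : Proc 𝒩 𝒯
  | sum (M : Choice 𝒩 𝒯) : Proc 𝒩 𝒯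
  | repl (M : Choice 𝒩 𝒯) : Proc 𝒩 𝒯

/-- Choices `M ::= 0 | M + M | π.P`. -/
inductive Choice (𝒩 : Type u) (𝒯 : Type v) : Type (max u v)
  | zero : Choice 𝒩 𝒯
  | plus (M M' : Choice 𝒩 𝒯) : Choice 𝒩 𝒯
  | pre (p : Prefix 𝒩) (P : Proc 𝒩 𝒯) : Choice 𝒩 𝒯

end

variable {𝒩 : Type u} {𝒯 : Type v}

/-- The inactive process `0`. -/
def Proc.nil : Proc 𝒩 𝒯 := .sum .zero

/-- `νX.P` for a list `X` of type assignments. -/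
def Proc.ress (X : List (𝒩 × Ty 𝒯)) (P : Proc 𝒩 𝒯) : Proc 𝒩 𝒯 :=
  X.foldr (fun p Q => .res p.1 p.2 Q) P

/-- `A₁ ∥ ⋯ ∥ Aₘ`, which is `0` for the empty list. -/
def Proc.prod : List (Proc 𝒩 𝒯) → Proc 𝒩 𝒯
  | [] => .nil
  | [A] => A
  | A :: B :: L => .par A (Proc.prod (B :: L))

/-- `M₁ + ⋯ + Mₙ`, which is `0` for the empty list. -/
def Choice.sums : List (Choice 𝒩 𝒯) → Choice 𝒩 𝒯
  | [] => .zero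
  | [M] => M
  | M :: M' :: L => .plus M (Choice.sums (M' :: L))

mutual

/-- All binding occurrences, by restrictions and by inputs, listed with multiplicity. -/
def Proc.binders : Proc 𝒩 𝒯 → List 𝒩
  | .res x _ P => x :: P.binders
  | .par P Q => P.binders ++ Q.binders
  | .sum M => M.binders
  | .repl M => M.binders

def Choice.binders : Choice 𝒩 𝒯 → List 𝒩
  | .zero => []
  | .plus M M' => M.binders ++ M'.binders
  | .pre (.inp _ x) P => x :: P.binders
  | .pre (.out _ _) P => P.binders
  | .pre .tau P => P.binders

end

mutual

/-- All names bound by restrictions, active or not, with their type annotations. -/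
def Proc.bnRes : Proc 𝒩 𝒯 → List (𝒩 × Ty 𝒯)
  | .res x τ P => (x, τ) :: P.bnRes
  | .par P Q => P.bnRes ++ Q.bnRes
  | .sum M => M.bnRes
  | .repl M => M.bnRes

def Choice.bnRes : Choice 𝒩 𝒯 → List (𝒩 × Ty 𝒯)
  | .zero => []
  | .plus M M' => M.bnRes ++ M'.bnRes
  | .pre _ P => P.bnRes

end

mutual

/-- The process subterms of a process, itself included, also those under prefixes. -/
def Proc.subterms : Proc 𝒩 𝒯 → Set (Proc 𝒩 𝒯)
  | .res x τ P => {.res x τ P} ∪ P.subterms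
  | .par P Q => {.par P Q} ∪ P.subterms ∪ Q.subterms
  | .sum M => M.subterms
  | .repl M => {.repl M} ∪ M.subterms

def Choice.subterms : Choice 𝒩 𝒯 → Set (Proc 𝒩 𝒯)
  | .zero => {.sum .zero}
  | .plus M M' => {.sum (.plus M M')} ∪ M.subterms ∪ M'.subterms
  | .pre p P => {.sum (.pre p P)} ∪ P.subterms

end

section Names

variable [DecidableEq 𝒩]

mutual

/-- Free names. -/
def Proc.fn : Proc 𝒩 𝒯 → Finset 𝒩
  | .res x _ P => P.fn \ {x}
  | .par P Q => P.fn ∪ Q.fn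
  | .sum M => M.fn
  | .repl M => M.fn

def Choice.fn : Choice 𝒩 𝒯 → Finset 𝒩
  | .zero => ∅
  | .plus M M' => M.fn ∪ M'.fn
  | .pre (.inp a x) P => {a} ∪ (P.fn \ {x})
  | .pre (.out a b) P => {a, b} ∪ P.fn
  | .pre .tau P => P.fn

end

/-- Bound names. -/
def Proc.bn (P : Proc 𝒩 𝒯) : Finset 𝒩 := P.binders.toFinset

/-- Replace the name `x` by `y`. -/
def substName (x y z : 𝒩) : 𝒩 := if z = x then y else z

mutual

/-- `P{y/x}`: replace the free occurrences of `x` by `y`. It is only applied where `y` is not a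
bound name of `P`, so that no capture can occur. -/
def Proc.subst (x y : 𝒩) : Proc 𝒩 𝒯 → Proc 𝒩 𝒯
  | .res z τ P => if z = x then .res z τ P else .res z τ (P.subst x y)
  | .par P Q => .par (P.subst x y) (Q.subst x y)
  | .sum M => .sum (M.subst x y)
  | .repl M => .repl (M.subst x y)

def Choice.subst (x y : 𝒩) : Choice 𝒩 𝒯 → Choice 𝒩 𝒯
  | .zero => .zero
  | .plus M M' => .plus (M.subst x y) (M'.subst x y)
  | .pre (.inp a z) P =>
      .pre (.inp (substName x y a) z) (if z = x then P else P.subst x y)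
  | .pre (.out a b) P => .pre (.out (substName x y a) (substName x y b)) (P.subst x y)
  | .pre .tau P => .pre .tau (P.subst x y)

end

/-! Structural congruence -/

mutual

/-- Structural congruence on processes: the smallest congruence containing the laws below. -/
inductive Proc.SC : Proc 𝒩 𝒯 → Proc 𝒩 𝒯 → Prop
  | refl (P : Proc 𝒩 𝒯) : Proc.SC P P
  | symm {P Q : Proc 𝒩 𝒯} : Proc.SC P Q → Proc.SC Q P
  | trans {P Q R : Proc 𝒩 𝒯} : Proc.SC P Q → Proc.SC Q R → Proc.SC P R
  | res_congr (x : 𝒩) (τ : Ty 𝒯) {P Q : Proc 𝒩 𝒯} :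
      Proc.SC P Q → Proc.SC (.res x τ P) (.res x τ Q)
  | par_congr {P P' Q Q' : Proc 𝒩 𝒯} :
      Proc.SC P P' → Proc.SC Q Q' → Proc.SC (.par P Q) (.par P' Q')
  | sum_congr {M M' : Choice 𝒩 𝒯} : Choice.SC M M' → Proc.SC (.sum M) (.sum M')
  | repl_congr {M M' : Choice 𝒩 𝒯} : Choice.SC M M' → Proc.SC (.repl M) (.repl M')
  | res_alpha (x y : 𝒩) (τ : Ty 𝒯) (P : Proc 𝒩 𝒯) : y ∉ P.fn → y ∉ P.bn →
      Proc.SC (.res x τ P) (.res y τ (P.subst x y))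
  | par_comm (P Q : Proc 𝒩 𝒯) : Proc.SC (.par P Q) (.par Q P)
  | par_assoc (P Q R : Proc 𝒩 𝒯) : Proc.SC (.par (.par P Q) R) (.par P (.par Q R))
  | par_nil (P : Proc 𝒩 𝒯) : Proc.SC (.par P .nil) P
  | res_nil (x : 𝒩) (τ : Ty 𝒯) : Proc.SC (.res x τ .nil) .nil
  | res_swap (x y : 𝒩) (τ σ : Ty 𝒯) (P : Proc 𝒩 𝒯) : x ≠ y →
      Proc.SC (.res x τ (.res y σ P)) (.res y σ (.res x τ P))
  | repl_zero : Proc.SC (.repl .zero) .nil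
  | repl_unfold (M : Choice 𝒩 𝒯) : Proc.SC (.repl M) (.par (.sum M) (.repl M))
  | extrude (x : 𝒩) (τ : Ty 𝒯) (P Q : Proc 𝒩 𝒯) : x ∉ P.fn →
      Proc.SC (.par P (.res x τ Q)) (.res x τ (.par P Q))

/-- Structural congruence on choices. -/
inductive Choice.SC : Choice 𝒩 𝒯 → Choice 𝒩 𝒯 → Prop
  | refl (M : Choice 𝒩 𝒯) : Choice.SC M M
  | symm {M M' : Choice 𝒩 𝒯} : Choice.SC M M' → Choice.SC M' M
  | trans {M M' M'' : Choice 𝒩 𝒯} : Choice.SC M M' → Choice.SC M' M'' → Choice.SC M M''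
  | plus_congr {M M' L L' : Choice 𝒩 𝒯} :
      Choice.SC M M' → Choice.SC L L' → Choice.SC (.plus M L) (.plus M' L')
  | pre_congr (p : Prefix 𝒩) {P Q : Proc 𝒩 𝒯} :
      Proc.SC P Q → Choice.SC (.pre p P) (.pre p Q)
  | inp_alpha (a x y : 𝒩) (P : Proc 𝒩 𝒯) : y ∉ P.fn → y ∉ P.bn →
      Choice.SC (.pre (.inp a x) P) (.pre (.inp a y) (P.subst x y))
  | plus_comm (M L : Choice 𝒩 𝒯) : Choice.SC (.plus M L) (.plus L M)
  | plus_assoc (M L K : Choice 𝒩 𝒯) :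
      Choice.SC (.plus (.plus M L) K) (.plus M (.plus L K))
  | plus_zero (M : Choice 𝒩 𝒯) : Choice.SC (.plus M .zero) M

end

/-! Normal forms -/

/-- Each name is bound at most once, and no name is both free and bound. -/
def Proc.NameUniq (P : Proc 𝒩 𝒯) : Prop :=
  P.binders.Nodup ∧ Disjoint P.fn P.bn

end Names

mutual

/-- The grammar `N ::= νx₁⋯νxₙ.(A₁ ∥ ⋯ ∥ Aₘ)` with `n, m ≥ 0`, where the parallel composition may
be bracketed in any way and is `0` for `m = 0`. -/
inductive Proc.NFGrammar : Proc 𝒩 𝒯 → Prop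
  | nil : Proc.NFGrammar .nil
  | prod {P : Proc 𝒩 𝒯} : Proc.NFProd P → Proc.NFGrammar P
  | res (x : 𝒩) (τ : Ty 𝒯) {P : Proc 𝒩 𝒯} : Proc.NFGrammar P → Proc.NFGrammar (.res x τ P)

/-- `A₁ ∥ ⋯ ∥ Aₘ` with `m ≥ 1`, where each `Aᵢ` is `Σ` or `!Σ` for a guarded sum `Σ`. -/
inductive Proc.NFProd : Proc 𝒩 𝒯 → Prop
  | sum {M : Choice 𝒩 𝒯} : Choice.NFSum M → Proc.NFProd (.sum M)
  | repl {M : Choice 𝒩 𝒯} : Choice.NFSum M → Proc.NFProd (.repl M)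
  | par {P Q : Proc 𝒩 𝒯} : Proc.NFProd P → Proc.NFProd Q → Proc.NFProd (.par P Q)

/-- Guarded sums `π₁.N₁ + ⋯ + πₙ.Nₙ` with `n ≥ 1`. -/
inductive Choice.NFSum : Choice 𝒩 𝒯 → Prop
  | pre (p : Prefix 𝒩) {P : Proc 𝒩 𝒯} : Proc.NFGrammar P → Choice.NFSum (.pre p P)
  | plus {M M' : Choice 𝒩 𝒯} : Choice.NFSum M → Choice.NFSum M' → Choice.NFSum (.plus M M')

end

/-- The leading restrictions `X` of a normal form `νX.∏ᵢ Aᵢ`. -/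
def Proc.restrs : Proc 𝒩 𝒯 → List (𝒩 × Ty 𝒯)
  | .res x τ P => (x, τ) :: P.restrs
  | _ => []

/-- The part of a process below its leading restrictions. -/
def Proc.body : Proc 𝒩 𝒯 → Proc 𝒩 𝒯
  | .res _ _ P => P.body
  | P => P

/-- The factors of a parallel composition, where `0` is the empty composition. -/
def Proc.factors : Proc 𝒩 𝒯 → List (Proc 𝒩 𝒯)
  | .par P Q => P.factors ++ Q.factors
  | .sum .zero => []
  | P => [P]

/-- The sequential terms `A₁, …, Aₘ` of a normal form `νX.∏ᵢ Aᵢ`. -/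
def Proc.comps (P : Proc 𝒩 𝒯) : List (Proc 𝒩 𝒯) := P.body.factors

/-- The indices of the sequential terms of a normal form. -/
abbrev Proc.Idx (P : Proc 𝒩 𝒯) : Type := Fin P.comps.length

/-- The sequential term `Aᵢ` of a normal form. -/
def Proc.comp (P : Proc 𝒩 𝒯) (i : P.Idx) : Proc 𝒩 𝒯 := P.comps.get i

section Semantics

variable [DecidableEq 𝒩]

/-- Normal forms; they satisfy the name uniqueness assumption. -/
def Proc.IsNormalForm (P : Proc 𝒩 𝒯) : Prop := P.NFGrammar ∧ P.NameUniq

/-! Reduction -/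

/-- The reduction relation. With `Nₛ = νYₛ.S'` and `Nᵣ = νYᵣ.R'`, a synchronisation takes
`νW.((a⟨b⟩.Nₛ + Mₛ) ∥ (a(x).Nᵣ + Mᵣ) ∥ C)` to `νW Yₛ Yᵣ.(S' ∥ R'{b/x} ∥ C)`, and
with `N = νY.P'` a silent action takes `νW.(τ.N ∥ C)` to `νW Y.(P' ∥ C)`. -/
inductive Proc.Step : Proc 𝒩 𝒯 → Proc 𝒩 𝒯 → Prop
  | comm {P Q : Proc 𝒩 𝒯} (W : List (𝒩 × Ty 𝒯)) (a b x : 𝒩) (Ns Nr : Proc 𝒩 𝒯)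
      (Ms Mr : List (Choice 𝒩 𝒯)) (C : List (Proc 𝒩 𝒯)) (P₀ : Proc 𝒩 𝒯) :
      P₀ = .ress W (.prod (
        .sum (.sums (.pre (.out a b) Ns :: Ms)) :: .sum (.sums (.pre (.inp a x) Nr :: Mr)) :: C)) →
      P₀.IsNormalForm → Proc.SC P P₀ →
      Proc.SC Q (.ress (W ++ Ns.restrs ++ Nr.restrs)
        (.prod (Ns.comps ++ Nr.comps.map (Proc.subst x b) ++ C))) →
      Proc.Step P Q
  | tau {P Q : Proc 𝒩 𝒯} (W : List (𝒩 × Ty 𝒯)) (N : Proc 𝒩 𝒯) (C : List (Proc 𝒩 𝒯))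
      (P₀ : Proc 𝒩 𝒯) :
      P₀ = .ress W (.prod (.sum (.pre .tau N) :: C)) →
      P₀.IsNormalForm → Proc.SC P P₀ →
      Proc.SC Q (.ress (W ++ N.restrs) (.prod (N.comps ++ C))) →
      Proc.Step P Q

end Semantics

/-! Labelled forests -/

/-- Finite `L`-labelled forests: the empty forest, disjoint unions `φ₁ ⊎ φ₂`, and `l[φ]`, which
adds to `φ` a common root labelled `l`. -/
inductive LForest (L : Type u) : Type u
  | empty : LForest L
  | union (φ₁ φ₂ : LForest L) : LForest L
  | node (l : L) (φ : LForest L) : LForest L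

/-- The traces of the (nonempty) paths that start at a root. -/
inductive LForest.IsRootTrace {L : Type u} : LForest L → List L → Prop
  | single (l : L) (φ : LForest L) : IsRootTrace (.node l φ) [l]
  | cons (l : L) {φ : LForest L} {s : List L} :
      IsRootTrace φ s → IsRootTrace (.node l φ) (l :: s)
  | left {φ₁ : LForest L} (φ₂ : LForest L) {s : List L} :
      IsRootTrace φ₁ s → IsRootTrace (.union φ₁ φ₂) s
  | right (φ₁ : LForest L) {φ₂ : LForest L} {s : List L} :
      IsRootTrace φ₂ s → IsRootTrace (.union φ₁ φ₂) s

/-- The traces of all (nonempty) paths. -/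
inductive LForest.IsTrace {L : Type u} : LForest L → List L → Prop
  | root {φ : LForest L} {s : List L} : φ.IsRootTrace s → IsTrace φ s
  | under (l : L) {φ : LForest L} {s : List L} : IsTrace φ s → IsTrace (.node l φ) s
  | left {φ₁ : LForest L} (φ₂ : LForest L) {s : List L} :
      IsTrace φ₁ s → IsTrace (.union φ₁ φ₂) s
  | right (φ₁ : LForest L) {φ₂ : LForest L} {s : List L} :
      IsTrace φ₂ s → IsTrace (.union φ₁ φ₂) s

/-- Labels of the forest of a term: names with base types, or sequential terms. -/
abbrev Label (𝒩 : Type u) (𝒯 : Type v) : Type (max u v) := (𝒩 × 𝒯) ⊕ Proc 𝒩 𝒯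

/-- The forest of a term. -/
def Proc.forest : Proc 𝒩 𝒯 → LForest (Label 𝒩 𝒯)
  | .res x τ P => .node (.inl (x, τ.base)) P.forest
  | .par P Q => .union P.forest Q.forest
  | .sum .zero => .empty
  | .sum M => .node (.inr (.sum M)) .empty
  | .repl M => .node (.inr (.repl M)) .empty

/-- The set of the forests of all terms structurally congruent to `P`. -/
def Proc.forests [DecidableEq 𝒩] (P : Proc 𝒩 𝒯) : Set (LForest (Label 𝒩 𝒯)) :=
  {φ | ∃ Q : Proc 𝒩 𝒯, Proc.SC Q P ∧ φ = Q.forest}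

/-- For every trace `(x₁,t₁) ⋯ (xₖ,tₖ) A` with `A` sequential, `t₁ < ⋯ < tₖ`. -/
def RootedForest.ForestCompatible (F : RootedForest 𝒯) (φ : LForest (Label 𝒩 𝒯)) : Prop :=
  ∀ (s : List (𝒩 × 𝒯)) (A : Proc 𝒩 𝒯),
    φ.IsTrace (s.map Sum.inl ++ [Sum.inr A]) → List.IsChain F.lt (s.map Prod.snd)

/-- `𝒯`-compatible terms. -/
def RootedForest.Compatible [DecidableEq 𝒩] (F : RootedForest 𝒯) (P : Proc 𝒩 𝒯) : Prop :=
  ∃ φ ∈ P.forests, F.ForestCompatible φ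

/-- `𝒯`-shaped terms. -/
def RootedForest.Shaped [DecidableEq 𝒩] (F : RootedForest 𝒯) (P : Proc 𝒩 𝒯) : Prop :=
  ∀ R ∈ P.subterms, F.Compatible R

/-! The type system -/

/-- Type environments: partial maps from names to types. -/
abbrev Env (𝒩 : Type u) (𝒯 : Type v) : Type (max u v) := 𝒩 → Option (Ty 𝒯)

section Typing

variable [DecidableEq 𝒩]

/-- `Γ, X`, used where no name of `X` is in the domain of `Γ`. -/
def Env.extend (Γ : Env 𝒩 𝒯) (X : List (𝒩 × Ty 𝒯)) : Env 𝒩 𝒯 :=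
  X.foldr (fun p Δ => Function.update Δ p.1 (some p.2)) Γ

/-- No name of `X` is in the domain of `Γ`. -/
def Env.Avoids (Γ : Env 𝒩 𝒯) (X : List (𝒩 × Ty 𝒯)) : Prop := ∀ p ∈ X, Γ p.1 = none

/-- `base(Γ(S)) < t`: the types that `Γ` assigns to names in `S` have base types below `t`. -/
def RootedForest.BaseBelow (F : RootedForest 𝒯) (Γ : Env 𝒩 𝒯) (S : Finset 𝒩) (t : 𝒯) : Prop :=
  ∀ z ∈ S, ∀ σ, Γ z = some σ → F.lt σ.base t

/-- `Aᵢ` is linked to `Aⱼ` in the normal form `P`: they share a name restricted by `P`. -/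
def Proc.Linked (P : Proc 𝒩 𝒯) (i j : P.Idx) : Prop :=
  ∃ x ∈ (P.comp i).fn ∩ (P.comp j).fn, x ∈ P.restrs.map Prod.fst

/-- `Aᵢ` is tied to `Aⱼ` in `P`; every `Aᵢ` is tied to itself. -/
def Proc.Tied (P : Proc 𝒩 𝒯) : P.Idx → P.Idx → Prop := Relation.ReflTransGen P.Linked

/-- The name `y` is tied to `Aᵢ` in `P`. -/
def Proc.NameTied (P : Proc 𝒩 𝒯) (y : 𝒩) (i : P.Idx) : Prop :=
  ∃ j : P.Idx, y ∈ (P.comp j).fn ∧ P.Tied j i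

/-- `Aᵢ` is migratable in the input-prefixed term `a(y).P`. -/
def Proc.Migratable (y : 𝒩) (P : Proc 𝒩 𝒯) (i : P.Idx) : Prop := P.NameTied y i

mutual

/-- `Γ ⊢ νX.∏ᵢ Aᵢ`. -/
inductive RootedForest.TypesProc (F : RootedForest 𝒯) : Env 𝒩 𝒯 → Proc 𝒩 𝒯 → Prop
  | par {Γ : Env 𝒩 𝒯} {P : Proc 𝒩 𝒯} :
      Γ.Avoids P.restrs →
      (∀ i : P.Idx, RootedForest.TypesSeq F (Γ.extend P.restrs) (P.comp i)) →
      (∀ i : P.Idx, ∀ p ∈ P.restrs, P.NameTied p.1 i → F.BaseBelow Γ (P.comp i).fn p.2.base) →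
      RootedForest.TypesProc F Γ P

/-- `Γ ⊢ A` for a sequential term `A`. -/
inductive RootedForest.TypesSeq (F : RootedForest 𝒯) : Env 𝒩 𝒯 → Proc 𝒩 𝒯 → Prop
  | sum {Γ : Env 𝒩 𝒯} {M : Choice 𝒩 𝒯} :
      RootedForest.TypesChoice F Γ M → RootedForest.TypesSeq F Γ (.sum M)
  | repl {Γ : Env 𝒩 𝒯} {M : Choice 𝒩 𝒯} :
      RootedForest.TypesChoice F Γ M → RootedForest.TypesSeq F Γ (.repl M)

/-- `Γ ⊢ π₁.P₁ + ⋯ + πₙ.Pₙ`: every summand is typable. -/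
inductive RootedForest.TypesChoice (F : RootedForest 𝒯) : Env 𝒩 𝒯 → Choice 𝒩 𝒯 → Prop
  | plus {Γ : Env 𝒩 𝒯} {M M' : Choice 𝒩 𝒯} :
      RootedForest.TypesChoice F Γ M → RootedForest.TypesChoice F Γ M' →
      RootedForest.TypesChoice F Γ (.plus M M')
  | tau {Γ : Env 𝒩 𝒯} {P : Proc 𝒩 𝒯} :
      RootedForest.TypesProc F Γ P → RootedForest.TypesChoice F Γ (.pre .tau P)
  | out {Γ : Env 𝒩 𝒯} {a b : 𝒩} {t : 𝒯} {τ : Ty 𝒯} {P : Proc 𝒩 𝒯} :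
      Γ a = some (.chan t τ) → Γ b = some τ → RootedForest.TypesProc F Γ P →
      RootedForest.TypesChoice F Γ (.pre (.out a b) P)
  | inp {Γ : Env 𝒩 𝒯} {a x : 𝒩} {t : 𝒯} {τ : Ty 𝒯} {P : Proc 𝒩 𝒯} :
      Γ a = some (.chan t τ) → Γ.Avoids [(x, τ)] →
      RootedForest.TypesProc F (Γ.extend [(x, τ)]) P →
      (F.le τ.base t ∨
        ∀ i : P.Idx, P.Migratable x i → F.BaseBelow Γ ((P.comp i).fn \ {a}) t) →
      RootedForest.TypesChoice F Γ (.pre (.inp a x) P)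

end

/-- `Γ` is `P`-safe: the types of the free names of `P` have base types below those of the
annotations of all restrictions in `P`. -/
def RootedForest.Safe (F : RootedForest 𝒯) (Γ : Env 𝒩 𝒯) (P : Proc 𝒩 𝒯) : Prop :=
  ∀ p ∈ P.bnRes, F.BaseBelow Γ P.fn p.2.base

end Typing

end HPi

/-!
Compatibility of a term can be read off from a graph that structural congruence does not change.
Consider the graph of a term: its vertices are the active restrictions, and two of them are
adjacent if they are free in a common sequential term. In every arrangement of the term as a
forest, the free restrictions of a sequential term are on the path to it, so a nonempty connected
set `Y` of restrictions has a member above all others. Hence compatibility implies that every such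
`Y` has an element whose base type is strictly below all others (`RootedForest.HasLeast`,
`RootedForest.ForestCompatible.good`). Conversely, if all connected sets have such a least
element, the restrictions can be put back one by one, by decreasing base types, each of them above
exactly the clusters in which it is free; the result is a compatible arrangement
(`RootedForest.HasLeast.exists_clusters`). So a normal form is shaped if and only if the graphs of
the term and of all its continuations have this property (`Proc.IsNormalForm.shaped`).

All notions used for this transfer (which names are joined by active restrictions, typing, the
graph of a term, and the property of the graphs of continuations) are defined by recursion on
arbitrary terms and are invariant under structural congruence (`SCInvariant`). This allows for
replacing both sides of a reduction step by the normal forms that exhibit the redex.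

The step itself is a statement about graphs (`RootedForest.HasLeast.comm`). Two things happen. The
restrictions of the continuations become active: by typing, each of them lies above the old names
that it gets joined to, so the least element of the old part of a connected set remains least
(`RootedForest.HasLeast.attach`). And, as `b` is substituted for `x`, the name `b` becomes
adjacent to the names `v` in migratable parts of the receiver (`RootedForest.HasLeast.join`). Both
`b` and `v` are already adjacent to the channel `a`, since `a` and `b` are free in the sender and
`a` and `v` are free in the receiver. Thus a set that is connected after the step becomes
connected in the old graph when `a` is added to it. The least element of the enlarged set is not
`a`, since the typing rule for inputs provides `base b ≤ base a` or `base v < base a`; so it is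
least in the set itself. If `a` were not restricted, the same inequality would contradict the
safety of the environment.
-/

namespace HPi

universe u v

/-! ### Walks and least elements -/

section Walks

variable {α : Type*} {G G' : α → α → Prop} {Y Y' : Set α} {u v w x : α}

/-- `Walk G Y u v`: there is a nonempty `G`-walk from `u` to `v` all of whose inner vertices are in
`Y`; the end points are arbitrary. -/
inductive Walk (G : α → α → Prop) (Y : Set α) : α → α → Prop
  | edge {u v : α} : G u v → Walk G Y u v
  | step {u w v : α} : G u w → w ∈ Y → Walk G Y w v → Walk G Y u v

theorem Walk.trans (h : Walk G Y u w) (hw : w ∈ Y) (h' : Walk G Y w v) : Walk G Y u v := by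
  induction h with
  | edge h => exact .step h hw h'
  | step h hm _ ih => exact .step h hm (ih hw h')

/-- Each edge of a walk may be replaced by a walk. -/
theorem Walk.bind (h : Walk G Y u v) (hu : u ∈ Y) (hv : v ∈ Y) (hY : Y ⊆ Y')
    (hG : ∀ a ∈ Y, ∀ b ∈ Y, G a b → Walk G' Y' a b) : Walk G' Y' u v := by
  induction h with
  | edge h => exact hG _ hu _ hv h
  | step h hm _ ih => exact (hG _ hu _ hm h).trans (hY hm) (ih hm hv)

theorem Walk.mono (h : Walk G Y u v) (hG : ∀ a b, G a b → G' a b) (hY : Y ⊆ Y') :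
    Walk G' Y' u v := by
  induction h with
  | edge h => exact .edge (hG _ _ h)
  | step h hm _ ih => exact .step (hG _ _ h) (hY hm) ih

theorem Walk.exists_left (h : Walk G Y u v) : ∃ w, G u w := by
  cases h with
  | edge h => exact ⟨_, h⟩
  | step h _ _ => exact ⟨_, h⟩

theorem Walk.exists_right (h : Walk G Y u v) : ∃ w, G w v := by
  induction h with
  | edge h => exact ⟨_, h⟩
  | step _ _ _ ih => exact ih

theorem Walk.symm (hG : ∀ a b, G a b → G b a) (h : Walk G Y u v) : Walk G Y v u := by
  induction h with
  | edge h => exact .edge (hG _ _ h)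
  | step h hm _ ih => exact ih.trans hm (.edge (hG _ _ h))

theorem walk_empty : Walk G ∅ u v ↔ G u v := by
  refine ⟨fun h => ?_, .edge⟩
  cases h with
  | edge h => exact h
  | step _ hm _ => exact hm.elim

theorem walk_insert :
    Walk G (insert x Y) u v ↔ Walk G Y u v ∨ (Walk G Y u x ∧ Walk G Y x v) := by
  constructor
  · intro h
    induction h with
    | edge h => exact .inl (.edge h)
    | step h hm _ ih =>
      rcases hm with rfl | hm
      · exact .inr ⟨.edge h, ih.elim id And.right⟩
      · exact ih.imp (.step h hm) fun ⟨h₁, h₂⟩ => ⟨.step h hm h₁, h₂⟩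
  · have hs : Y ⊆ insert x Y := Set.subset_insert x Y
    rintro (h | ⟨h₁, h₂⟩)
    · exact h.mono (fun _ _ => id) hs
    · exact (h₁.mono (fun _ _ => id) hs).trans (Set.mem_insert x Y) (h₂.mono (fun _ _ => id) hs)

/-- `Y` is connected in the graph `G`, and no vertex of `Y` is isolated. -/
def Connected (G : α → α → Prop) (Y : Set α) : Prop := ∀ u ∈ Y, ∀ v ∈ Y, Walk G Y u v

variable {𝒯 : Type v}

/-- Every nonempty connected set of vertices in `X` has a vertex whose base type is strictly below
those of the other ones. For the graph of a term, whose vertices are the active restrictions,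
this characterises `𝒯`-compatibility. -/
def RootedForest.HasLeast (F : RootedForest 𝒯) (ty : α → 𝒯) (X : Set α) (G : α → α → Prop) : Prop :=
  ∀ Y ⊆ X, Y.Nonempty → Connected G Y → ∃ m ∈ Y, ∀ y ∈ Y, y ≠ m → F.lt (ty m) (ty y)

variable {F : RootedForest 𝒯} {ty : α → 𝒯} {X X' : Set α}

theorem RootedForest.lt_irrefl (F : RootedForest 𝒯) (t : 𝒯) : ¬ F.lt t t := F.acyclic t

theorem RootedForest.lt_trans (F : RootedForest 𝒯) {s t r : 𝒯} (h : F.lt s t) (h' : F.lt t r) :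
    F.lt s r := Relation.TransGen.trans h h'

theorem RootedForest.lt_of_le_of_lt (F : RootedForest 𝒯) {s t r : 𝒯} (h : F.le s t)
    (h' : F.lt t r) : F.lt s r := Relation.TransGen.trans_right h h'

theorem RootedForest.HasLeast.mono (h : F.HasLeast ty X G) (hX : X' ⊆ X) : F.HasLeast ty X' G :=
  fun Y hY => h Y (hY.trans hX)

/-- Edges that leave `X` are irrelevant. -/
theorem RootedForest.HasLeast.of_edges (h : F.HasLeast ty X G)
    (hG : ∀ u ∈ X, ∀ v ∈ X, G' u v → G u v) : F.HasLeast ty X G' := fun Y hY hne hc =>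
  h Y hY hne fun u hu v hv =>
    (hc u hu v hv).bind hu hv subset_rfl fun a ha b hb hab => .edge (hG a (hY ha) b (hY hb) hab)

/-- A graph `G₁` on new vertices `Z` may be attached to a graph `G` on old vertices `W` if every new
vertex lies above the old vertices to which it is joined through new ones. The hypothesis on
the old vertices concerns `G` with the shortcuts that `G₁` adds to it. -/
theorem RootedForest.HasLeast.attach {W Z : Set α} {G₁ : α → α → Prop}
    (hW : F.HasLeast ty W fun u v => G u v ∨ Walk G₁ Z u v) (hZ : F.HasLeast ty Z G₁)
    (hG : ∀ u v, G u v → u ∉ Z ∧ v ∉ Z)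
    (hlt : ∀ y ∈ Z, ∀ z ∈ W, Walk G₁ Z y z → F.lt (ty z) (ty y)) :
    F.HasLeast ty (W ∪ Z) fun u v => G u v ∨ G₁ u v := by
  intro Y hY hne hc
  by_cases hYW : (Y ∩ W).Nonempty
  swap
  · have hYZ : Y ⊆ Z := fun y hy => (hY hy).resolve_left fun h => hYW ⟨y, hy, h⟩
    exact hZ Y hYZ hne fun u hu v hv => (hc u hu v hv).bind hu hv subset_rfl
      fun a ha b hb hab => .edge (hab.resolve_left fun h => (hG a b h).1 (hYZ ha))
  -- A walk towards an old vertex leaves the new vertices at some first old vertex `z`.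
  have key : ∀ u v, Walk (fun u v => G u v ∨ G₁ u v) Y u v → u ∈ Y → v ∈ Y ∩ W →
      (u ∈ W → Walk (fun u v => G u v ∨ Walk G₁ Z u v) (Y ∩ W) u v) ∧
      (u ∈ Z → ∃ z ∈ Y ∩ W, Walk G₁ Z u z ∧
        (z = v ∨ Walk (fun u v => G u v ∨ Walk G₁ Z u v) (Y ∩ W) z v)) := by
    intro u v h
    induction h with
    | edge h =>
      intro hu hv
      refine ⟨fun _ => .edge (h.imp_right .edge), fun huZ => ⟨_, hv, .edge ?_, .inl rfl⟩⟩
      exact h.resolve_left fun h => (hG _ _ h).1 huZ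
    | @step u w v h hw _ ih =>
      intro hu hv
      obtain ⟨ih₁, ih₂⟩ := ih hw hv
      constructor
      · intro huW
        rcases hY hw with hwW | hwZ
        · exact .step (h.imp_right .edge) ⟨hw, hwW⟩ (ih₁ hwW)
        · obtain ⟨z, hz, hwz, hzv⟩ := ih₂ hwZ
          have huw : G₁ u w := h.resolve_left fun h => (hG _ _ h).2 hwZ
          rcases hzv with rfl | hzv
          · exact .edge (.inr (.step huw hwZ hwz))
          · exact .step (.inr (.step huw hwZ hwz)) hz hzv
      · intro huZ
        have huw : G₁ u w := h.resolve_left fun h => (hG _ _ h).1 huZ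
        rcases hY hw with hwW | hwZ
        · exact ⟨w, ⟨hw, hwW⟩, .edge huw, .inr (ih₁ hwW)⟩
        · obtain ⟨z, hz, hwz, hzv⟩ := ih₂ hwZ
          exact ⟨z, hz, .step huw hwZ hwz, hzv⟩
  obtain ⟨m, hm, hmin⟩ := hW (Y ∩ W) Set.inter_subset_right hYW fun u hu v hv =>
    (key u v (hc u hu.1 v hv.1) hu.1 hv).1 hu.2
  refine ⟨m, hm.1, fun y hy hym => ?_⟩
  rcases hY hy with hyW | hyZ
  · exact hmin y ⟨hy, hyW⟩ hym
  · obtain ⟨z, hz, hyz, -⟩ := (key y m (hc y hy m hm.1) hy hm).2 hyZ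
    have hzy := hlt y hyZ z hz.2 hyz
    by_cases hzm : z = m
    · exact hzm ▸ hzy
    · exact F.lt_trans (hmin z hz hzm) hzy

/-- Joining a vertex `b` to new neighbours `N` preserves the existence of least elements if `b`
and all of `N` are neighbours of a vertex `a` such that `b` is not above `a`, or no new neighbour
is: then `a` can be added to a connected set that uses a new edge, and is not its least element.
-/
theorem RootedForest.HasLeast.join {a b : α} {N : Set α} (h : F.HasLeast ty X G)
    (hG : ∀ u v, G u v → G v u) (haa : G a a) (hab : G a b)
    (haN : ∀ v ∈ N, G a v)
    (hG' : ∀ u ∈ X, ∀ v ∈ X, G' u v → G u v ∨ (u = b ∧ v ∈ N) ∨ (v = b ∧ u ∈ N))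
    (hor : (b ∈ X → a ∈ X ∧ ¬ F.lt (ty a) (ty b)) ∨
      ∀ v ∈ X, v ∈ N → v ≠ a → a ∈ X ∧ ¬ F.lt (ty a) (ty v)) :
    F.HasLeast ty X G' := by
  intro Y hY hne hc
  by_cases hnew : b ∈ Y ∧ ∃ v ∈ Y, v ∈ N
  swap
  · refine h Y hY hne fun u hu v hv => (hc u hu v hv).bind hu hv subset_rfl
      fun c hc d hd hcd => .edge ?_
    rcases hG' c (hY hc) d (hY hd) hcd with h | ⟨rfl, h⟩ | ⟨rfl, h⟩
    · exact h
    · exact (hnew ⟨hc, d, hd, h⟩).elim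
    · exact (hnew ⟨hd, c, hc, h⟩).elim
  obtain ⟨hbY, v, hvY, hvN⟩ := hnew
  have haX : a ∈ X := by
    rcases hor with hor | hor
    · exact (hor (hY hbY)).1
    · by_cases hva : v = a
      · exact hva ▸ hY hvY
      · exact (hor v (hY hvY) hvN hva).1
  have hYa : Y ⊆ insert a Y := Set.subset_insert a Y
  have haY : a ∈ insert a Y := Set.mem_insert a Y
  have hYY : ∀ u ∈ Y, ∀ v ∈ Y, Walk G (insert a Y) u v := fun u hu v hv =>
    (hc u hu v hv).bind hu hv hYa fun c hc d hd hcd => by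
      rcases hG' c (hY hc) d (hY hd) hcd with h | ⟨rfl, h⟩ | ⟨rfl, h⟩
      · exact .edge h
      · exact .step (hG _ _ hab) haY (.edge (haN _ h))
      · exact .step (hG _ _ (haN _ h)) haY (.edge hab)
  have haw : ∀ v ∈ Y, Walk G (insert a Y) a v := fun v hv => .step hab (hYa hbY) (hYY b hbY v hv)
  have hcon : Connected G (insert a Y) := by
    rintro u (rfl | hu) v (rfl | hv)
    · exact .edge haa
    · exact haw v hv
    · exact (haw u hu).symm hG
    · exact hYY u hu v hv
  obtain ⟨m, hm, hmin⟩ := h (insert a Y) (Set.insert_subset haX hY) ⟨a, haY⟩ hcon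
  by_cases hmY : m ∈ Y
  · exact ⟨m, hmY, fun y hy => hmin y (hYa hy)⟩
  · obtain rfl : m = a := hm.resolve_right hmY
    have hlt : ∀ y ∈ Y, F.lt (ty m) (ty y) := fun y hy =>
      hmin y (hYa hy) fun h => hmY (h ▸ hy)
    rcases hor with hor | hor
    · exact ((hor (hY hbY)).2 (hlt b hbY)).elim
    · exact ((hor v (hY hvY) hvN fun h => hmY (h ▸ hvY)).2 (hlt v hvY)).elim

end Walks

section

variable {𝒩 : Type u} {𝒯 : Type v} [DecidableEq 𝒩]

/-! ### Invariants of structural congruence -/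

/-- The functions `f` on processes and `g` on choices respect the laws of structural congruence. The
rules for congruence may use that the arguments are congruent, which makes invariants that have been
established before available. -/
structure SCInvariant {α β : Type*} (f : Proc 𝒩 𝒯 → α) (g : Choice 𝒩 𝒯 → β) : Prop where
  res_congr : ∀ x τ (P Q : Proc 𝒩 𝒯), P.SC Q → f P = f Q → f (.res x τ P) = f (.res x τ Q)
  par_congr : ∀ P P' Q Q' : Proc 𝒩 𝒯, f P = f P' → f Q = f Q' → f (.par P Q) = f (.par P' Q')
  sum_congr : ∀ M M' : Choice 𝒩 𝒯, M.SC M' → g M = g M' → f (.sum M) = f (.sum M')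
  repl_congr : ∀ M M' : Choice 𝒩 𝒯, M.SC M' → g M = g M' → f (.repl M) = f (.repl M')
  res_alpha : ∀ x y τ (P : Proc 𝒩 𝒯), y ∉ P.fn → y ∉ P.binders →
    f (.res x τ P) = f (.res y τ (P.subst x y))
  par_comm : ∀ P Q : Proc 𝒩 𝒯, f (.par P Q) = f (.par Q P)
  par_assoc : ∀ P Q R : Proc 𝒩 𝒯, f (.par (.par P Q) R) = f (.par P (.par Q R))
  par_nil : ∀ P : Proc 𝒩 𝒯, f (.par P .nil) = f P
  res_nil : ∀ x τ, f (.res x τ .nil) = f .nil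
  res_swap : ∀ x y τ σ (P : Proc 𝒩 𝒯), x ≠ y →
    f (.res x τ (.res y σ P)) = f (.res y σ (.res x τ P))
  repl_zero : f (.repl .zero) = f .nil
  repl_unfold : ∀ M : Choice 𝒩 𝒯, f (.repl M) = f (.par (.sum M) (.repl M))
  extrude : ∀ x τ (P Q : Proc 𝒩 𝒯), x ∉ P.fn →
    f (.par P (.res x τ Q)) = f (.res x τ (.par P Q))
  plus_congr : ∀ M M' L L' : Choice 𝒩 𝒯, g M = g M' → g L = g L' →
    g (.plus M L) = g (.plus M' L')
  pre_congr : ∀ p (P Q : Proc 𝒩 𝒯), P.SC Q → f P = f Q → g (.pre p P) = g (.pre p Q)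
  inp_alpha : ∀ a x y (P : Proc 𝒩 𝒯), y ∉ P.fn → y ∉ P.binders →
    g (.pre (.inp a x) P) = g (.pre (.inp a y) (P.subst x y))
  plus_comm : ∀ M L : Choice 𝒩 𝒯, g (.plus M L) = g (.plus L M)
  plus_assoc : ∀ M L K : Choice 𝒩 𝒯, g (.plus (.plus M L) K) = g (.plus M (.plus L K))
  plus_zero : ∀ M : Choice 𝒩 𝒯, g (.plus M .zero) = g M

section

variable {α β : Type*} {f : Proc 𝒩 𝒯 → α} {g : Choice 𝒩 𝒯 → β}

mutual

theorem SCInvariant.proc_eq (h : SCInvariant f g) : ∀ {P Q : Proc 𝒩 𝒯}, P.SC Q → f P = f Q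
  | _, _, .refl _ => rfl
  | _, _, .symm h₁ => (h.proc_eq h₁).symm
  | _, _, .trans h₁ h₂ => (h.proc_eq h₁).trans (h.proc_eq h₂)
  | _, _, .res_congr x τ h₁ => h.res_congr x τ _ _ h₁ (h.proc_eq h₁)
  | _, _, .par_congr h₁ h₂ => h.par_congr _ _ _ _ (h.proc_eq h₁) (h.proc_eq h₂)
  | _, _, .sum_congr h₁ => h.sum_congr _ _ h₁ (h.choice_eq h₁)
  | _, _, .repl_congr h₁ => h.repl_congr _ _ h₁ (h.choice_eq h₁)
  | _, _, .res_alpha x y τ P h₁ h₂ => h.res_alpha x y τ P h₁ (mt List.mem_toFinset.2 h₂)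
  | _, _, .par_comm P Q => h.par_comm P Q
  | _, _, .par_assoc P Q R => h.par_assoc P Q R
  | _, _, .par_nil P => h.par_nil P
  | _, _, .res_nil x τ => h.res_nil x τ
  | _, _, .res_swap x y τ σ P h₁ => h.res_swap x y τ σ P h₁
  | _, _, .repl_zero => h.repl_zero
  | _, _, .repl_unfold M => h.repl_unfold M
  | _, _, .extrude x τ P Q h₁ => h.extrude x τ P Q h₁

theorem SCInvariant.choice_eq (h : SCInvariant f g) :
    ∀ {M M' : Choice 𝒩 𝒯}, M.SC M' → g M = g M'
  | _, _, .refl _ => rfl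
  | _, _, .symm h₁ => (h.choice_eq h₁).symm
  | _, _, .trans h₁ h₂ => (h.choice_eq h₁).trans (h.choice_eq h₂)
  | _, _, .plus_congr h₁ h₂ => h.plus_congr _ _ _ _ (h.choice_eq h₁) (h.choice_eq h₂)
  | _, _, .pre_congr p h₁ => h.pre_congr p _ _ h₁ (h.proc_eq h₁)
  | _, _, .inp_alpha a x y P h₁ h₂ => h.inp_alpha a x y P h₁ (mt List.mem_toFinset.2 h₂)
  | _, _, .plus_comm M L => h.plus_comm M L
  | _, _, .plus_assoc M L K => h.plus_assoc M L K
  | _, _, .plus_zero M => h.plus_zero M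

end

end

/-! ### Free names -/

section Subst

variable {x y : 𝒩}

theorem substName_of_ne {z : 𝒩} (h : z ≠ x) : substName x y z = z := if_neg h

theorem substName_self : substName x y x = y := if_pos rfl

theorem substName_cases (x y z : 𝒩) :
    (z = x ∧ substName x y z = y) ∨ (z ≠ x ∧ substName x y z = z) := by
  unfold substName; split_ifs with h <;> simp [h]

mutual

theorem Proc.mem_fn_subst : ∀ (P : Proc 𝒩 𝒯), y ∉ P.binders → ∀ z,
    z ∈ (P.subst x y).fn ↔ ∃ w ∈ P.fn, substName x y w = z
  | .res v τ P, h, z => by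
    have h₁ : y ≠ v ∧ y ∉ P.binders := by simpa [Proc.binders] using h
    have ih := P.mem_fn_subst h₁.2
    unfold Proc.subst
    split_ifs with hv
    · subst hv
      have : ∀ w ∈ (Proc.res v τ P).fn, substName v y w = w := fun w hw =>
        substName_of_ne (by simp [Proc.fn] at hw; exact hw.2)
      constructor
      · exact fun hz => ⟨z, hz, this z hz⟩
      · rintro ⟨w, hw, rfl⟩
        rwa [this w hw]
    · simp only [Proc.fn, Finset.mem_sdiff, Finset.mem_singleton, ih]
      have := h₁.1
      constructor
      · rintro ⟨⟨w, hw, rfl⟩, hz⟩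
        refine ⟨w, ⟨hw, ?_⟩, rfl⟩
        rintro rfl
        exact hz (substName_of_ne hv)
      · rintro ⟨w, ⟨hw, hwv⟩, rfl⟩
        refine ⟨⟨w, hw, rfl⟩, ?_⟩
        rcases substName_cases x y w with h | h <;> grind
  | .par P Q, h, z => by
    have h₁ : y ∉ P.binders ∧ y ∉ Q.binders := by simpa [Proc.binders] using h
    simp only [Proc.subst, Proc.fn, Finset.mem_union, P.mem_fn_subst h₁.1, Q.mem_fn_subst h₁.2]
    grind
  | .sum M, h, z => M.mem_fn_subst h z
  | .repl M, h, z => M.mem_fn_subst h z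

theorem Choice.mem_fn_subst : ∀ (M : Choice 𝒩 𝒯), y ∉ M.binders → ∀ z,
    z ∈ (M.subst x y).fn ↔ ∃ w ∈ M.fn, substName x y w = z
  | .zero, _, z => by simp [Choice.subst, Choice.fn]
  | .plus M L, h, z => by
    have h₁ : y ∉ M.binders ∧ y ∉ L.binders := by simpa [Choice.binders] using h
    simp only [Choice.subst, Choice.fn, Finset.mem_union, M.mem_fn_subst h₁.1,
      L.mem_fn_subst h₁.2]
    grind
  | .pre (.inp a v) P, h, z => by
    have h₁ : y ≠ v ∧ y ∉ P.binders := by simpa [Choice.binders] using h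
    have ih := P.mem_fn_subst h₁.2
    have := h₁.1
    simp only [Choice.subst, Choice.fn, Finset.mem_union, Finset.mem_singleton,
      Finset.mem_sdiff]
    split_ifs with hv
    · subst hv
      grind [substName]
    · simp only [ih]
      grind [substName]
  | .pre (.out a b) P, h, z => by
    simp only [Choice.subst, Choice.fn, Finset.mem_union, Finset.mem_insert,
      Finset.mem_singleton, P.mem_fn_subst h]
    grind
  | .pre .tau P, h, z => P.mem_fn_subst h z

end

end Subst

theorem scInvariant_fn : SCInvariant (Proc.fn (𝒩 := 𝒩) (𝒯 := 𝒯)) Choice.fn where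
  res_congr x τ P Q _ h := by simp [Proc.fn, h]
  par_congr P P' Q Q' h h' := by simp [Proc.fn, h, h']
  sum_congr M M' _ h := h
  repl_congr M M' _ h := h
  res_alpha x y τ P hy hb := by
    ext z
    simp only [Proc.fn, Finset.mem_sdiff, Finset.mem_singleton, P.mem_fn_subst hb]
    grind [substName]
  par_comm P Q := Finset.union_comm _ _
  par_assoc P Q R := Finset.union_assoc _ _ _
  par_nil P := Finset.union_empty _
  res_nil x τ := by simp [Proc.fn, Proc.nil, Choice.fn]
  res_swap x y τ σ P _ := by ext z; simp only [Proc.fn, Finset.mem_sdiff]; tauto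
  repl_zero := rfl
  repl_unfold M := (Finset.union_self _).symm
  extrude x τ P Q h := by
    ext z; simp only [Proc.fn, Finset.mem_sdiff, Finset.mem_union, Finset.mem_singleton]; grind
  plus_congr M M' L L' h h' := by simp [Choice.fn, h, h']
  pre_congr p P Q _ h := by cases p <;> simp [Choice.fn, h]
  inp_alpha a x y P hy hb := by
    ext z
    simp only [Choice.fn, Finset.mem_union, Finset.mem_sdiff, Finset.mem_singleton,
      P.mem_fn_subst hb]
    grind [substName]
  plus_comm M L := Finset.union_comm _ _
  plus_assoc M L K := Finset.union_assoc _ _ _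
  plus_zero M := Finset.union_empty _

theorem Proc.SC.fn_eq {P Q : Proc 𝒩 𝒯} (h : P.SC Q) : P.fn = Q.fn := scInvariant_fn.proc_eq h

theorem Choice.SC.fn_eq {M L : Choice 𝒩 𝒯} (h : M.SC L) : M.fn = L.fn :=
  scInvariant_fn.choice_eq h

/-! ### Names joined by active restrictions -/

/-- `P.Co u v`: the free names `u` and `v` of `P` occur in sequential terms of `P` that are tied to
each other. If `P` has no active restriction, they occur in the same sequential term. -/
def Proc.Co : Proc 𝒩 𝒯 → 𝒩 → 𝒩 → Prop
  | .res x _ P => fun u v => u ≠ x ∧ v ≠ x ∧ (P.Co u v ∨ (P.Co u x ∧ P.Co x v))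
  | .par P Q => fun u v => P.Co u v ∨ Q.Co u v
  | .sum M => fun u v => u ∈ M.fn ∧ v ∈ M.fn
  | .repl M => fun u v => u ∈ M.fn ∧ v ∈ M.fn

/-- `P.CoBase z t`: some active restriction of `P` with base type `t` is tied to a sequential term
with free name `z`. -/
def Proc.CoBase : Proc 𝒩 𝒯 → 𝒩 → 𝒯 → Prop
  | .res x τ P => fun z t =>
      z ≠ x ∧ (P.CoBase z t ∨ (P.Co z x ∧ (t = τ.base ∨ P.CoBase x t)))
  | .par P Q => fun z t => P.CoBase z t ∨ Q.CoBase z t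
  | .sum _ => fun _ _ => False
  | .repl _ => fun _ _ => False

/-- `t` is the base type of an active restriction of `P` whose name is used. -/
def Proc.UsedBase : Proc 𝒩 𝒯 → 𝒯 → Prop
  | .res x τ P => fun t => P.UsedBase t ∨ (x ∈ P.fn ∧ t = τ.base)
  | .par P Q => fun t => P.UsedBase t ∨ Q.UsedBase t
  | .sum _ => fun _ => False
  | .repl _ => fun _ => False

theorem Proc.Co.symm : ∀ {P : Proc 𝒩 𝒯} {u v : 𝒩}, P.Co u v → P.Co v u
  | .res _ _ _, _, _, ⟨hu, hv, h⟩ =>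
    ⟨hv, hu, h.imp Proc.Co.symm fun h => ⟨h.2.symm, h.1.symm⟩⟩
  | .par _ _, _, _, h => h.imp Proc.Co.symm Proc.Co.symm
  | .sum _, _, _, h => ⟨h.2, h.1⟩
  | .repl _, _, _, h => ⟨h.2, h.1⟩

theorem Proc.Co.mem_fn : ∀ {P : Proc 𝒩 𝒯} {u v : 𝒩}, P.Co u v → u ∈ P.fn
  | .res _ _ _, _, _, ⟨hu, _, h⟩ => by
    simp only [Proc.fn, Finset.mem_sdiff, Finset.mem_singleton]
    exact ⟨h.elim Proc.Co.mem_fn fun h => h.1.mem_fn, hu⟩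
  | .par _ _, _, _, h => Finset.mem_union.2 (h.imp Proc.Co.mem_fn Proc.Co.mem_fn)
  | .sum _, _, _, h => h.1
  | .repl _, _, _, h => h.1

theorem Proc.Co.mem_fn_right {P : Proc 𝒩 𝒯} {u v : 𝒩} (h : P.Co u v) : v ∈ P.fn := h.symm.mem_fn

theorem Proc.CoBase.mem_fn : ∀ {P : Proc 𝒩 𝒯} {z : 𝒩} {t : 𝒯}, P.CoBase z t → z ∈ P.fn
  | .res _ _ _, _, _, ⟨hu, h⟩ => by
    simp only [Proc.fn, Finset.mem_sdiff, Finset.mem_singleton]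
    exact ⟨h.elim Proc.CoBase.mem_fn fun h => h.1.mem_fn, hu⟩
  | .par _ _, _, _, h => Finset.mem_union.2 (h.imp Proc.CoBase.mem_fn Proc.CoBase.mem_fn)

section Subst

variable {x y : 𝒩}

theorem Proc.co_subst : ∀ (P : Proc 𝒩 𝒯), y ∉ P.binders → ∀ u v,
    (P.subst x y).Co u v ↔ ∃ u' v', P.Co u' v' ∧ substName x y u' = u ∧ substName x y v' = v
  | .res w τ P, h, u, v => by
    have h₁ : y ≠ w ∧ y ∉ P.binders := by simpa [Proc.binders] using h
    have ih := P.co_subst h₁.2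
    have := h₁.1
    unfold Proc.subst
    split_ifs with hv
    · subst hv
      simp only [Proc.Co]
      grind [substName]
    · simp only [Proc.Co, ih]
      have e₁ : ∀ u', substName x y u' = w ↔ u' = w := by grind [substName]
      constructor
      · rintro ⟨hu, hv, ⟨u', v', h, rfl, rfl⟩ | ⟨⟨u', w', h₂, rfl, hw⟩, w'', v', h₃, hw', rfl⟩⟩
        · grind
        · obtain rfl := (e₁ w').1 hw
          obtain rfl := (e₁ w'').1 hw'
          exact ⟨u', v', ⟨mt (e₁ u').2 hu, mt (e₁ v').2 hv, .inr ⟨h₂, h₃⟩⟩, rfl, rfl⟩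
      · rintro ⟨u', v', ⟨hu, hv, h⟩, rfl, rfl⟩
        exact ⟨mt (e₁ u').1 hu, mt (e₁ v').1 hv, h.imp (fun h => ⟨u', v', h, rfl, rfl⟩)
          fun h => ⟨⟨u', w, h.1, rfl, (e₁ w).2 rfl⟩, w, v', h.2, (e₁ w).2 rfl, rfl⟩⟩
  | .par P Q, h, u, v => by
    have h₁ : y ∉ P.binders ∧ y ∉ Q.binders := by simpa [Proc.binders] using h
    simp only [Proc.subst, Proc.Co, P.co_subst h₁.1, Q.co_subst h₁.2]
    grind
  | .sum M, h, u, v => by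
    simp only [Proc.subst, Proc.Co, M.mem_fn_subst h]
    grind
  | .repl M, h, u, v => by
    simp only [Proc.subst, Proc.Co, M.mem_fn_subst h]
    grind

theorem Proc.coBase_subst : ∀ (P : Proc 𝒩 𝒯), y ∉ P.binders → ∀ z t,
    (P.subst x y).CoBase z t ↔ ∃ z', P.CoBase z' t ∧ substName x y z' = z
  | .res w τ P, h, z, t => by
    have h₁ : y ≠ w ∧ y ∉ P.binders := by simpa [Proc.binders] using h
    have ih := P.coBase_subst h₁.2
    have := h₁.1
    unfold Proc.subst
    split_ifs with hv
    · subst hv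
      simp only [Proc.CoBase]
      grind [substName]
    · simp only [Proc.CoBase, ih, P.co_subst h₁.2]
      have e₁ : ∀ u', substName x y u' = w ↔ u' = w := by grind [substName]
      simp only [e₁]
      grind
  | .par P Q, h, z, t => by
    have h₁ : y ∉ P.binders ∧ y ∉ Q.binders := by simpa [Proc.binders] using h
    simp only [Proc.subst, Proc.CoBase, P.coBase_subst h₁.1, Q.coBase_subst h₁.2]
    grind
  | .sum M, h, z, t => by simp [Proc.subst, Proc.CoBase]
  | .repl M, h, z, t => by simp [Proc.subst, Proc.CoBase]

theorem Proc.usedBase_subst : ∀ (P : Proc 𝒩 𝒯), y ∉ P.binders → ∀ t,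
    (P.subst x y).UsedBase t ↔ P.UsedBase t
  | .res w τ P, h, t => by
    have h₁ : y ≠ w ∧ y ∉ P.binders := by simpa [Proc.binders] using h
    have := h₁.1
    unfold Proc.subst
    split_ifs with hv
    · rfl
    · simp only [Proc.UsedBase, P.usedBase_subst h₁.2, P.mem_fn_subst h₁.2]
      have e₁ : ∀ u', substName x y u' = w ↔ u' = w := by grind [substName]
      simp [e₁]
  | .par P Q, h, t => by
    have h₁ : y ∉ P.binders ∧ y ∉ Q.binders := by simpa [Proc.binders] using h
    simp only [Proc.subst, Proc.UsedBase, P.usedBase_subst h₁.1, Q.usedBase_subst h₁.2]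
  | .sum M, h, t => Iff.rfl
  | .repl M, h, t => Iff.rfl

end Subst

theorem scInvariant_co : SCInvariant (Proc.Co (𝒩 := 𝒩) (𝒯 := 𝒯)) Choice.fn :=
  { scInvariant_fn with
    pre_congr := fun p _ _ h _ => (Choice.SC.pre_congr p h).fn_eq
    res_congr := fun x τ P Q _ h => by simp [Proc.Co, h]
    par_congr := fun P P' Q Q' h h' => by simp [Proc.Co, h, h']
    sum_congr := fun M M' _ h => by simp [Proc.Co, h]
    repl_congr := fun M M' _ h => by simp [Proc.Co, h]
    res_alpha := fun x y τ P hy hb => by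
      have h₁ : ∀ u v, P.Co u v → u ≠ y := fun u v h => by rintro rfl; exact hy h.mem_fn
      have h₂ : ∀ u v, P.Co u v → v ≠ y := fun u v h => by rintro rfl; exact hy h.mem_fn_right
      funext u v
      simp only [Proc.Co, P.co_subst hb]
      grind [substName]
    par_comm := fun P Q => by funext u v; simp only [Proc.Co]; grind
    par_assoc := fun P Q R => by funext u v; simp only [Proc.Co]; grind
    par_nil := fun P => by funext u v; simp [Proc.Co, Proc.nil, Choice.fn]
    res_nil := fun x τ => by funext u v; simp [Proc.Co, Proc.nil, Choice.fn]
    res_swap := fun x y τ σ P hxy => by funext u v; simp only [Proc.Co]; grind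
    repl_zero := rfl
    repl_unfold := fun M => by funext u v; simp [Proc.Co]
    extrude := fun x τ P Q hx => by
      have h₁ : ∀ u, ¬ P.Co x u := fun u h => hx h.mem_fn
      have h₂ : ∀ u, ¬ P.Co u x := fun u h => hx h.mem_fn_right
      funext u v
      simp only [Proc.Co]
      grind }

theorem Proc.SC.co_eq {P Q : Proc 𝒩 𝒯} (h : P.SC Q) : P.Co = Q.Co := scInvariant_co.proc_eq h

theorem scInvariant_coBase :
    SCInvariant (fun P : Proc 𝒩 𝒯 => (P.Co, P.CoBase)) Choice.fn :=
  { scInvariant_fn with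
    pre_congr := fun p _ _ h _ => (Choice.SC.pre_congr p h).fn_eq
    res_congr := fun x τ P Q _ h => by
      simp only [Prod.mk.injEq] at h ⊢
      simp [Proc.Co, Proc.CoBase, h]
    par_congr := fun P P' Q Q' h h' => by
      simp only [Prod.mk.injEq] at h h' ⊢
      simp [Proc.Co, Proc.CoBase, h, h']
    sum_congr := fun M M' _ h => by simp [Proc.Co, Proc.CoBase, h]
    repl_congr := fun M M' _ h => by simp [Proc.Co, Proc.CoBase, h]
    res_alpha := fun x y τ P hy hb => by
      refine Prod.ext (scInvariant_co.res_alpha x y τ P hy hb) ?_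
      have h₁ : ∀ u v, P.Co u v → u ≠ y := fun u v h => by rintro rfl; exact hy h.mem_fn
      have h₂ : ∀ u v, P.Co u v → v ≠ y := fun u v h => by rintro rfl; exact hy h.mem_fn_right
      have h₃ : ∀ u t, P.CoBase u t → u ≠ y := fun u v h => by rintro rfl; exact hy h.mem_fn
      funext z t
      simp only [Proc.CoBase, P.co_subst hb, P.coBase_subst hb]
      grind [substName]
    par_comm := fun P Q => by
      refine Prod.ext (scInvariant_co.par_comm P Q) ?_
      funext u v; simp only [Proc.CoBase]; grind
    par_assoc := fun P Q R => by
      refine Prod.ext (scInvariant_co.par_assoc P Q R) ?_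
      funext u v; simp only [Proc.CoBase]; grind
    par_nil := fun P => by
      refine Prod.ext (scInvariant_co.par_nil P) ?_
      funext u v; simp [Proc.CoBase, Proc.nil]
    res_nil := fun x τ => by
      refine Prod.ext (scInvariant_co.res_nil x τ) ?_
      funext u v; simp [Proc.CoBase, Proc.Co, Proc.nil, Choice.fn]
    res_swap := fun x y τ σ P hxy => by
      refine Prod.ext (scInvariant_co.res_swap x y τ σ P hxy) ?_
      have h₁ : ∀ u v, P.Co u v → P.Co v u := fun u v => Proc.Co.symm
      funext u v; simp only [Proc.CoBase, Proc.Co]; grind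
    repl_zero := rfl
    repl_unfold := fun M => by
      refine Prod.ext (scInvariant_co.repl_unfold M) ?_
      funext u v; simp [Proc.CoBase]
    extrude := fun x τ P Q hx => by
      refine Prod.ext (scInvariant_co.extrude x τ P Q hx) ?_
      have h₁ : ∀ u, ¬ P.Co x u := fun u h => hx h.mem_fn
      have h₂ : ∀ u, ¬ P.Co u x := fun u h => hx h.mem_fn_right
      have h₃ : ∀ t, ¬ P.CoBase x t := fun t h => hx h.mem_fn
      have h₄ : ∀ z t, P.CoBase z t → z ≠ x := fun z t h => by rintro rfl; exact hx h.mem_fn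
      funext u v
      simp only [Proc.CoBase, Proc.Co]
      grind }

theorem Proc.SC.coBase_eq {P Q : Proc 𝒩 𝒯} (h : P.SC Q) : P.CoBase = Q.CoBase :=
  congrArg Prod.snd (scInvariant_coBase.proc_eq h)

theorem scInvariant_usedBase : SCInvariant (Proc.UsedBase (𝒩 := 𝒩) (𝒯 := 𝒯)) Choice.fn :=
  { scInvariant_fn with
    pre_congr := fun p _ _ h _ => (Choice.SC.pre_congr p h).fn_eq
    res_congr := fun x τ P Q hPQ h => by simp [Proc.UsedBase, h, hPQ.fn_eq]
    par_congr := fun P P' Q Q' h h' => by simp [Proc.UsedBase, h, h']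
    sum_congr := fun M M' _ h => rfl
    repl_congr := fun M M' _ h => rfl
    res_alpha := fun x y τ P hy hb => by
      funext t
      simp only [Proc.UsedBase, P.usedBase_subst hb, P.mem_fn_subst hb]
      grind [substName]
    par_comm := fun P Q => by funext t; simp only [Proc.UsedBase]; grind
    par_assoc := fun P Q R => by funext t; simp only [Proc.UsedBase]; grind
    par_nil := fun P => by funext t; simp [Proc.UsedBase, Proc.nil]
    res_nil := fun x τ => by funext t; simp [Proc.UsedBase, Proc.nil, Proc.fn, Choice.fn]
    res_swap := fun x y τ σ P hxy => by
      funext t; simp only [Proc.UsedBase, Proc.fn, Finset.mem_sdiff, Finset.mem_singleton]; grind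
    repl_zero := rfl
    repl_unfold := fun M => by funext t; simp [Proc.UsedBase]
    extrude := fun x τ P Q hx => by
      funext t; simp only [Proc.UsedBase, Proc.fn, Finset.mem_union]; grind }

theorem Proc.SC.usedBase_eq {P Q : Proc 𝒩 𝒯} (h : P.SC Q) : P.UsedBase = Q.UsedBase :=
  scInvariant_usedBase.proc_eq h

end

section

variable {𝒩 : Type u} {𝒯 : Type v}

/-! ### Typing of arbitrary terms -/

/-- The base type of the type that `Γ` assigns to `z`, if any, is below `t`. -/
def RootedForest.NameBelow (F : RootedForest 𝒯) (Γ : Env 𝒩 𝒯) (z : 𝒩) (t : 𝒯) : Prop :=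
  ∀ σ, Γ z = some σ → F.lt σ.base t

theorem RootedForest.nameBelow_congr {F : RootedForest 𝒯} {Γ Δ : Env 𝒩 𝒯} {z : 𝒩}
    (h : Γ z = Δ z) (t : 𝒯) :
    F.NameBelow Γ z t ↔ F.NameBelow Δ z t := by
  simp only [RootedForest.NameBelow, h]

variable [DecidableEq 𝒩]

/-- The condition on restrictions in the typing rule for normal forms, for arbitrary terms. -/
def RootedForest.CoBaseBelow (F : RootedForest 𝒯) (Γ : Env 𝒩 𝒯) (P : Proc 𝒩 𝒯) : Prop :=
  ∀ z t, P.CoBase z t → F.NameBelow Γ z t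

mutual

/-- The sequential terms of an arbitrary term are typable. Environments are updated with lexical
scoping, and the conditions that the type system imposes on a normal form are imposed on all
continuations. -/
def RootedForest.WT (F : RootedForest 𝒯) : Proc 𝒩 𝒯 → Env 𝒩 𝒯 → Prop
  | .res x τ P, Γ => F.WT P (Function.update Γ x (some τ))
  | .par P Q, Γ => F.WT P Γ ∧ F.WT Q Γ
  | .sum M, Γ => F.WTChoice M Γ
  | .repl M, Γ => F.WTChoice M Γ

/-- The counterpart of `RootedForest.WT` for choices. -/
def RootedForest.WTChoice (F : RootedForest 𝒯) : Choice 𝒩 𝒯 → Env 𝒩 𝒯 → Prop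
  | .zero, _ => True
  | .plus M L, Γ => F.WTChoice M Γ ∧ F.WTChoice L Γ
  | .pre (.inp a x) P, Γ => ∃ t σ, Γ a = some (.chan t σ) ∧
      F.WT P (Function.update Γ x (some σ)) ∧ F.CoBaseBelow (Function.update Γ x (some σ)) P ∧
      (F.le σ.base t ∨ ∀ z, z ≠ a → z ≠ x → P.Co x z → F.NameBelow Γ z t)
  | .pre (.out a b) P, Γ => (∃ t σ, Γ a = some (.chan t σ) ∧ Γ b = some σ) ∧
      F.WT P Γ ∧ F.CoBaseBelow Γ P
  | .pre .tau P, Γ => F.WT P Γ ∧ F.CoBaseBelow Γ P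

end

variable {F : RootedForest 𝒯} {x y : 𝒩} {Γ Δ : Env 𝒩 𝒯}

theorem RootedForest.coBaseBelow_congr {P : Proc 𝒩 𝒯} (h : ∀ z ∈ P.fn, Γ z = Δ z) :
    F.CoBaseBelow Γ P ↔ F.CoBaseBelow Δ P :=
  forall₂_congr fun z t => forall_congr' fun hz => nameBelow_congr (h z hz.mem_fn) t

mutual

theorem RootedForest.wt_congr (F : RootedForest 𝒯) : ∀ (P : Proc 𝒩 𝒯) {Γ Δ : Env 𝒩 𝒯}, (∀ z ∈ P.fn,
    Γ z = Δ z) →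
    (F.WT P Γ ↔ F.WT P Δ)
  | .res x τ P, Γ, Δ, h => F.wt_congr P fun z hz => by
      simp only [Proc.fn] at h
      grind [Function.update_apply]
  | .par P Q, Γ, Δ, h => by
      simp only [Proc.fn, Finset.mem_union] at h
      exact and_congr (F.wt_congr P fun z hz => h z (.inl hz))
        (F.wt_congr Q fun z hz => h z (.inr hz))
  | .sum M, Γ, Δ, h => F.wtChoice_congr M h
  | .repl M, Γ, Δ, h => F.wtChoice_congr M h

theorem RootedForest.wtChoice_congr (F : RootedForest 𝒯) : ∀ (M : Choice 𝒩 𝒯) {Γ Δ : Env 𝒩 𝒯},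
    (∀ z ∈ M.fn, Γ z = Δ z) → (F.WTChoice M Γ ↔ F.WTChoice M Δ)
  | .zero, Γ, Δ, h => Iff.rfl
  | .plus M L, Γ, Δ, h => by
      simp only [Choice.fn, Finset.mem_union] at h
      exact and_congr (F.wtChoice_congr M fun z hz => h z (.inl hz))
        (F.wtChoice_congr L fun z hz => h z (.inr hz))
  | .pre (.inp a x) P, Γ, Δ, h => by
      simp only [Choice.fn, Finset.mem_union, Finset.mem_sdiff, Finset.mem_singleton] at h
      refine exists₂_congr fun t σ => ?_
      have hu : ∀ z ∈ P.fn, Function.update Γ x (some σ) z = Function.update Δ x (some σ) z := by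
        intro z hz
        grind [Function.update_apply]
      refine and_congr (by rw [h a (.inl rfl)]) (and_congr (F.wt_congr P hu)
        (and_congr (coBaseBelow_congr hu) (or_congr Iff.rfl ?_)))
      refine forall₄_congr fun z _ hzx hz => nameBelow_congr ?_ t
      exact h z (.inr ⟨hz.mem_fn_right, hzx⟩)
  | .pre (.out a b) P, Γ, Δ, h => by
      simp only [Choice.fn, Finset.mem_union, Finset.mem_insert, Finset.mem_singleton] at h
      have hu : ∀ z ∈ P.fn, Γ z = Δ z := fun z hz => h z (.inr hz)
      refine and_congr ?_ (and_congr (F.wt_congr P hu) (coBaseBelow_congr hu))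
      rw [h a (.inl (.inl rfl)), h b (.inl (.inr rfl))]
  | .pre .tau P, Γ, Δ, h => and_congr (F.wt_congr P h) (coBaseBelow_congr h)

end

theorem RootedForest.coBaseBelow_subst {P : Proc 𝒩 𝒯} (h : y ∉ P.binders) :
    F.CoBaseBelow Γ (P.subst x y) ↔ F.CoBaseBelow (Γ ∘ substName x y) P := by
  simp only [RootedForest.CoBaseBelow, P.coBase_subst h]
  constructor
  · exact fun H z t hz => H _ t ⟨z, hz, rfl⟩
  · rintro H _ t ⟨z, hz, rfl⟩
    exact H z t hz

theorem update_comp_substName {z : 𝒩} {τ : Option (Ty 𝒯)} (hx : z ≠ x) (hy : y ≠ z) :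
    Function.update Γ z τ ∘ substName x y = Function.update (Γ ∘ substName x y) z τ := by
  funext w
  simp only [Function.comp_apply, Function.update_apply]
  grind [substName]

mutual

theorem RootedForest.wt_subst (F : RootedForest 𝒯) : ∀ (P : Proc 𝒩 𝒯) (Γ : Env 𝒩 𝒯),
    y ∉ P.fn → y ∉ P.binders →
    (F.WT (P.subst x y) Γ ↔ F.WT P (Γ ∘ substName x y))
  | .res z τ P, Γ, hf, hb => by
      have h₁ : y ≠ z ∧ y ∉ P.binders := by simpa [Proc.binders] using hb
      unfold Proc.subst
      split_ifs with hz
      · subst hz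
        refine F.wt_congr _ fun w hw => ?_
        simp only [Proc.fn, Finset.mem_sdiff, Finset.mem_singleton] at hw
        simp [substName_of_ne hw.2]
      · simp only [Proc.fn, Finset.mem_sdiff, Finset.mem_singleton] at hf
        simp only [RootedForest.WT]
        rw [F.wt_subst P _ (by tauto) h₁.2, update_comp_substName hz h₁.1]
  | .par P Q, Γ, hf, hb => by
      have h₁ : y ∉ P.binders ∧ y ∉ Q.binders := by simpa [Proc.binders] using hb
      simp only [Proc.fn, Finset.mem_union, not_or] at hf
      exact and_congr (F.wt_subst P Γ hf.1 h₁.1) (F.wt_subst Q Γ hf.2 h₁.2)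
  | .sum M, Γ, hf, hb => F.wtChoice_subst M Γ hf hb
  | .repl M, Γ, hf, hb => F.wtChoice_subst M Γ hf hb

theorem RootedForest.wtChoice_subst (F : RootedForest 𝒯) : ∀ (M : Choice 𝒩 𝒯) (Γ : Env 𝒩 𝒯),
    y ∉ M.fn →
    y ∉ M.binders → (F.WTChoice (M.subst x y) Γ ↔ F.WTChoice M (Γ ∘ substName x y))
  | .zero, _, _, _ => Iff.rfl
  | .plus M L, Γ, hf, hb => by
      have h₁ : y ∉ M.binders ∧ y ∉ L.binders := by simpa [Choice.binders] using hb
      simp only [Choice.fn, Finset.mem_union, not_or] at hf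
      exact and_congr (F.wtChoice_subst M Γ hf.1 h₁.1) (F.wtChoice_subst L Γ hf.2 h₁.2)
  | .pre (.inp a z) P, Γ, hf, hb => by
      have h₁ : y ≠ z ∧ y ∉ P.binders := by simpa [Choice.binders] using hb
      simp only [Choice.fn, Finset.mem_union, Finset.mem_sdiff, Finset.mem_singleton,
        not_or] at hf
      have hyP : y ∉ P.fn := by tauto
      have hco : ∀ u v, P.Co u v → v ≠ y := fun u v h => by rintro rfl; exact hyP h.mem_fn_right
      have hco' : ∀ u v, P.Co u v → u ≠ y := fun u v h => by rintro rfl; exact hyP h.mem_fn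
      unfold Choice.subst
      split_ifs with hz
      · subst hz
        simp only [RootedForest.WTChoice]
        refine exists₂_congr fun t σ => and_congr Iff.rfl ?_
        have hu : ∀ w ∈ P.fn, Function.update Γ z (some σ) w =
            Function.update (Γ ∘ substName z y) z (some σ) w := fun w _ => by
          simp only [Function.update_apply, Function.comp_apply]
          grind [substName]
        refine and_congr (F.wt_congr P hu) (and_congr (coBaseBelow_congr hu)
          (or_congr Iff.rfl ?_))
        have : ∀ w, P.Co z w → w ≠ z → (w ≠ substName z y a ↔ w ≠ a) := by
          intro w hw hwz
          have := hco _ _ hw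
          grind [substName]
        constructor
        · intro H w hwa hwz hw
          rw [nameBelow_congr (Δ := Γ) (by simp [substName_of_ne hwz])]
          exact H w ((this w hw hwz).2 hwa) hwz hw
        · intro H w hwa hwz hw
          rw [nameBelow_congr (Δ := Γ ∘ substName z y) (by simp [substName_of_ne hwz])]
          exact H w ((this w hw hwz).1 hwa) hwz hw
      · simp only [RootedForest.WTChoice]
        refine exists₂_congr fun t σ => and_congr Iff.rfl ?_
        rw [F.wt_subst P _ hyP h₁.2, coBaseBelow_subst h₁.2, update_comp_substName hz h₁.1]
        refine and_congr Iff.rfl (and_congr Iff.rfl (or_congr Iff.rfl ?_))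
        simp only [P.co_subst h₁.2]
        have hya : y ≠ a := hf.1
        constructor
        · intro H w hwa hwz hw
          have := hco _ _ hw
          exact H (substName x y w) (by grind [substName]) (by grind [substName])
            ⟨z, w, hw, substName_of_ne hz, rfl⟩
        · rintro H _ hwa hwz ⟨z', w, hw, hz', rfl⟩
          have := hco _ _ hw
          have hzz : z' = z := by grind [substName]
          exact H w (by grind [substName]) (by grind [substName]) (hzz ▸ hw)
  | .pre (.out a b) P, Γ, hf, hb => by
      simp only [Choice.fn, Finset.mem_union, not_or] at hf
      exact and_congr Iff.rfl (and_congr (F.wt_subst P Γ hf.2 hb) (coBaseBelow_subst hb))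
  | .pre .tau P, Γ, hf, hb => and_congr (F.wt_subst P Γ hf hb) (coBaseBelow_subst hb)

end

theorem update_comp_substName_self {τ : Option (Ty 𝒯)} {z : 𝒩} (h : z ≠ y) :
    (Function.update Γ y τ ∘ substName x y) z = Function.update Γ x τ z := by
  simp only [Function.comp_apply, Function.update_apply]
  grind [substName]

theorem RootedForest.scInvariant_wt (F : RootedForest 𝒯) :
    SCInvariant (F.WT (𝒩 := 𝒩)) F.WTChoice where
  res_congr x τ P Q _ h := by funext Γ; simp [RootedForest.WT, h]
  par_congr P P' Q Q' h h' := by funext Γ; simp [RootedForest.WT, h, h']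
  sum_congr M M' _ h := h
  repl_congr M M' _ h := h
  res_alpha x y τ P hy hb := by
    funext Γ
    simp only [RootedForest.WT, F.wt_subst P _ hy hb]
    refine propext (F.wt_congr P fun z hz => ?_)
    exact (update_comp_substName_self (ne_of_mem_of_not_mem hz hy)).symm
  par_comm P Q := by funext Γ; simp only [RootedForest.WT, and_comm]
  par_assoc P Q R := by funext Γ; simp only [RootedForest.WT, and_assoc]
  par_nil P := by funext Γ; simp [RootedForest.WT, RootedForest.WTChoice, Proc.nil]
  res_nil x τ := by funext Γ; simp [RootedForest.WT, RootedForest.WTChoice, Proc.nil]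
  res_swap x y τ σ P hxy := by
    funext Γ; simp only [RootedForest.WT, Function.update_comm hxy]
  repl_zero := rfl
  repl_unfold M := by funext Γ; simp [RootedForest.WT]
  extrude x τ P Q h := by
    funext Γ
    simp only [RootedForest.WT]
    refine propext (and_congr (F.wt_congr P fun z hz => ?_) Iff.rfl)
    exact (Function.update_of_ne (ne_of_mem_of_not_mem hz h) _ _).symm
  plus_congr M M' L L' h h' := by funext Γ; simp [RootedForest.WTChoice, h, h']
  pre_congr p P Q hPQ h := by
    funext Γ
    have hc : ∀ Γ, F.CoBaseBelow Γ P ↔ F.CoBaseBelow Γ Q := fun Γ => by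
      simp only [RootedForest.CoBaseBelow, hPQ.coBase_eq]
    cases p <;> simp only [RootedForest.WTChoice, h, hc, hPQ.co_eq]
  inp_alpha a x y P hy hb := by
    funext Γ
    have hco : ∀ u v, P.Co u v → u ≠ y ∧ v ≠ y := fun u v h =>
      ⟨by rintro rfl; exact hy h.mem_fn, by rintro rfl; exact hy h.mem_fn_right⟩
    simp only [RootedForest.WTChoice, F.wt_subst P _ hy hb, coBaseBelow_subst hb]
    refine propext (exists₂_congr fun t σ => and_congr Iff.rfl ?_)
    have hu : ∀ z ∈ P.fn, Function.update Γ x (some σ) z =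
        (Function.update Γ y (some σ) ∘ substName x y) z := fun z hz =>
      (update_comp_substName_self (ne_of_mem_of_not_mem hz hy)).symm
    refine and_congr (F.wt_congr P hu) (and_congr (coBaseBelow_congr hu) (or_congr Iff.rfl ?_))
    simp only [P.co_subst hb]
    constructor
    · rintro H z hza hzy ⟨x', z', hz, hx', rfl⟩
      have := hco _ _ hz
      have hxx : x' = x := by grind [substName]
      have hzx : z' ≠ x := by grind [substName]
      rw [substName_of_ne hzx] at *
      exact H z' hza hzx (hxx ▸ hz)
    · intro H z hza hzx hz
      exact H z hza (hco _ _ hz).2 ⟨x, z, hz, substName_self, substName_of_ne hzx⟩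
  plus_comm M L := by funext Γ; simp only [RootedForest.WTChoice, and_comm]
  plus_assoc M L K := by funext Γ; simp only [RootedForest.WTChoice, and_assoc]
  plus_zero M := by funext Γ; simp [RootedForest.WTChoice]

theorem Proc.SC.wt_eq {P Q : Proc 𝒩 𝒯} (h : P.SC Q) (F : RootedForest 𝒯) : F.WT P = F.WT Q :=
  F.scInvariant_wt.proc_eq h

/-! ### The graph of a term -/

/-- `P.Net ty ρ X G`: the set `X` and the graph `G` on names represent the active restrictions of
`P`, where `ρ` interprets the free names. Every active restriction whose name is used is
represented by an element of `X` of its own, which `ty` maps to the base type of the restriction;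
two names are adjacent in `G` if they occur free in a common sequential term. -/
def Proc.Net (ty : 𝒩 → 𝒯) : Proc 𝒩 𝒯 → (𝒩 → 𝒩) → Set 𝒩 → (𝒩 → 𝒩 → Prop) → Prop
  | .res x τ P, ρ, X, G => (x ∉ P.fn ∧ P.Net ty ρ X G) ∨
      (x ∈ P.fn ∧ ∃ v X', v ∉ X' ∧ ty v = τ.base ∧ X = insert v X' ∧
        P.Net ty (Function.update ρ x v) X' G)
  | .par P Q, ρ, X, G => ∃ X₁ X₂ G₁ G₂, Disjoint X₁ X₂ ∧ X = X₁ ∪ X₂ ∧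
      G = (fun u v => G₁ u v ∨ G₂ u v) ∧ P.Net ty ρ X₁ G₁ ∧ Q.Net ty ρ X₂ G₂
  | .sum M, ρ, X, G => X = ∅ ∧ G = fun u v => u ∈ ρ '' M.fn ∧ v ∈ ρ '' M.fn
  | .repl M, ρ, X, G => X = ∅ ∧ G = fun u v => u ∈ ρ '' M.fn ∧ v ∈ ρ '' M.fn

variable {ty : 𝒩 → 𝒯}

theorem Proc.net_congr : ∀ (P : Proc 𝒩 𝒯) {ρ ρ' : 𝒩 → 𝒩} (X : Set 𝒩) (G : 𝒩 → 𝒩 → Prop),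
    (∀ z ∈ P.fn, ρ z = ρ' z) → (P.Net ty ρ X G ↔ P.Net ty ρ' X G)
  | .res x τ P, ρ, ρ', X, G, h => by
      simp only [Proc.fn, Finset.mem_sdiff, Finset.mem_singleton] at h
      refine or_congr (and_congr_right fun hx => P.net_congr X G fun z hz => ?_)
        (and_congr_right fun hx => exists₂_congr fun v X' => and_congr Iff.rfl
          (and_congr Iff.rfl (and_congr Iff.rfl (P.net_congr X' G fun z hz => ?_))))
      · exact h z ⟨hz, ne_of_mem_of_not_mem hz hx⟩
      · grind [Function.update_apply]
  | .par P Q, ρ, ρ', X, G, h => by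
      simp only [Proc.fn, Finset.mem_union] at h
      simp only [Proc.Net, P.net_congr _ _ fun z hz => h z (.inl hz),
        Q.net_congr _ _ fun z hz => h z (.inr hz)]
  | .sum M, ρ, ρ', X, G, h => by
      have : ρ '' M.fn = ρ' '' M.fn := Set.image_congr fun z hz => h z hz
      simp only [Proc.Net, this]
  | .repl M, ρ, ρ', X, G, h => by
      have : ρ '' M.fn = ρ' '' M.fn := Set.image_congr fun z hz => h z hz
      simp only [Proc.Net, this]

theorem Choice.image_fn_subst (M : Choice 𝒩 𝒯) (h : y ∉ M.binders) (ρ : 𝒩 → 𝒩) :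
    ρ '' (M.subst x y).fn = (ρ ∘ substName x y) '' M.fn := by
  ext z
  simp only [Set.mem_image, Finset.mem_coe, M.mem_fn_subst h]
  grind

theorem Proc.image_fn_subst (P : Proc 𝒩 𝒯) (h : y ∉ P.binders) (ρ : 𝒩 → 𝒩) :
    ρ '' (P.subst x y).fn = (ρ ∘ substName x y) '' P.fn := by
  ext z
  simp only [Set.mem_image, Finset.mem_coe, P.mem_fn_subst h]
  grind

theorem Proc.net_subst : ∀ (P : Proc 𝒩 𝒯), y ∉ P.binders → ∀ (ρ : 𝒩 → 𝒩) X G,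
    ((P.subst x y).Net ty ρ X G ↔ P.Net ty (ρ ∘ substName x y) X G)
  | .res z τ P, h, ρ, X, G => by
      have h₁ : y ≠ z ∧ y ∉ P.binders := by simpa [Proc.binders] using h
      unfold Proc.subst
      split_ifs with hz
      · subst hz
        refine Proc.net_congr _ _ _ fun w hw => ?_
        simp only [Proc.fn, Finset.mem_sdiff, Finset.mem_singleton] at hw
        simp [substName_of_ne hw.2]
      · have hz' : z ∈ (P.subst x y).fn ↔ z ∈ P.fn := by
          have := h₁.1
          rw [P.mem_fn_subst h₁.2]
          grind [substName]
        have hu : ∀ v, Function.update ρ z v ∘ substName x y =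
            Function.update (ρ ∘ substName x y) z v := fun v => by
          have := h₁.1
          funext w
          simp only [Function.comp_apply, Function.update_apply]
          grind [substName]
        simp only [Proc.Net, hz', P.net_subst h₁.2, hu]
  | .par P Q, h, ρ, X, G => by
      have h₁ : y ∉ P.binders ∧ y ∉ Q.binders := by simpa [Proc.binders] using h
      simp only [Proc.subst, Proc.Net, P.net_subst h₁.1, Q.net_subst h₁.2]
  | .sum M, h, ρ, X, G => by
      simp only [Proc.subst, Proc.Net, M.image_fn_subst h]
  | .repl M, h, ρ, X, G => by
      simp only [Proc.subst, Proc.Net, M.image_fn_subst h]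

theorem scInvariant_net (ty : 𝒩 → 𝒯) :
    SCInvariant (Proc.Net (𝒩 := 𝒩) ty) Choice.fn :=
  { scInvariant_fn with
    pre_congr := fun p _ _ h _ => (Choice.SC.pre_congr p h).fn_eq
    res_congr := fun x τ P Q hPQ h => by funext ρ X G; simp [Proc.Net, h, hPQ.fn_eq]
    par_congr := fun P P' Q Q' h h' => by funext ρ X G; simp [Proc.Net, h, h']
    sum_congr := fun M M' _ h => by funext ρ X G; simp [Proc.Net, h]
    repl_congr := fun M M' _ h => by funext ρ X G; simp [Proc.Net, h]
    res_alpha := fun x y τ P hy hb => by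
      funext ρ X G
      have hxy : y ∈ (P.subst x y).fn ↔ x ∈ P.fn := by
        rw [P.mem_fn_subst hb]
        grind [substName]
      simp only [Proc.Net, hxy, P.net_subst hb]
      refine propext (or_congr (and_congr_right fun hx => P.net_congr X G fun z hz => ?_)
        (and_congr_right fun hx => exists₂_congr fun v X' => and_congr Iff.rfl
          (and_congr Iff.rfl (and_congr Iff.rfl (P.net_congr X' G fun z hz => ?_)))))
      · rw [Function.comp_apply, substName_of_ne (ne_of_mem_of_not_mem hz hx)]
      · have : z ≠ y := ne_of_mem_of_not_mem hz hy
        simp only [Function.comp_apply, Function.update_apply]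
        grind [substName]
    par_comm := fun P Q => by
      funext ρ X G
      simp only [Proc.Net]
      refine propext ⟨?_, ?_⟩ <;>
      · rintro ⟨X₁, X₂, G₁, G₂, hd, rfl, rfl, h₁, h₂⟩
        exact ⟨X₂, X₁, G₂, G₁, hd.symm, Set.union_comm _ _, by funext u v; exact propext or_comm,
          h₂, h₁⟩
    par_assoc := fun P Q R => by
      funext ρ X G
      simp only [Proc.Net]
      refine propext ⟨?_, ?_⟩
      · rintro ⟨_, X₃, _, G₃, hd, rfl, rfl, ⟨X₁, X₂, G₁, G₂, hd', rfl, rfl, h₁, h₂⟩, h₃⟩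
        rw [Set.disjoint_union_left] at hd
        exact ⟨X₁, X₂ ∪ X₃, G₁, _, Set.disjoint_union_right.2 ⟨hd', hd.1⟩, Set.union_assoc _ _ _,
          by funext u v; exact propext or_assoc, h₁, X₂, X₃, G₂, G₃, hd.2, rfl, rfl, h₂, h₃⟩
      · rintro ⟨X₁, _, G₁, _, hd, rfl, rfl, h₁, X₂, X₃, G₂, G₃, hd', rfl, rfl, h₂, h₃⟩
        rw [Set.disjoint_union_right] at hd
        exact ⟨X₁ ∪ X₂, X₃, _, G₃, Set.disjoint_union_left.2 ⟨hd.2, hd'⟩,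
          (Set.union_assoc _ _ _).symm, by funext u v; exact propext or_assoc.symm,
          ⟨X₁, X₂, G₁, G₂, hd.1, rfl, rfl, h₁, h₂⟩, h₃⟩
    par_nil := fun P => by
      funext ρ X G
      refine propext ⟨?_, fun h => ⟨X, ∅, G, fun _ _ => False, Set.disjoint_empty X,
        (Set.union_empty X).symm, by simp, h, rfl, by simp [Choice.fn]⟩⟩
      rintro ⟨X₁, X₂, G₁, G₂, hd, rfl, rfl, h, rfl, rfl⟩
      simpa [Choice.fn] using h
    res_nil := fun x τ => by funext ρ X G; simp [Proc.Net, Proc.nil, Proc.fn, Choice.fn]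
    res_swap := fun x y τ σ P hxy => by
      have key : ∀ (x y : 𝒩) (τ σ : Ty 𝒯) ρ X G, x ≠ y →
          (Proc.res x τ (.res y σ P)).Net ty ρ X G →
          (Proc.res y σ (.res x τ P)).Net ty ρ X G := by
        intro x y τ σ ρ X G hxy h
        have hx : x ∈ (Proc.res y σ P).fn ↔ x ∈ P.fn := by simp [Proc.fn, hxy]
        have hy : y ∈ (Proc.res x τ P).fn ↔ y ∈ P.fn := by simp [Proc.fn, hxy.symm]
        simp only [Proc.Net, hx, hy] at h ⊢
        rcases h with ⟨hx, ⟨hy, h⟩ | ⟨hy, w, X', hw, hty, rfl, h⟩⟩ |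
          ⟨hx, v, X', hv, hty, rfl, ⟨hy, h⟩ | ⟨hy, w, X'', hw, hty', rfl, h⟩⟩
        · exact .inl ⟨hy, .inl ⟨hx, h⟩⟩
        · exact .inr ⟨hy, w, X', hw, hty, rfl, .inl ⟨hx, h⟩⟩
        · exact .inl ⟨hy, .inr ⟨hx, v, X', hv, hty, rfl, h⟩⟩
        · rw [Function.update_comm hxy] at h
          simp only [Set.mem_insert_iff, not_or] at hv
          exact .inr ⟨hy, w, insert v X'', by simp [hw, Ne.symm hv.1], hty',
            Set.insert_comm _ _ _, .inr ⟨hx, v, X'', hv.2, hty, rfl, h⟩⟩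
      funext ρ X G
      exact propext ⟨key x y τ σ ρ X G hxy, key y x σ τ ρ X G hxy.symm⟩
    repl_zero := rfl
    repl_unfold := fun M => by
      funext ρ X G
      refine propext ⟨?_, ?_⟩
      · rintro ⟨rfl, rfl⟩
        exact ⟨∅, ∅, _, _, Set.disjoint_empty _, by simp, by simp, ⟨rfl, rfl⟩, rfl, rfl⟩
      · rintro ⟨_, _, _, _, hd, rfl, rfl, ⟨rfl, rfl⟩, rfl, rfl⟩
        exact ⟨by simp, by simp⟩
    extrude := fun x τ P Q hx => by
      funext ρ X G
      have hx' : x ∈ (Proc.par P Q).fn ↔ x ∈ Q.fn := by simp [Proc.fn, hx]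
      have hP : ∀ v X G, P.Net ty (Function.update ρ x v) X G ↔ P.Net ty ρ X G := fun v X G =>
        P.net_congr X G fun z hz => Function.update_of_ne (ne_of_mem_of_not_mem hz hx) _ _
      simp only [Proc.Net, hx', hP]
      refine propext ⟨?_, ?_⟩
      · rintro ⟨X₁, X₂, G₁, G₂, hd, rfl, rfl, h, ⟨hq, h'⟩ | ⟨hq, v, X', hv, hty, rfl, h'⟩⟩
        · exact .inl ⟨hq, X₁, X₂, G₁, G₂, hd, rfl, rfl, h, h'⟩
        · rw [Set.disjoint_insert_right] at hd
          exact .inr ⟨hq, v, X₁ ∪ X', by simp [hv, hd.1], hty, by rw [Set.union_insert],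
            X₁, X', G₁, G₂, hd.2, rfl, rfl, h, h'⟩
      · rintro (⟨hq, X₁, X₂, G₁, G₂, hd, rfl, rfl, h, h'⟩ |
          ⟨hq, v, _, hv, hty, rfl, X₁, X₂, G₁, G₂, hd, rfl, rfl, h, h'⟩)
        · exact ⟨X₁, X₂, G₁, G₂, hd, rfl, rfl, h, .inl ⟨hq, h'⟩⟩
        · simp only [Set.mem_union, not_or] at hv
          exact ⟨X₁, insert v X₂, G₁, G₂, Set.disjoint_insert_right.2 ⟨hv.1, hd⟩,
            by rw [Set.union_insert], rfl, h, .inr ⟨hq, v, X₂, hv.2, hty, rfl, h'⟩⟩ }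

theorem Proc.SC.net_eq {P Q : Proc 𝒩 𝒯} (h : P.SC Q) (ty : 𝒩 → 𝒯) : P.Net ty = Q.Net ty :=
  (scInvariant_net ty).proc_eq h

/-- In every graph of `P` with fresh names for the active restrictions, all nonempty connected sets
have a least element. For normal forms, this is equivalent to `𝒯`-compatibility. -/
def RootedForest.Good (F : RootedForest 𝒯) (P : Proc 𝒩 𝒯) : Prop :=
  ∀ (ty : 𝒩 → 𝒯) (ρ : 𝒩 → 𝒩) (X : Set 𝒩) (G : 𝒩 → 𝒩 → Prop),
    P.Net ty ρ X G → Disjoint X (ρ '' P.fn) → F.HasLeast ty X G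

theorem Proc.SC.good_iff {P Q : Proc 𝒩 𝒯} (h : P.SC Q) : F.Good P ↔ F.Good Q := by
  simp only [RootedForest.Good, h.net_eq, h.fn_eq]

theorem RootedForest.Good.subst {P : Proc 𝒩 𝒯} (h : F.Good P) (hb : y ∉ P.binders) :
    F.Good (P.subst x y) := fun ty ρ X G hn hd => by
  rw [P.net_subst hb] at hn
  rw [P.image_fn_subst hb] at hd
  exact h ty _ X G hn hd

theorem RootedForest.Good.of_subst {P : Proc 𝒩 𝒯} (h : F.Good (P.subst x y)) (hb : y ∉ P.binders)
    (hy : y ∉ P.fn) : F.Good P := fun ty ρ X G hn hd => by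
  have hρ : ∀ z ∈ P.fn, ρ z = (Function.update ρ y (ρ x) ∘ substName x y) z := fun z hz => by
    have : z ≠ y := ne_of_mem_of_not_mem hz hy
    simp only [Function.comp_apply, Function.update_apply]
    grind [substName]
  refine h ty (Function.update ρ y (ρ x)) X G ?_ ?_
  · rw [P.net_subst hb]
    exact (P.net_congr X G hρ).1 hn
  · rw [P.image_fn_subst hb, ← Set.image_congr fun z hz => hρ z hz]
    exact hd

mutual

/-- All continuations in a process, at any depth, satisfy `RootedForest.Good`. -/
def RootedForest.GoodConts (F : RootedForest 𝒯) : Proc 𝒩 𝒯 → Prop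
  | .res _ _ P => F.GoodConts P
  | .par P Q => F.GoodConts P ∧ F.GoodConts Q
  | .sum M => F.GoodContsChoice M
  | .repl M => F.GoodContsChoice M

/-- All continuations in a choice, at any depth, satisfy `RootedForest.Good`. -/
def RootedForest.GoodContsChoice (F : RootedForest 𝒯) : Choice 𝒩 𝒯 → Prop
  | .zero => True
  | .plus M L => F.GoodContsChoice M ∧ F.GoodContsChoice L
  | .pre _ P => F.GoodConts P ∧ F.Good P

end

mutual

theorem RootedForest.goodConts_subst (F : RootedForest 𝒯) : ∀ (P : Proc 𝒩 𝒯),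
    y ∉ P.binders → F.GoodConts P →
    F.GoodConts (P.subst x y)
  | .res z τ P, hb, h => by
      have h₁ : y ≠ z ∧ y ∉ P.binders := by simpa [Proc.binders] using hb
      unfold Proc.subst
      split_ifs
      · exact h
      · exact F.goodConts_subst P h₁.2 h
  | .par P Q, hb, h => by
      have h₁ : y ∉ P.binders ∧ y ∉ Q.binders := by simpa [Proc.binders] using hb
      exact ⟨F.goodConts_subst P h₁.1 h.1, F.goodConts_subst Q h₁.2 h.2⟩
  | .sum M, hb, h => F.goodContsChoice_subst M hb h
  | .repl M, hb, h => F.goodContsChoice_subst M hb h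

theorem RootedForest.goodContsChoice_subst (F : RootedForest 𝒯) : ∀ (M : Choice 𝒩 𝒯),
    y ∉ M.binders →
    F.GoodContsChoice M → F.GoodContsChoice (M.subst x y)
  | .zero, _, _ => trivial
  | .plus M L, hb, h => by
      have h₁ : y ∉ M.binders ∧ y ∉ L.binders := by simpa [Choice.binders] using hb
      exact ⟨F.goodContsChoice_subst M h₁.1 h.1, F.goodContsChoice_subst L h₁.2 h.2⟩
  | .pre (.inp a z) P, hb, h => by
      have h₁ : y ≠ z ∧ y ∉ P.binders := by simpa [Choice.binders] using hb
      unfold Choice.subst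
      split_ifs
      · exact h
      · exact ⟨F.goodConts_subst P h₁.2 h.1, h.2.subst h₁.2⟩
  | .pre (.out a b) P, hb, h => ⟨F.goodConts_subst P hb h.1, h.2.subst hb⟩
  | .pre .tau P, hb, h => ⟨F.goodConts_subst P hb h.1, h.2.subst hb⟩

end

mutual

theorem RootedForest.goodConts_of_subst (F : RootedForest 𝒯) : ∀ (P : Proc 𝒩 𝒯),
    y ∉ P.binders → y ∉ P.fn →
    F.GoodConts (P.subst x y) → F.GoodConts P
  | .res z τ P, hb, hf, h => by
      have h₁ : y ≠ z ∧ y ∉ P.binders := by simpa [Proc.binders] using hb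
      simp only [Proc.fn, Finset.mem_sdiff, Finset.mem_singleton] at hf
      unfold Proc.subst at h
      split_ifs at h
      · exact h
      · exact F.goodConts_of_subst P h₁.2 (by tauto) h
  | .par P Q, hb, hf, h => by
      have h₁ : y ∉ P.binders ∧ y ∉ Q.binders := by simpa [Proc.binders] using hb
      simp only [Proc.fn, Finset.mem_union, not_or] at hf
      exact ⟨F.goodConts_of_subst P h₁.1 hf.1 h.1, F.goodConts_of_subst Q h₁.2 hf.2 h.2⟩
  | .sum M, hb, hf, h => F.goodContsChoice_of_subst M hb hf h
  | .repl M, hb, hf, h => F.goodContsChoice_of_subst M hb hf h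

theorem RootedForest.goodContsChoice_of_subst (F : RootedForest 𝒯) : ∀ (M : Choice 𝒩 𝒯),
    y ∉ M.binders → y ∉ M.fn →
    F.GoodContsChoice (M.subst x y) → F.GoodContsChoice M
  | .zero, _, _, _ => trivial
  | .plus M L, hb, hf, h => by
      have h₁ : y ∉ M.binders ∧ y ∉ L.binders := by simpa [Choice.binders] using hb
      simp only [Choice.fn, Finset.mem_union, not_or] at hf
      exact ⟨F.goodContsChoice_of_subst M h₁.1 hf.1 h.1,
        F.goodContsChoice_of_subst L h₁.2 hf.2 h.2⟩
  | .pre (.inp a z) P, hb, hf, h => by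
      have h₁ : y ≠ z ∧ y ∉ P.binders := by simpa [Choice.binders] using hb
      simp only [Choice.fn, Finset.mem_union, Finset.mem_sdiff, Finset.mem_singleton] at hf
      have hyP : y ∉ P.fn := by tauto
      unfold Choice.subst at h
      split_ifs at h
      · exact h
      · exact ⟨F.goodConts_of_subst P h₁.2 hyP h.1, h.2.of_subst h₁.2 hyP⟩
  | .pre (.out a b) P, hb, hf, h => by
      simp only [Choice.fn, Finset.mem_union, not_or] at hf
      exact ⟨F.goodConts_of_subst P hb hf.2 h.1, h.2.of_subst hb hf.2⟩
  | .pre .tau P, hb, hf, h => ⟨F.goodConts_of_subst P hb hf h.1, h.2.of_subst hb hf⟩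

end

theorem RootedForest.scInvariant_goodConts (F : RootedForest 𝒯) :
    SCInvariant (F.GoodConts (𝒩 := 𝒩)) F.GoodContsChoice where
  res_congr x τ P Q _ h := h
  par_congr P P' Q Q' h h' := by simp [RootedForest.GoodConts, h, h']
  sum_congr M M' _ h := h
  repl_congr M M' _ h := h
  res_alpha x y τ P hy hb :=
    propext ⟨F.goodConts_subst P hb, F.goodConts_of_subst P hb hy⟩
  par_comm P Q := propext and_comm
  par_assoc P Q R := propext and_assoc
  par_nil P := propext (and_iff_left trivial)
  res_nil x τ := rfl
  res_swap x y τ σ P hxy := rfl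
  repl_zero := rfl
  repl_unfold M := (propext (and_self_iff)).symm
  extrude x τ P Q h := rfl
  plus_congr M M' L L' h h' := by simp [RootedForest.GoodContsChoice, h, h']
  pre_congr p P Q hPQ h := by simp [RootedForest.GoodContsChoice, h, hPQ.good_iff]
  inp_alpha a x y P hy hb := by
    exact propext (and_congr ⟨F.goodConts_subst P hb, F.goodConts_of_subst P hb hy⟩
      ⟨fun h => h.subst hb, fun h => h.of_subst hb hy⟩)
  plus_comm M L := propext and_comm
  plus_assoc M L K := propext and_assoc
  plus_zero M := propext (and_iff_left trivial)

theorem Proc.SC.goodConts_iff {P Q : Proc 𝒩 𝒯} (h : P.SC Q) : F.GoodConts P ↔ F.GoodConts Q :=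
  Iff.of_eq (F.scInvariant_goodConts.proc_eq h)

end

section

variable {𝒩 : Type u} {𝒯 : Type v}

/-! ### Restrictions over flat terms -/

/-- The names of a list of type assignments. -/
def namesOf (X : List (𝒩 × Ty 𝒯)) : Set 𝒩 := {x | x ∈ X.map Prod.fst}

@[simp] theorem namesOf_nil : namesOf ([] : List (𝒩 × Ty 𝒯)) = ∅ := by simp [namesOf]

@[simp] theorem namesOf_cons (p : 𝒩 × Ty 𝒯) (X : List (𝒩 × Ty 𝒯)) :
    namesOf (p :: X) = insert p.1 (namesOf X) := by
  ext; simp [namesOf]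

@[simp] theorem namesOf_append (X Y : List (𝒩 × Ty 𝒯)) :
    namesOf (X ++ Y) = namesOf X ∪ namesOf Y := by
  ext; simp [namesOf]

theorem mem_namesOf {p : 𝒩 × Ty 𝒯} {X : List (𝒩 × Ty 𝒯)} (h : p ∈ X) : p.1 ∈ namesOf X :=
  List.mem_map_of_mem h

theorem exists_of_mem_namesOf {x : 𝒩} {X : List (𝒩 × Ty 𝒯)} (h : x ∈ namesOf X) :
    ∃ τ, (x, τ) ∈ X := by
  obtain ⟨p, hp, rfl⟩ := List.mem_map.1 h
  exact ⟨p.2, hp⟩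

/-- A term without active restrictions. -/
def Proc.Flat : Proc 𝒩 𝒯 → Prop
  | .res _ _ _ => False
  | .par P Q => P.Flat ∧ Q.Flat
  | .sum _ => True
  | .repl _ => True

theorem Proc.ress_restrs_body : ∀ P : Proc 𝒩 𝒯, Proc.ress P.restrs P.body = P
  | .res x τ P => congrArg (Proc.res x τ) P.ress_restrs_body
  | .par _ _ => rfl
  | .sum _ => rfl
  | .repl _ => rfl

theorem Proc.flat_prod : ∀ {L : List (Proc 𝒩 𝒯)}, (∀ A ∈ L, A.Flat) → (Proc.prod L).Flat
  | [], _ => trivial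
  | [A], h => h A (by simp)
  | A :: B :: L, h => ⟨h A (by simp), Proc.flat_prod fun C hC => h C (by simp [hC])⟩

theorem Proc.flat_of_flat_factors : ∀ {P : Proc 𝒩 𝒯}, (∀ A ∈ P.factors, A.Flat) → P.Flat
  | .res x τ P, h => h (.res x τ P) (by simp [Proc.factors])
  | .par P Q, h => ⟨Proc.flat_of_flat_factors fun A hA => h A (by simp [Proc.factors, hA]),
      Proc.flat_of_flat_factors fun A hA => h A (by simp [Proc.factors, hA])⟩
  | .sum _, _ => trivial
  | .repl _, _ => trivial

theorem Proc.Flat.factors : ∀ {P : Proc 𝒩 𝒯}, P.Flat → ∀ A ∈ P.factors, A.Flat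
  | .par P Q, h, A, hA => by
    rcases List.mem_append.1 hA with hA | hA
    · exact Proc.Flat.factors h.1 A hA
    · exact Proc.Flat.factors h.2 A hA
  | .sum .zero, _, A, hA => by simp [Proc.factors] at hA
  | .sum (.plus _ _), _, A, hA => by simp [Proc.factors] at hA; subst hA; trivial
  | .sum (.pre _ _), _, A, hA => by simp [Proc.factors] at hA; subst hA; trivial
  | .repl _, _, A, hA => by simp [Proc.factors] at hA; subst hA; trivial

theorem Proc.NFProd.flat {P : Proc 𝒩 𝒯} : P.NFProd → P.Flat
  | .sum _ => trivial
  | .repl _ => trivial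
  | .par h h' => ⟨h.flat, h'.flat⟩

theorem Proc.NFProd.body_eq {P : Proc 𝒩 𝒯} (h : P.NFProd) : P.body = P := by
  cases h <;> rfl

theorem Proc.NFGrammar.flat_body {P : Proc 𝒩 𝒯} : P.NFGrammar → P.body.Flat
  | .nil => trivial
  | .prod h => h.body_eq.symm ▸ h.flat
  | .res _ _ h => h.flat_body

theorem RootedForest.exists_minimal [Finite 𝒯] (F : RootedForest 𝒯) {X : List (𝒩 × Ty 𝒯)}
    (hX : X ≠ []) : ∃ p ∈ X, ∀ q ∈ X, ¬ F.lt q.2.base p.2.base := by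
  have htr : IsTrans 𝒯 F.lt := ⟨fun _ _ _ => F.lt_trans⟩
  have hirr : Std.Irrefl F.lt := ⟨F.lt_irrefl⟩
  have hwf : WellFounded F.lt := Finite.wellFounded_of_trans_of_irrefl F.lt
  obtain ⟨p, hp⟩ := List.exists_mem_of_ne_nil X hX
  obtain ⟨_, ⟨q, hq, rfl⟩, hmin⟩ := hwf.has_min {t | ∃ q ∈ X, q.2.base = t} ⟨_, p, hp, rfl⟩
  exact ⟨q, hq, fun r hr => hmin _ ⟨r, hr, rfl⟩⟩

theorem eq_of_mem_of_nodup {X : List (𝒩 × Ty 𝒯)} (hX : (X.map Prod.fst).Nodup) {x : 𝒩}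
    {τ σ : Ty 𝒯} (h : (x, τ) ∈ X) (h' : (x, σ) ∈ X) : τ = σ :=
  congrArg Prod.snd (List.inj_on_of_nodup_map hX h h' rfl)

theorem Proc.restrs_sublist : ∀ P : Proc 𝒩 𝒯, (P.restrs.map Prod.fst).Sublist P.binders
  | .res x _ P => P.restrs_sublist.cons_cons x
  | .par _ _ => List.nil_sublist _
  | .sum _ => List.nil_sublist _
  | .repl _ => List.nil_sublist _

theorem Proc.NFProd.restrs_eq {P : Proc 𝒩 𝒯} (h : P.NFProd) : P.restrs = [] := by
  cases h <;> rfl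

theorem Proc.mem_subterms_self (P : Proc 𝒩 𝒯) : P ∈ P.subterms := by
  rcases P with _ | _ | (_ | _ | _) | _ <;> simp [Proc.subterms, Choice.subterms]

variable [DecidableEq 𝒩]

theorem Proc.mem_fn_prod {z : 𝒩} : ∀ {L : List (Proc 𝒩 𝒯)},
    z ∈ (Proc.prod L).fn ↔ ∃ A ∈ L, z ∈ A.fn
  | [] => by simp [Proc.prod, Proc.nil, Proc.fn, Choice.fn]
  | [A] => by simp [Proc.prod]
  | A :: B :: L => by
    simp only [Proc.prod, Proc.fn, Finset.mem_union, Proc.mem_fn_prod (L := B :: L),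
      List.exists_mem_cons_iff]

theorem Proc.co_prod {u v : 𝒩} : ∀ {L : List (Proc 𝒩 𝒯)},
    (Proc.prod L).Co u v ↔ ∃ A ∈ L, A.Co u v
  | [] => by simp [Proc.prod, Proc.nil, Proc.Co, Choice.fn]
  | [A] => by simp [Proc.prod]
  | A :: B :: L => by
    have := Proc.co_prod (u := u) (v := v) (L := B :: L)
    simp only [Proc.prod, Proc.Co] at this ⊢
    rw [this]
    simp

theorem Proc.co_iff_factors {u v : 𝒩} : ∀ {P : Proc 𝒩 𝒯}, P.Co u v ↔ ∃ A ∈ P.factors, A.Co u v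
  | .res x τ P => by simp [Proc.factors]
  | .par P Q => by
    simp only [Proc.Co, Proc.factors, P.co_iff_factors, Q.co_iff_factors, List.mem_append]
    grind
  | .sum .zero => by simp [Proc.factors, Proc.Co, Choice.fn]
  | .sum (.plus _ _) => by simp [Proc.factors]
  | .sum (.pre _ _) => by simp [Proc.factors]
  | .repl M => by simp [Proc.factors]

theorem Proc.Flat.co_iff {P : Proc 𝒩 𝒯} (h : P.Flat) {u v : 𝒩} :
    P.Co u v ↔ ∃ A ∈ P.factors, u ∈ A.fn ∧ v ∈ A.fn := by
  rw [Proc.co_iff_factors]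
  refine exists_congr fun A => and_congr_right fun hA => ?_
  have key : ∀ {P : Proc 𝒩 𝒯}, P.Flat → ∀ A ∈ P.factors, (A.Co u v ↔ u ∈ A.fn ∧ v ∈ A.fn) := by
    intro P
    induction P using Proc.factors.induct with
    | case1 P Q ih₁ ih₂ =>
      intro h A hA
      exact (List.mem_append.1 hA).elim (ih₁ h.1 A) (ih₂ h.2 A)
    | case2 => intro h A hA; simp [Proc.factors] at hA
    | case3 P h₁ h₂ =>
      intro h A hA
      cases P with
      | res => exact h.elim
      | par => exact (h₁ _ _ rfl).elim
      | sum M =>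
        cases M <;> simp [Proc.factors] at hA <;> subst hA <;> rfl
      | repl M => simp [Proc.factors] at hA; subst hA; rfl
  exact key h A hA

theorem Proc.mem_fn_ress {z : 𝒩} {P : Proc 𝒩 𝒯} : ∀ {X : List (𝒩 × Ty 𝒯)},
    z ∈ (Proc.ress X P).fn ↔ z ∈ P.fn ∧ z ∉ namesOf X
  | [] => by simp [Proc.ress]
  | p :: X => by
    have : Proc.ress (p :: X) P = .res p.1 p.2 (Proc.ress X P) := rfl
    rw [this, Proc.fn, Finset.mem_sdiff, Proc.mem_fn_ress, namesOf_cons]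
    simp; tauto

theorem Proc.mem_fn_of_mem_fn_body {z : 𝒩} {P : Proc 𝒩 𝒯} (h : z ∈ P.body.fn) :
    z ∈ P.fn ∨ z ∈ namesOf P.restrs := by
  rw [← P.ress_restrs_body, Proc.mem_fn_ress]
  simp only [Proc.ress_restrs_body]
  tauto

/-- Two free names of `νX.P` are joined by active restrictions if and only if there is a walk
between them that goes through names restricted by `X`. -/
theorem Proc.co_ress {u v : 𝒩} {P : Proc 𝒩 𝒯} : ∀ {X : List (𝒩 × Ty 𝒯)},
    (X.map Prod.fst).Nodup →
    ((Proc.ress X P).Co u v ↔ u ∉ namesOf X ∧ v ∉ namesOf X ∧ Walk P.Co (namesOf X) u v)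
  | [], _ => by simp [Proc.ress, walk_empty]
  | p :: X, h => by
    rw [List.map_cons, List.nodup_cons] at h
    have hp : p.1 ∉ namesOf X := h.1
    have : Proc.ress (p :: X) P = .res p.1 p.2 (Proc.ress X P) := rfl
    simp only [this, Proc.Co, Proc.co_ress h.2, namesOf_cons, walk_insert, Set.mem_insert_iff]
    tauto

theorem Proc.Flat.coBase {P : Proc 𝒩 𝒯} {z : 𝒩} {t : 𝒯} : P.Flat → ¬ P.CoBase z t := by
  induction P using Proc.factors.induct with
  | case1 P Q ih₁ ih₂ => exact fun h h' => h'.elim (ih₁ h.1) (ih₂ h.2)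
  | case2 => exact fun _ => id
  | case3 P h₁ h₂ =>
    intro h
    cases P with
    | res => exact h.elim
    | par => exact (h₁ _ _ rfl).elim
    | sum M => exact id
    | repl M => exact id

theorem Proc.coBase_ress {z : 𝒩} {t : 𝒯} {P : Proc 𝒩 𝒯} (hP : P.Flat) :
    ∀ {X : List (𝒩 × Ty 𝒯)}, (X.map Prod.fst).Nodup →
    ((Proc.ress X P).CoBase z t ↔
      z ∉ namesOf X ∧ ∃ p ∈ X, t = p.2.base ∧ Walk P.Co (namesOf X) z p.1)
  | [], _ => by simp [Proc.ress, hP.coBase]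
  | p :: X, h => by
    have hX := h
    rw [List.map_cons, List.nodup_cons] at h
    have hp : p.1 ∉ namesOf X := h.1
    have ih := @Proc.coBase_ress z t P hP X h.2
    have ih' := @Proc.coBase_ress p.1 t P hP X h.2
    have : Proc.ress (p :: X) P = .res p.1 p.2 (Proc.ress X P) := rfl
    simp only [this, Proc.CoBase, Proc.co_ress h.2, namesOf_cons, Set.mem_insert_iff,
      walk_insert, List.mem_cons, ih, ih']
    constructor
    · rintro ⟨hz, ⟨hz', q, hq, rfl, hw⟩ | ⟨⟨hz', -, hw⟩, rfl | ⟨-, q, hq, rfl, hw'⟩⟩⟩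
      · exact ⟨by tauto, q, .inr hq, rfl, .inl hw⟩
      · exact ⟨by tauto, p, .inl rfl, rfl, .inl hw⟩
      · exact ⟨by tauto, q, .inr hq, rfl, .inr ⟨hw, hw'⟩⟩
    · rintro ⟨hz, q, rfl | hq, rfl, hw⟩
      · exact ⟨by tauto, .inr ⟨⟨by tauto, hp, by tauto⟩, .inl rfl⟩⟩
      · refine ⟨by tauto, ?_⟩
        rcases hw with hw | ⟨hw, hw'⟩
        · exact .inl ⟨by tauto, q, hq, rfl, hw⟩
        · exact .inr ⟨⟨by tauto, hp, hw⟩, .inr ⟨hp, q, hq, rfl, hw'⟩⟩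

theorem Proc.usedBase_ress {P : Proc 𝒩 𝒯} : ∀ {X : List (𝒩 × Ty 𝒯)}, (X.map Prod.fst).Nodup →
    ∀ p ∈ X, p.1 ∈ P.fn → (Proc.ress X P).UsedBase p.2.base
  | q :: X, h, p, hp, hf => by
    rw [List.map_cons, List.nodup_cons] at h
    rcases List.mem_cons.1 hp with rfl | hp
    · exact .inr ⟨Proc.mem_fn_ress.2 ⟨hf, h.1⟩, rfl⟩
    · exact .inl (Proc.usedBase_ress h.2 p hp hf)

theorem Proc.UsedBase.exists_mem_bnRes : ∀ {P : Proc 𝒩 𝒯} {t : 𝒯}, P.UsedBase t →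
    ∃ p ∈ P.bnRes, p.2.base = t
  | .res x τ P, t, h => by
    rcases h with h | h
    · obtain ⟨p, hp, rfl⟩ := h.exists_mem_bnRes
      exact ⟨p, List.mem_cons_of_mem _ hp, rfl⟩
    · exact ⟨(x, τ), List.mem_cons_self, h.2.symm⟩
  | .par P Q, t, h => by
    rcases h with h | h
    · obtain ⟨p, hp, rfl⟩ := h.exists_mem_bnRes
      exact ⟨p, List.mem_append_left _ hp, rfl⟩
    · obtain ⟨p, hp, rfl⟩ := h.exists_mem_bnRes
      exact ⟨p, List.mem_append_right _ hp, rfl⟩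

theorem Proc.Flat.net_iff {ty : 𝒩 → 𝒯} {ρ : 𝒩 → 𝒩} : ∀ {P : Proc 𝒩 𝒯}, P.Flat → ∀ {X G},
    (P.Net ty ρ X G ↔ X = ∅ ∧ G = fun u v => ∃ u' v', P.Co u' v' ∧ ρ u' = u ∧ ρ v' = v)
  | .par P Q, h, X, G => by
    simp only [Proc.Net, h.1.net_iff, h.2.net_iff]
    constructor
    · rintro ⟨_, _, _, _, -, rfl, rfl, ⟨rfl, rfl⟩, rfl, rfl⟩
      refine ⟨by simp, ?_⟩
      funext u v
      simp only [Proc.Co]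
      grind
    · rintro ⟨rfl, rfl⟩
      refine ⟨∅, ∅, _, _, Set.disjoint_empty _, by simp, ?_, ⟨rfl, rfl⟩, rfl, rfl⟩
      funext u v
      simp only [Proc.Co]
      grind
  | .sum M, _, X, G => by
    have : (fun u v => u ∈ ρ '' M.fn ∧ v ∈ ρ '' M.fn) =
        fun u v => ∃ u' v', (Proc.sum M).Co u' v' ∧ ρ u' = u ∧ ρ v' = v := by
      funext u v
      simp only [Proc.Co, Set.mem_image, Finset.mem_coe]
      grind
    simp only [Proc.Net, this]
  | .repl M, _, X, G => by
    have : (fun u v => u ∈ ρ '' M.fn ∧ v ∈ ρ '' M.fn) =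
        fun u v => ∃ u' v', (Proc.repl M).Co u' v' ∧ ρ u' = u ∧ ρ v' = v := by
      funext u v
      simp only [Proc.Co, Set.mem_image, Finset.mem_coe]
      grind
    simp only [Proc.Net, this]

/-- The graphs of `νX.P` are the images of the graph of `P` under the renamings that are injective
on the used names of `X`. -/
theorem Proc.Net.exists_renaming {ty : 𝒩 → 𝒯} {P : Proc 𝒩 𝒯} (hP : P.Flat) :
    ∀ {X : List (𝒩 × Ty 𝒯)} {ρ : 𝒩 → 𝒩} {Z G}, (X.map Prod.fst).Nodup →
    (Proc.ress X P).Net ty ρ Z G →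
    ∃ f : 𝒩 → 𝒩, (∀ z, z ∉ namesOf X → f z = ρ z) ∧
      (∀ p ∈ X, p.1 ∈ P.fn → ty (f p.1) = p.2.base) ∧
      Set.InjOn f (namesOf X ∩ P.fn) ∧ Z = f '' (namesOf X ∩ P.fn) ∧
      G = fun u v => ∃ u' v', P.Co u' v' ∧ f u' = u ∧ f v' = v
  | [], ρ, Z, G, _, h => by
    obtain ⟨rfl, rfl⟩ := hP.net_iff.1 h
    exact ⟨ρ, by simp⟩
  | (x, τ) :: X, ρ, Z, G, hX, h => by
    rw [List.map_cons, List.nodup_cons] at hX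
    have hxX : x ∉ namesOf X := hX.1
    have hx : x ∈ (Proc.ress X P).fn ↔ x ∈ P.fn := by
      rw [Proc.mem_fn_ress]; exact and_iff_left hxX
    have h' : (Proc.res x τ (Proc.ress X P)).Net ty ρ Z G := h
    simp only [Proc.Net, hx] at h'
    rcases h' with ⟨hxP, h⟩ | ⟨hxP, v, Z', hv, hty, rfl, h₁⟩
    · obtain ⟨f, hf, hfty, hinj, rfl, rfl⟩ := Proc.Net.exists_renaming hP hX.2 h
      have : namesOf ((x, τ) :: X) ∩ P.fn = namesOf X ∩ P.fn := by
        rw [namesOf_cons, Set.insert_inter_of_notMem (by simpa using hxP)]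
      refine ⟨f, fun z hz => hf z fun h => hz (by simp [h]), fun p hp hpP => ?_, ?_, ?_, rfl⟩
      · rcases List.mem_cons.1 hp with rfl | hp
        · exact (hxP hpP).elim
        · exact hfty p hp hpP
      · rwa [this]
      · rw [this]
    · obtain ⟨f, hf, hfty, hinj, rfl, rfl⟩ := Proc.Net.exists_renaming hP hX.2 h₁
      have : namesOf ((x, τ) :: X) ∩ P.fn = insert x (namesOf X ∩ P.fn) := by
        rw [namesOf_cons, Set.insert_inter_of_mem (by simpa using hxP)]
      have hfx : f x = v := by rw [hf x hxX, Function.update_self]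
      refine ⟨f, fun z hz => ?_, fun p hp hpP => ?_, ?_, ?_, rfl⟩
      · simp only [namesOf_cons, Set.mem_insert_iff, not_or] at hz
        rw [hf z hz.2, Function.update_of_ne hz.1]
      · rcases List.mem_cons.1 hp with rfl | hp
        · exact (congrArg ty hfx).trans hty
        · exact hfty p hp hpP
      · rw [this, Set.injOn_insert fun h => hxX h.1, hfx]
        exact ⟨hinj, hv⟩
      · rw [this, Set.image_insert_eq, hfx]

theorem Proc.net_ress {ty : 𝒩 → 𝒯} {P : Proc 𝒩 𝒯} (hP : P.Flat) :
    ∀ {X : List (𝒩 × Ty 𝒯)}, (X.map Prod.fst).Nodup →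
    (∀ p ∈ X, p.1 ∈ P.fn → ty p.1 = p.2.base) →
    (Proc.ress X P).Net ty id (namesOf X ∩ P.fn) P.Co
  | [], _, _ => by
    refine hP.net_iff.2 ⟨by simp, ?_⟩
    funext u v
    simp
  | (x, τ) :: X, hX, h => by
    rw [List.map_cons, List.nodup_cons] at hX
    have hxX : x ∉ namesOf X := hX.1
    have hx : x ∈ (Proc.ress X P).fn ↔ x ∈ P.fn := by
      rw [Proc.mem_fn_ress]; exact and_iff_left hxX
    have ih := Proc.net_ress hP hX.2 fun p hp => h p (List.mem_cons_of_mem _ hp)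
    change (Proc.res x τ (Proc.ress X P)).Net ty _ _ _
    simp only [Proc.Net, hx]
    by_cases hxP : x ∈ P.fn
    · refine .inr ⟨hxP, x, namesOf X ∩ P.fn, fun h => hxX h.1,
        h (x, τ) List.mem_cons_self hxP, ?_, ?_⟩
      · rw [namesOf_cons, Set.insert_inter_of_mem (by simpa using hxP)]
      · convert ih using 1
        exact Function.update_eq_self x id
    · refine .inl ⟨hxP, ?_⟩
      rw [namesOf_cons, Set.insert_inter_of_notMem (by simpa using hxP)]
      exact ih

variable {F : RootedForest 𝒯}

/-- `RootedForest.Good` for the term `νX.P`, in terms of its own names. -/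
def RootedForest.LeastOn (F : RootedForest 𝒯) (X : List (𝒩 × Ty 𝒯)) (P : Proc 𝒩 𝒯) : Prop :=
  ∀ ty : 𝒩 → 𝒯, (∀ p ∈ X, p.1 ∈ P.fn → ty p.1 = p.2.base) → F.HasLeast ty (namesOf X) P.Co

theorem RootedForest.LeastOn.good {X : List (𝒩 × Ty 𝒯)} {P : Proc 𝒩 𝒯} (h : F.LeastOn X P)
    (hP : P.Flat) (hX : (X.map Prod.fst).Nodup) : F.Good (Proc.ress X P) := by
  intro ty ρ Z G hn hd
  obtain ⟨f, hf, hfty, hinj, rfl, rfl⟩ := hn.exists_renaming hP hX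
  intro Y hY ⟨y, hy⟩ hc
  -- A name of `P` that is mapped into `Y` is restricted, and `f` is injective there.
  have hpre : ∀ u ∈ P.fn, f u ∈ Y → u ∈ namesOf X ∩ P.fn := fun u hu hfu => by
    refine ⟨?_, hu⟩
    by_contra hux
    exact Set.disjoint_left.1 hd (hY hfu) ⟨u, Proc.mem_fn_ress.2 ⟨hu, hux⟩, (hf u hux).symm⟩
  have hwalk : ∀ a b, Walk (fun u v => ∃ u' v', P.Co u' v' ∧ f u' = u ∧ f v' = v) Y a b →
      a ∈ Y → b ∈ Y → ∀ u ∈ namesOf X ∩ P.fn, ∀ v ∈ namesOf X ∩ P.fn, f u = a → f v = b →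
      Walk P.Co (namesOf X ∩ P.fn ∩ f ⁻¹' Y) u v := by
    intro a b h
    induction h with
    | edge h =>
      rintro ha hb u hu v hv rfl rfl
      obtain ⟨u', v', h, hu', hv'⟩ := h
      have h₁ := hinj (hpre u' h.mem_fn (hu' ▸ ha)) hu hu'
      have h₂ := hinj (hpre v' h.mem_fn_right (hv' ▸ hb)) hv hv'
      exact .edge (h₁ ▸ h₂ ▸ h)
    | step h hm _ ih =>
      rintro ha hb u hu v hv rfl rfl
      obtain ⟨u', v', h, hu', rfl⟩ := h
      have h₁ := hinj (hpre u' h.mem_fn (hu' ▸ ha)) hu hu'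
      have h₂ := hpre v' h.mem_fn_right hm
      exact .step (h₁ ▸ h) ⟨h₂, hm⟩ (ih hm hb v' h₂ v hv rfl rfl)
  obtain ⟨x, hx, rfl⟩ := hY hy
  obtain ⟨m, hm, hmin⟩ := h (ty ∘ f) hfty (namesOf X ∩ P.fn ∩ f ⁻¹' Y) (fun z hz => hz.1.1)
    ⟨x, hx, hy⟩ fun u hu v hv => hwalk _ _ (hc _ hu.2 _ hv.2) hu.2 hv.2 u hu.1 v hv.1 rfl rfl
  refine ⟨f m, hm.2, fun b hb hbm => ?_⟩
  obtain ⟨z, hz, rfl⟩ := hY hb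
  exact hmin z ⟨hz, hb⟩ fun e => hbm (e ▸ rfl)

theorem RootedForest.Good.leastOn {X : List (𝒩 × Ty 𝒯)} {P : Proc 𝒩 𝒯}
    (h : F.Good (Proc.ress X P)) (hP : P.Flat) (hX : (X.map Prod.fst).Nodup) :
    F.LeastOn X P := by
  intro ty hty Y hY hne hc
  refine h ty id _ _ (Proc.net_ress hP hX hty) ?_ Y (fun y hy => ⟨hY hy, ?_⟩) hne hc
  · refine Set.disjoint_left.2 fun z hz hz' => ?_
    rw [Set.image_id] at hz'
    exact (Proc.mem_fn_ress.1 hz').2 hz.1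
  · obtain ⟨w, hw⟩ := (hc y hy y hy).exists_left
    exact hw.mem_fn

end

section

variable {𝒩 : Type u} {𝒯 : Type v}

/-! ### Compatible terms have good graphs -/

/-- The trace `(x₁,t₁) ⋯ (xₖ,tₖ) A`. -/
def leafTrace (s : List (𝒩 × 𝒯)) (A : Proc 𝒩 𝒯) : List (Label 𝒩 𝒯) :=
  s.map Sum.inl ++ [Sum.inr A]

theorem RootedForest.ForestCompatible.of_node {F : RootedForest 𝒯} {l : Label 𝒩 𝒯}
    {φ : LForest (Label 𝒩 𝒯)} (h : F.ForestCompatible (.node l φ)) : F.ForestCompatible φ :=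
  fun s A hs => h s A (.under l hs)

theorem exists_isTrace_of_prod {t : List (Label 𝒩 𝒯)} : ∀ {L : List (Proc 𝒩 𝒯)},
    (Proc.prod L).forest.IsTrace t → ∃ A ∈ L, A.forest.IsTrace t
  | [], h => by cases h with | root h => cases h
  | [A], h => ⟨A, by simp, h⟩
  | A :: B :: L, h => by
    have key : A.forest.IsTrace t ∨ (Proc.prod (B :: L)).forest.IsTrace t := by
      cases h with
      | root h =>
        cases h with
        | left _ h => exact .inl (.root h)
        | right _ h => exact .inr (.root h)
      | left _ h => exact .inl h
      | right _ h => exact .inr h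
    rcases key with h | h
    · exact ⟨A, by simp, h⟩
    · obtain ⟨C, hC, h⟩ := exists_isTrace_of_prod h
      exact ⟨C, List.mem_cons_of_mem _ hC, h⟩

theorem exists_isTrace_of_res {x : 𝒩} {τ : Ty 𝒯} {P : Proc 𝒩 𝒯} {s : List (𝒩 × 𝒯)}
    {A : Proc 𝒩 𝒯} (h : (Proc.res x τ P).forest.IsTrace (leafTrace s A)) :
    P.forest.IsTrace (leafTrace s A) ∨
      ∃ s', s = (x, τ.base) :: s' ∧ P.forest.IsTrace (leafTrace s' A) := by
  generalize ht : leafTrace s A = t at h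
  cases h with
  | under _ h => exact .inl h
  | root h =>
    cases h with
    | single l φ => cases s <;> simp [leafTrace] at ht
    | cons l h =>
      cases s with
      | nil => simp [leafTrace] at ht
      | cons p s =>
        simp only [leafTrace, List.map_cons, List.cons_append, List.cons.injEq,
          Sum.inl.injEq] at ht
        obtain ⟨rfl, rfl⟩ := ht
        exact .inr ⟨s, rfl, .root h⟩

theorem eq_nil_of_isTrace_leaf {s : List (𝒩 × 𝒯)} {A B : Proc 𝒩 𝒯}
    (h : (LForest.node (Sum.inr B) .empty).IsTrace (leafTrace s A)) : s = [] := by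
  generalize ht : leafTrace s A = t at h
  cases h with
  | under _ h => cases h with | root h => cases h
  | root h =>
    cases h with
    | single l φ => cases s <;> simp_all [leafTrace]
    | cons l h => cases h

theorem Proc.Flat.eq_nil_of_isTrace {s : List (𝒩 × 𝒯)} {A : Proc 𝒩 𝒯} :
    ∀ {P : Proc 𝒩 𝒯}, P.Flat → P.forest.IsTrace (leafTrace s A) → s = []
  | .par P Q, hP, h => by
    generalize ht : leafTrace s A = t at h
    cases h with
    | root h =>
      cases h with
      | left _ h => exact hP.1.eq_nil_of_isTrace (.root (ht ▸ h))
      | right _ h => exact hP.2.eq_nil_of_isTrace (.root (ht ▸ h))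
    | left _ h => exact hP.1.eq_nil_of_isTrace (ht ▸ h)
    | right _ h => exact hP.2.eq_nil_of_isTrace (ht ▸ h)
  | .sum .zero, _, h => by cases h with | root h => cases h
  | .sum (.plus M L), _, h => eq_nil_of_isTrace_leaf h
  | .sum (.pre p P), _, h => eq_nil_of_isTrace_leaf h
  | .repl M, _, h => eq_nil_of_isTrace_leaf h

variable [DecidableEq 𝒩]

theorem Proc.exists_isRootTrace : ∀ {P : Proc 𝒩 𝒯} {x : 𝒩}, x ∈ P.fn →
    ∃ s A, P.forest.IsRootTrace (leafTrace s A)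
  | .res z τ P, x, h => by
    obtain ⟨s, A, hs⟩ := P.exists_isRootTrace (Finset.mem_sdiff.1 h).1
    exact ⟨(z, τ.base) :: s, A, .cons _ hs⟩
  | .par P Q, x, h => by
    rcases Finset.mem_union.1 h with h | h
    · obtain ⟨s, A, hs⟩ := P.exists_isRootTrace h
      exact ⟨s, A, .left _ hs⟩
    · obtain ⟨s, A, hs⟩ := Q.exists_isRootTrace h
      exact ⟨s, A, .right _ hs⟩
  | .sum .zero, x, h => by simp [Proc.fn, Choice.fn] at h
  | .sum (.plus M L), x, h => ⟨[], _, .single _ _⟩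
  | .sum (.pre p P), x, h => ⟨[], _, .single _ _⟩
  | .repl M, x, h => ⟨[], _, .single _ _⟩

variable {ty : 𝒩 → 𝒯}

/-- Used restrictions lie on a path to a sequential term, so that compatibility constrains them. -/
theorem Proc.Net.exists_isRootTrace : ∀ {P : Proc 𝒩 𝒯} {ρ X G}, P.Net ty ρ X G → ∀ y ∈ X,
    ∃ s A, P.forest.IsRootTrace (leafTrace s A) ∧ ty y ∈ s.map Prod.snd
  | .res x τ P, ρ, X, G, h, y, hy => by
    rcases h with ⟨-, h⟩ | ⟨hx, v, X', -, hty, rfl, h⟩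
    · obtain ⟨s, A, hs, ht⟩ := h.exists_isRootTrace y hy
      exact ⟨(x, τ.base) :: s, A, .cons _ hs, List.mem_cons_of_mem _ ht⟩
    · rcases hy with rfl | hy
      · obtain ⟨s, A, hs⟩ := P.exists_isRootTrace hx
        exact ⟨(x, τ.base) :: s, A, .cons _ hs, by simp [hty]⟩
      · obtain ⟨s, A, hs, ht⟩ := h.exists_isRootTrace y hy
        exact ⟨(x, τ.base) :: s, A, .cons _ hs, List.mem_cons_of_mem _ ht⟩
  | .par P Q, ρ, X, G, h, y, hy => by
    obtain ⟨X₁, X₂, G₁, G₂, -, rfl, rfl, h₁, h₂⟩ := h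
    rcases hy with hy | hy
    · obtain ⟨s, A, hs, ht⟩ := h₁.exists_isRootTrace y hy
      exact ⟨s, A, .left _ hs, ht⟩
    · obtain ⟨s, A, hs, ht⟩ := h₂.exists_isRootTrace y hy
      exact ⟨s, A, .right _ hs, ht⟩
  | .sum M, ρ, X, G, h, y, hy => by
    obtain ⟨rfl, -⟩ := h
    exact hy.elim
  | .repl M, ρ, X, G, h, y, hy => by
    obtain ⟨rfl, -⟩ := h
    exact hy.elim

theorem Proc.Net.support : ∀ {P : Proc 𝒩 𝒯} {ρ X G}, P.Net ty ρ X G → ∀ {u v}, G u v →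
    u ∈ X ∪ ρ '' P.fn ∧ v ∈ X ∪ ρ '' P.fn
  | .res x τ P, ρ, X, G, h, u, v, huv => by
    rcases h with ⟨hx, h⟩ | ⟨hx, w, X', -, hty, rfl, h⟩
    · have : (Proc.res x τ P).fn = P.fn := Finset.sdiff_eq_self_of_disjoint (by simpa using hx)
      rw [this]
      exact h.support huv
    · have : X' ∪ Function.update ρ x w '' P.fn ⊆
          insert w X' ∪ ρ '' (Proc.res x τ P).fn := by
        rintro z (hz | ⟨z, hz, rfl⟩)
        · exact .inl (.inr hz)
        · by_cases hzx : z = x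
          · subst hzx; simp
          · rw [Function.update_of_ne hzx]
            exact .inr ⟨z, by simpa [Proc.fn, hzx] using hz, rfl⟩
      exact ⟨this (h.support huv).1, this (h.support huv).2⟩
  | .par P Q, ρ, X, G, h, u, v, huv => by
    obtain ⟨X₁, X₂, G₁, G₂, -, rfl, rfl, h₁, h₂⟩ := h
    have e₁ : X₁ ∪ ρ '' P.fn ⊆ X₁ ∪ X₂ ∪ ρ '' (Proc.par P Q).fn :=
      Set.union_subset_union Set.subset_union_left (Set.image_mono (by simp [Proc.fn]))
    have e₂ : X₂ ∪ ρ '' Q.fn ⊆ X₁ ∪ X₂ ∪ ρ '' (Proc.par P Q).fn :=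
      Set.union_subset_union Set.subset_union_right (Set.image_mono (by simp [Proc.fn]))
    rcases huv with h | h
    · exact ⟨e₁ (h₁.support h).1, e₁ (h₁.support h).2⟩
    · exact ⟨e₂ (h₂.support h).1, e₂ (h₂.support h).2⟩
  | .sum M, ρ, X, G, h, u, v, huv => by
    obtain ⟨rfl, rfl⟩ := h
    exact ⟨.inr huv.1, .inr huv.2⟩
  | .repl M, ρ, X, G, h, u, v, huv => by
    obtain ⟨rfl, rfl⟩ := h
    exact ⟨.inr huv.1, .inr huv.2⟩

/-- A set that is connected in the union of two graphs on disjoint sets of vertices, and contains a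
vertex of the first one, is connected in the first one. -/
theorem Connected.of_union {α : Type*} {G₁ G₂ : α → α → Prop} {X₁ X₂ Y : Set α}
    (hY : Y ⊆ X₁ ∪ X₂) (hc : Connected (fun u v => G₁ u v ∨ G₂ u v) Y)
    (h₁ : ∀ u v, G₁ u v → v ∉ X₂) (h₂ : ∀ u v, G₂ u v → u ∉ X₁) {y : α} (hy : y ∈ Y)
    (hyX : y ∈ X₁) : Y ⊆ X₁ ∧ Connected G₁ Y := by
  have key : ∀ u v, Walk (fun u v => G₁ u v ∨ G₂ u v) Y u v → u ∈ X₁ → v ∈ Y →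
      v ∈ X₁ ∧ Walk G₁ Y u v := by
    intro u v h
    induction h with
    | edge h =>
      intro hu hv
      have h := h.resolve_right fun h => h₂ _ _ h hu
      exact ⟨(hY hv).resolve_right (h₁ _ _ h), .edge h⟩
    | step h hm _ ih =>
      intro hu hv
      have h := h.resolve_right fun h => h₂ _ _ h hu
      obtain ⟨h', hw⟩ := ih ((hY hm).resolve_right (h₁ _ _ h)) hv
      exact ⟨h', .step h hm hw⟩
  have hYX : Y ⊆ X₁ := fun v hv => (key y v (hc y hy v hv) hyX hv).1
  exact ⟨hYX, fun u hu v hv => (key u v (hc u hu v hv) (hYX hu) hv).2⟩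

variable {F : RootedForest 𝒯}

theorem RootedForest.ForestCompatible.good : ∀ {P : Proc 𝒩 𝒯}, F.ForestCompatible P.forest →
    F.Good P
  | .res x τ P, hF => by
    intro ty ρ X G hn hd
    have ih := RootedForest.ForestCompatible.good hF.of_node
    rcases hn with ⟨hx, hn⟩ | ⟨hx, v, X', hv, hty, rfl, hn⟩
    · have : (Proc.res x τ P).fn = P.fn := Finset.sdiff_eq_self_of_disjoint (by simpa using hx)
      rw [this] at hd
      exact ih ty ρ X G hn hd
    · intro Y hY hne hc
      by_cases hvY : v ∈ Y
      · refine ⟨v, hvY, fun y hy hyv => ?_⟩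
        -- A used restriction occurs on a path to a sequential term, below the root `x`.
        obtain ⟨s, A, hs, ht⟩ := hn.exists_isRootTrace y ((hY hy).resolve_left hyv)
        have hch := hF ((x, τ.base) :: s) A (.root (.cons _ hs))
        rw [List.map_cons] at hch
        have htr : IsTrans 𝒯 F.lt := ⟨fun _ _ _ => F.lt_trans⟩
        rw [hty]
        exact List.rel_of_pairwise_cons (List.isChain_iff_pairwise.1 hch) ht
      · refine ih ty _ X' G hn ?_ Y (fun y hy => (hY hy).resolve_left fun h => hvY (h ▸ hy)) hne hc
        rw [Set.disjoint_insert_left] at hd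
        refine Set.disjoint_left.2 ?_
        rintro _ hz ⟨z, hzP, rfl⟩
        by_cases hzx : z = x
        · subst hzx
          rw [Function.update_self] at hz
          exact hv hz
        · rw [Function.update_of_ne hzx] at hz
          exact Set.disjoint_left.1 hd.2 hz ⟨z, by simpa [Proc.fn, hzx] using hzP, rfl⟩
  | .par P Q, hF => by
    intro ty ρ X G hn hd
    have ih₁ : F.Good P := RootedForest.ForestCompatible.good fun s A hs => hF s A (.left _ hs)
    have ih₂ : F.Good Q := RootedForest.ForestCompatible.good fun s A hs => hF s A (.right _ hs)
    obtain ⟨X₁, X₂, G₁, G₂, hX, rfl, rfl, h₁, h₂⟩ := hn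
    have hfn : ρ '' (Proc.par P Q).fn = ρ '' P.fn ∪ ρ '' Q.fn := by
      rw [← Set.image_union, ← Finset.coe_union]; rfl
    rw [hfn, Set.disjoint_union_left, Set.disjoint_union_right, Set.disjoint_union_right] at hd
    obtain ⟨⟨hd₁, hd₁'⟩, hd₂, hd₂'⟩ := hd
    have hG₁ : ∀ u v, G₁ u v → u ∉ X₂ ∧ v ∉ X₂ := fun u v h =>
      have hdis := Set.disjoint_union_right.2 ⟨hX.symm, hd₂⟩
      ⟨Set.disjoint_right.1 hdis (h₁.support h).1, Set.disjoint_right.1 hdis (h₁.support h).2⟩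
    have hG₂ : ∀ u v, G₂ u v → u ∉ X₁ ∧ v ∉ X₁ := fun u v h =>
      have hdis := Set.disjoint_union_right.2 ⟨hX, hd₁'⟩
      ⟨Set.disjoint_right.1 hdis (h₂.support h).1, Set.disjoint_right.1 hdis (h₂.support h).2⟩
    rintro Y hY ⟨y, hy⟩ hc
    rcases hY hy with hyX | hyX
    · obtain ⟨hYX, hc'⟩ := hc.of_union hY (fun u v h => (hG₁ u v h).2)
        (fun u v h => (hG₂ u v h).1) hy hyX
      exact ih₁ ty ρ X₁ G₁ h₁ hd₁ Y hYX ⟨y, hy⟩ hc'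
    · have hc₂ : Connected (fun u v => G₂ u v ∨ G₁ u v) Y := fun u hu v hv =>
        (hc u hu v hv).mono (fun _ _ => Or.symm) subset_rfl
      obtain ⟨hYX, hc'⟩ := hc₂.of_union (Set.union_comm X₁ X₂ ▸ hY) (fun u v h => (hG₂ u v h).2)
        (fun u v h => (hG₁ u v h).1) hy hyX
      exact ih₂ ty ρ X₂ G₂ h₂ hd₂' Y hYX ⟨y, hy⟩ hc'
  | .sum M, _ => by
    rintro ty ρ X G ⟨rfl, rfl⟩ - Y hY ⟨y, hy⟩
    exact (hY hy).elim
  | .repl M, _ => by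
    rintro ty ρ X G ⟨rfl, rfl⟩ - Y hY ⟨y, hy⟩
    exact (hY hy).elim

theorem RootedForest.Compatible.good {P : Proc 𝒩 𝒯} (h : F.Compatible P) : F.Good P := by
  obtain ⟨_, ⟨Q, hQ, rfl⟩, h⟩ := h
  exact hQ.good_iff.1 h.good

/-! ### Terms with good graphs are compatible -/

theorem Proc.SC.prod_cons (A : Proc 𝒩 𝒯) (L : List (Proc 𝒩 𝒯)) :
    Proc.SC (Proc.prod (A :: L)) (.par A (Proc.prod L)) := by
  cases L with
  | nil => exact (Proc.SC.par_nil A).symm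
  | cons B L => exact .refl _

theorem Proc.SC.prod_append (L L' : List (Proc 𝒩 𝒯)) :
    Proc.SC (Proc.prod (L ++ L')) (.par (Proc.prod L) (Proc.prod L')) := by
  induction L with
  | nil => exact ((Proc.SC.par_comm _ _).trans (.par_nil _)).symm
  | cons A L ih =>
    exact (((prod_cons A (L ++ L')).trans (.par_congr (.refl _) ih)).trans
      (Proc.SC.par_assoc _ _ _).symm).trans (.par_congr (prod_cons A L).symm (.refl _))

theorem Proc.SC.prod_perm {L L' : List (Proc 𝒩 𝒯)} (h : L.Perm L') :
    Proc.SC (Proc.prod L) (Proc.prod L') := by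
  induction h with
  | nil => exact .refl _
  | cons A _ ih =>
    exact ((prod_cons A _).trans (.par_congr (.refl _) ih)).trans (prod_cons A _).symm
  | swap A B L =>
    have h : ∀ A B, Proc.SC (Proc.prod (A :: B :: L)) (.par (.par A B) (Proc.prod L)) :=
      fun A B => ((prod_cons A _).trans (.par_congr (.refl _) (prod_cons B L))).trans
        (Proc.SC.par_assoc _ _ _).symm
    exact ((h B A).trans (.par_congr (.par_comm _ _) (.refl _))).trans (h A B).symm
  | trans _ _ ih ih' => exact ih.trans ih'

theorem Proc.SC.factors : ∀ P : Proc 𝒩 𝒯, Proc.SC P (Proc.prod P.factors)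
  | .res _ _ _ => .refl _
  | .par P Q => (Proc.SC.par_congr (Proc.SC.factors P) (Proc.SC.factors Q)).trans
      (Proc.SC.prod_append _ _).symm
  | .sum .zero => .refl _
  | .sum (.plus _ _) => .refl _
  | .sum (.pre _ _) => .refl _
  | .repl _ => .refl _

theorem Proc.SC.ress_congr {P Q : Proc 𝒩 𝒯} (h : P.SC Q) :
    ∀ X : List (𝒩 × Ty 𝒯), Proc.SC (Proc.ress X P) (Proc.ress X Q)
  | [] => h
  | p :: X => .res_congr p.1 p.2 (h.ress_congr X)

theorem Proc.SC.ress_perm (P : Proc 𝒩 𝒯) {X X' : List (𝒩 × Ty 𝒯)} (h : X.Perm X')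
    (hX : (X.map Prod.fst).Nodup) : Proc.SC (Proc.ress X P) (Proc.ress X' P) := by
  induction h with
  | nil => exact .refl _
  | cons p _ ih => exact .res_congr _ _ (ih (List.nodup_cons.1 hX).2)
  | swap p q X =>
    refine .res_swap _ _ _ _ _ fun h => ?_
    simp [h] at hX
  | trans h _ ih ih' => exact (ih hX).trans (ih' ((h.map _).nodup_iff.1 hX))

theorem Proc.SC.res_of_notMem {x : 𝒩} (τ : Ty 𝒯) {P : Proc 𝒩 𝒯} (hx : x ∉ P.fn) :
    Proc.SC (.res x τ P) P :=
  (((Proc.SC.res_congr x τ (Proc.SC.par_nil P).symm).trans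
    (Proc.SC.extrude x τ P .nil hx).symm).trans
      (.par_congr (.refl _) (.res_nil x τ))).trans (.par_nil P)

/-- `Q` is a parallel component of a compatible rearrangement of a term with graph `G`: its paths to
sequential terms are increasing and carry base types of names in `Y`, and the names in `Y` together
with the free names of `Q` are connected through `Y`. -/
structure RootedForest.IsCluster (F : RootedForest 𝒯) (ty : 𝒩 → 𝒯) (G : 𝒩 → 𝒩 → Prop)
    (Y : Set 𝒩) (Q : Proc 𝒩 𝒯) : Prop where
  walk : ∀ u v, u ∈ Q.fn ∨ u ∈ Y → v ∈ Q.fn ∨ v ∈ Y → Walk G Y u v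
  chain : ∀ s A, Q.forest.IsTrace (leafTrace s A) → List.IsChain F.lt (s.map Prod.snd)
  mem : ∀ s A, Q.forest.IsTrace (leafTrace s A) → ∀ t ∈ s.map Prod.snd, ∃ y ∈ Y, ty y = t

/-- A new root for some clusters that it is joined to, whose base type is minimal: it is the least
name of the resulting cluster since that is connected. -/
theorem RootedForest.IsCluster.res {G : 𝒩 → 𝒩 → Prop} {X : Set 𝒩} {x : 𝒩} {τ : Ty 𝒯}
    {D : List (Proc 𝒩 𝒯)} {Y : Proc 𝒩 𝒯 → Set 𝒩} (hG : F.HasLeast ty X G)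
    (hD : ∀ Q ∈ D, F.IsCluster ty G (Y Q) Q) (hDx : ∀ Q ∈ D, x ∈ Q.fn) (hne : D ≠ [])
    (hYX : ∀ Q ∈ D, Y Q ⊆ X) (hxY : ∀ Q ∈ D, x ∉ Y Q) (hxX : x ∈ X) (hx : ty x = τ.base)
    (hmin : ∀ y ∈ X, ¬ F.lt (ty y) (ty x)) :
    F.IsCluster ty G (insert x {y | ∃ Q ∈ D, y ∈ Y Q}) (.res x τ (Proc.prod D)) := by
  set Z : Set 𝒩 := insert x {y | ∃ Q ∈ D, y ∈ Y Q} with hZ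
  have hYZ : ∀ Q ∈ D, Y Q ⊆ Z := fun Q hQ y hy => .inr ⟨Q, hQ, hy⟩
  have hxZ : x ∈ Z := Set.mem_insert _ _
  have hZX : Z ⊆ X := Set.insert_subset hxX fun y ⟨Q, hQ, hy⟩ => hYX Q hQ hy
  have hcl : ∀ u, u ∈ (Proc.res x τ (Proc.prod D)).fn ∨ u ∈ Z →
      ∃ Q ∈ D, u ∈ Q.fn ∨ u ∈ Y Q := by
    rintro u (hu | rfl | ⟨Q, hQ, hu⟩)
    · obtain ⟨Q, hQ, hu⟩ := Proc.mem_fn_prod.1 (Finset.mem_sdiff.1 hu).1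
      exact ⟨Q, hQ, .inl hu⟩
    · obtain ⟨Q, hQ⟩ := List.exists_mem_of_ne_nil D hne
      exact ⟨Q, hQ, .inl (hDx Q hQ)⟩
    · exact ⟨Q, hQ, .inr hu⟩
  have hwalk : ∀ u v, u ∈ (Proc.res x τ (Proc.prod D)).fn ∨ u ∈ Z →
      v ∈ (Proc.res x τ (Proc.prod D)).fn ∨ v ∈ Z → Walk G Z u v := by
    intro u v hu hv
    obtain ⟨Q, hQ, hu⟩ := hcl u hu
    obtain ⟨Q', hQ', hv⟩ := hcl v hv
    exact (((hD Q hQ).walk u x hu (.inl (hDx Q hQ))).mono (fun _ _ => id) (hYZ Q hQ)).trans hxZ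
      (((hD Q' hQ').walk x v (.inl (hDx Q' hQ')) hv).mono (fun _ _ => id) (hYZ Q' hQ'))
  obtain ⟨m, hm, hlt⟩ := hG Z hZX ⟨x, hxZ⟩ fun u hu v hv => hwalk u v (.inr hu) (.inr hv)
  obtain rfl : x = m := by
    by_contra hxm
    exact hmin m (hZX hm) (hlt x hxZ hxm)
  have hlt' : ∀ Q ∈ D, ∀ y ∈ Y Q, F.lt (ty x) (ty y) := fun Q hQ y hy =>
    hlt y (hYZ Q hQ hy) fun e => hxY Q hQ (e ▸ hy)
  refine ⟨hwalk, fun s A hs => ?_, fun s A hs t ht => ?_⟩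
  · have htr : IsTrans 𝒯 F.lt := ⟨fun _ _ _ => F.lt_trans⟩
    rcases exists_isTrace_of_res hs with hs | ⟨s, rfl, hs'⟩
    · obtain ⟨Q, hQ, hs⟩ := exists_isTrace_of_prod hs
      exact (hD Q hQ).chain s A hs
    · obtain ⟨Q, hQ, hs⟩ := exists_isTrace_of_prod hs'
      rw [List.map_cons, List.isChain_iff_pairwise, List.pairwise_cons]
      refine ⟨fun t ht => ?_, List.isChain_iff_pairwise.1 ((hD Q hQ).chain s A hs)⟩
      obtain ⟨y, hy, rfl⟩ := (hD Q hQ).mem s A hs t ht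
      exact hx ▸ hlt' Q hQ y hy
  · rcases exists_isTrace_of_res hs with hs | ⟨s, rfl, hs'⟩
    · obtain ⟨Q, hQ, hs⟩ := exists_isTrace_of_prod hs
      obtain ⟨y, hy, rfl⟩ := (hD Q hQ).mem s A hs t ht
      exact ⟨y, hYZ Q hQ hy, rfl⟩
    · obtain ⟨Q, hQ, hs⟩ := exists_isTrace_of_prod hs'
      rcases List.mem_cons.1 ht with rfl | ht
      · exact ⟨x, hxZ, hx⟩
      · obtain ⟨y, hy, rfl⟩ := (hD Q hQ).mem s A hs t ht
        exact ⟨y, hYZ Q hQ hy, rfl⟩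

/-- A term with a good graph is congruent to a composition of clusters. The restrictions are put in
place by decreasing base types, each one on top of the clusters in which it is free. -/
theorem RootedForest.HasLeast.exists_clusters [Finite 𝒯] {P : Proc 𝒩 𝒯} (hP : P.Flat) (n : ℕ) :
    ∀ X : List (𝒩 × Ty 𝒯), X.length = n → (X.map Prod.fst).Nodup →
    (∀ p ∈ X, ty p.1 = p.2.base) → F.HasLeast ty (namesOf X) P.Co →
    ∃ D : List (Proc 𝒩 𝒯), Proc.SC (Proc.ress X P) (Proc.prod D) ∧
      ∀ Q ∈ D, ∃ Y ⊆ namesOf X, F.IsCluster ty P.Co Y Q := by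
  induction n with
  | zero =>
    intro X hn _ _ _
    obtain rfl := List.length_eq_zero_iff.1 hn
    refine ⟨P.factors, Proc.SC.factors P, fun A hA => ⟨∅, Set.empty_subset _, ?_, ?_, ?_⟩⟩
    · intro u v hu hv
      simp only [Set.mem_empty_iff_false, or_false] at hu hv
      exact .edge (hP.co_iff.2 ⟨A, hA, hu, hv⟩)
    · intro s B hs
      obtain rfl := (hP.factors A hA).eq_nil_of_isTrace hs
      exact List.isChain_nil
    · intro s B hs t ht
      obtain rfl := (hP.factors A hA).eq_nil_of_isTrace hs
      simp at ht
  | succ n ih =>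
    intro X hn hX hty hl
    obtain ⟨⟨x, τ⟩, hp, hmin⟩ := F.exists_minimal (X := X) (by rintro rfl; simp at hn)
    obtain ⟨X₁, X₂, rfl⟩ := List.append_of_mem hp
    have hperm : (X₁ ++ (x, τ) :: X₂).Perm ((x, τ) :: (X₁ ++ X₂)) := List.perm_middle
    have hX' := (hperm.map Prod.fst).nodup_iff.1 hX
    rw [List.map_cons, List.nodup_cons] at hX'
    have hxX : x ∉ namesOf (X₁ ++ X₂) := hX'.1
    have hnames : namesOf (X₁ ++ (x, τ) :: X₂) = insert x (namesOf (X₁ ++ X₂)) := by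
      simp [Set.union_insert]
    rw [hnames] at hl ⊢
    have hsub := Set.subset_insert x (namesOf (X₁ ++ X₂))
    obtain ⟨D, hsc, hD⟩ := ih (X₁ ++ X₂) (by simp at hn ⊢; omega) hX'.2
      (fun p hp => hty p (hperm.mem_iff.2 (List.mem_cons_of_mem _ hp))) (hl.mono hsub)
    have hsc' : Proc.SC (Proc.ress (X₁ ++ (x, τ) :: X₂) P) (.res x τ (Proc.prod D)) :=
      (Proc.SC.ress_perm P hperm hX).trans (.res_congr x τ hsc)
    have hD' : ∀ Q ∈ D, ∃ Y ⊆ insert x (namesOf (X₁ ++ X₂)), F.IsCluster ty P.Co Y Q :=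
      fun Q hQ => let ⟨Y, hY, h⟩ := hD Q hQ; ⟨Y, hY.trans hsub, h⟩
    choose! Y hYX hcl using hD
    set D₁ := D.filter (fun Q => x ∈ Q.fn) with hD₁
    set D₂ := D.filter (fun Q => ¬ x ∈ Q.fn) with hD₂
    have hm₁ : ∀ Q ∈ D₁, Q ∈ D ∧ x ∈ Q.fn := fun Q hQ => by simpa [hD₁] using hQ
    have hm₂ : ∀ Q ∈ D₂, Q ∈ D ∧ x ∉ Q.fn := fun Q hQ => by simpa [hD₂] using hQ
    by_cases hne : D₁ = []
    · refine ⟨D, hsc'.trans (Proc.SC.res_of_notMem τ fun h => ?_), hD'⟩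
      obtain ⟨Q, hQ, hx⟩ := Proc.mem_fn_prod.1 h
      have : Q ∈ D₁ := by simp [hD₁, hQ, hx]
      simp [hne] at this
    · have hxD₂ : x ∉ (Proc.prod D₂).fn := fun h => by
        obtain ⟨Q, hQ, hx⟩ := Proc.mem_fn_prod.1 h
        exact (hm₂ Q hQ).2 hx
      have hDperm : D.Perm (D₂ ++ D₁) := by
        have := (List.filter_append_perm (fun Q : Proc 𝒩 𝒯 => decide (x ∈ Q.fn)) D).symm
        refine this.trans (List.perm_append_comm.trans (List.Perm.of_eq ?_))
        simp [hD₁, hD₂]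
      refine ⟨.res x τ (Proc.prod D₁) :: D₂, ?_, ?_⟩
      · refine hsc'.trans ?_
        refine (Proc.SC.res_congr x τ ((Proc.SC.prod_perm hDperm).trans
          (Proc.SC.prod_append D₂ D₁))).trans ?_
        exact ((Proc.SC.extrude x τ _ _ hxD₂).symm.trans (.par_comm _ _)).trans
          (Proc.SC.prod_cons _ _).symm
      · intro Q hQ
        rcases List.mem_cons.1 hQ with rfl | hQ
        · refine ⟨_, ?_, RootedForest.IsCluster.res hl (fun Q hQ => hcl Q (hm₁ Q hQ).1)
            (fun Q hQ => (hm₁ Q hQ).2) hne (fun Q hQ => (hYX Q (hm₁ Q hQ).1).trans hsub)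
            (fun Q hQ h => hxX (hYX Q (hm₁ Q hQ).1 h)) (Set.mem_insert _ _) (hty (x, τ) hp) ?_⟩
          · rintro y (rfl | ⟨Q, hQ, hy⟩)
            · exact Set.mem_insert _ _
            · exact hsub (hYX Q (hm₁ Q hQ).1 hy)
          · intro y hy
            rw [← hnames] at hy
            obtain ⟨σ, hσ⟩ := exists_of_mem_namesOf hy
            have h₁ := hty _ hσ
            have h₂ := hty _ hp
            simp only at h₁ h₂
            rw [h₁, h₂]
            exact hmin _ hσ
        · exact hD' Q (hm₂ Q hQ).1

theorem Proc.Flat.compatible (F : RootedForest 𝒯) {P : Proc 𝒩 𝒯} (hP : P.Flat) :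
    F.Compatible P := by
  refine ⟨P.forest, ⟨P, .refl P, rfl⟩, fun s A hs => ?_⟩
  obtain rfl := hP.eq_nil_of_isTrace hs
  exact List.isChain_nil

/-- The converse of `RootedForest.Compatible.good` for normal forms. -/
theorem RootedForest.LeastOn.compatible [Finite 𝒯] {X : List (𝒩 × Ty 𝒯)} {P : Proc 𝒩 𝒯}
    (h : F.LeastOn X P) (hP : P.Flat) (hX : (X.map Prod.fst).Nodup) :
    F.Compatible (Proc.ress X P) := by
  classical
  rcases X with - | ⟨p, X⟩
  · exact hP.compatible F
  let ty : 𝒩 → 𝒯 := fun x =>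
    if h : ∃ τ, (x, τ) ∈ p :: X then h.choose.base else p.2.base
  have hty : ∀ q ∈ p :: X, ty q.1 = q.2.base := fun q hq => by
    have hex : ∃ τ, (q.1, τ) ∈ p :: X := ⟨q.2, hq⟩
    simp only [ty, dif_pos hex]
    rw [eq_of_mem_of_nodup hX hex.choose_spec hq]
  obtain ⟨D, hsc, hD⟩ := RootedForest.HasLeast.exists_clusters hP _ _ rfl hX hty
    (h ty fun q hq _ => hty q hq)
  refine ⟨_, ⟨_, hsc.symm, rfl⟩, fun s A hs => ?_⟩
  obtain ⟨Q, hQ, hs⟩ := exists_isTrace_of_prod hs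
  obtain ⟨Y, -, hcl⟩ := hD Q hQ
  exact hcl.chain s A hs

/-! ### Shaped normal forms -/

theorem RootedForest.LeastOn.tail {p : 𝒩 × Ty 𝒯} {X : List (𝒩 × Ty 𝒯)} {P : Proc 𝒩 𝒯}
    (h : F.LeastOn (p :: X) P) (hX : ((p :: X).map Prod.fst).Nodup) : F.LeastOn X P := by
  intro ty hty Y hY hne hc
  rw [List.map_cons, List.nodup_cons] at hX
  have hp : p.1 ∉ namesOf X := hX.1
  have hu : ∀ y ∈ namesOf X, Function.update ty p.1 p.2.base y = ty y := fun y hy =>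
    Function.update_of_ne (ne_of_mem_of_not_mem hy hp) _ _
  obtain ⟨m, hm, hmin⟩ := h (Function.update ty p.1 p.2.base) (fun q hq hqP => by
    rcases List.mem_cons.1 hq with rfl | hq
    · exact Function.update_self _ _ _
    · rw [hu _ (mem_namesOf hq)]
      exact hty q hq hqP) Y (hY.trans (by simp)) hne hc
  refine ⟨m, hm, fun y hy hym => ?_⟩
  rw [← hu m (hY hm), ← hu y (hY hy)]
  exact hmin y hy hym

theorem RootedForest.leastOn_nil (F : RootedForest 𝒯) (P : Proc 𝒩 𝒯) : F.LeastOn [] P := by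
  rintro ty - Y hY ⟨y, hy⟩
  simpa using hY hy

mutual

theorem Proc.NFGrammar.compatible_subterm [Finite 𝒯] : ∀ {P : Proc 𝒩 𝒯}, P.NFGrammar →
    P.binders.Nodup → F.GoodConts P → F.LeastOn P.restrs P.body → ∀ R ∈ P.subterms,
    F.Compatible R
  | .res x τ P, hP, hb, hg, hl, R, hR => by
    have hP' : P.NFGrammar := by
      cases hP with
      | res _ _ h => exact h
      | prod h => cases h
    rcases hR with rfl | hR
    · have := hl.compatible hP.flat_body (hb.sublist (Proc.restrs_sublist _))
      rwa [Proc.ress_restrs_body] at this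
    · exact hP'.compatible_subterm (List.nodup_cons.1 hb).2 hg
        (hl.tail (hb.sublist (Proc.restrs_sublist (.res x τ P)))) R hR
  | .par P Q, hP, hb, hg, _, R, hR => by
    obtain ⟨h₁, h₂⟩ : P.NFProd ∧ Q.NFProd := by
      cases hP with | prod h => cases h with | par h₁ h₂ => exact ⟨h₁, h₂⟩
    have hb' := List.nodup_append.1 hb
    rcases hR with (rfl | hR) | hR
    · exact Proc.Flat.compatible F ⟨h₁.flat, h₂.flat⟩
    · exact (Proc.NFGrammar.prod h₁).compatible_subterm hb'.1 hg.1
        (h₁.restrs_eq ▸ F.leastOn_nil _) R hR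
    · exact (Proc.NFGrammar.prod h₂).compatible_subterm hb'.2.1 hg.2
        (h₂.restrs_eq ▸ F.leastOn_nil _) R hR
  | .sum M, hP, hb, hg, _, R, hR => by
    refine Choice.compatible_subterm M ?_ hb hg R hR
    cases hP with
    | nil => exact .inl rfl
    | prod h => cases h with | sum h => exact .inr h
  | .repl M, hP, hb, hg, _, R, hR => by
    rcases hR with rfl | hR
    · exact Proc.Flat.compatible (P := .repl M) F trivial
    · refine Choice.compatible_subterm M ?_ hb hg R hR
      cases hP with | prod h => cases h with | repl h => exact .inr h

theorem Choice.compatible_subterm [Finite 𝒯] : ∀ (M : Choice 𝒩 𝒯), M = .zero ∨ M.NFSum →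
    M.binders.Nodup → F.GoodContsChoice M → ∀ R ∈ M.subterms, F.Compatible R
  | .zero, _, _, _, R, hR => by
    obtain rfl := hR
    exact Proc.Flat.compatible (P := .sum .zero) F trivial
  | .plus M L, hM, hb, hg, R, hR => by
    obtain ⟨h₁, h₂⟩ : M.NFSum ∧ L.NFSum := by
      rcases hM with h | h
      · cases h
      · cases h with | plus h₁ h₂ => exact ⟨h₁, h₂⟩
    have hb' := List.nodup_append.1 hb
    rcases hR with (rfl | hR) | hR
    · exact Proc.Flat.compatible (P := .sum (.plus M L)) F trivial
    · exact Choice.compatible_subterm M (.inr h₁) hb'.1 hg.1 R hR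
    · exact Choice.compatible_subterm L (.inr h₂) hb'.2.1 hg.2 R hR
  | .pre p P, hM, hb, hg, R, hR => by
    have hP : P.NFGrammar := by
      rcases hM with h | h
      · cases h
      · cases h with | pre _ h => exact h
    have hbP : P.binders.Nodup := by
      cases p with
      | inp a x => exact (List.nodup_cons.1 hb).2
      | out a b => exact hb
      | tau => exact hb
    rcases hR with rfl | hR
    · exact Proc.Flat.compatible (P := .sum (.pre p P)) F trivial
    · refine hP.compatible_subterm hbP hg.1 ?_ R hR
      have hgP := hg.2
      rw [← P.ress_restrs_body] at hgP
      exact hgP.leastOn hP.flat_body (hbP.sublist P.restrs_sublist)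

end

theorem Proc.IsNormalForm.shaped [Finite 𝒯] {P : Proc 𝒩 𝒯} (hP : P.IsNormalForm)
    (hg : F.GoodConts P) (h : F.Good P) : F.Shaped P := by
  rw [← P.ress_restrs_body] at h
  exact hP.1.compatible_subterm hP.2.1 hg
    (h.leastOn hP.1.flat_body (hP.2.1.sublist P.restrs_sublist))

mutual

theorem RootedForest.goodConts_of_compatible : ∀ (P : Proc 𝒩 𝒯),
    (∀ R ∈ P.subterms, F.Compatible R) → F.GoodConts P
  | .res _ _ P, h => goodConts_of_compatible P fun R hR => h R (.inr hR)
  | .par P Q, h => ⟨goodConts_of_compatible P fun R hR => h R (.inl (.inr hR)),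
      goodConts_of_compatible Q fun R hR => h R (.inr hR)⟩
  | .sum M, h => goodContsChoice_of_compatible M h
  | .repl M, h => goodContsChoice_of_compatible M fun R hR => h R (.inr hR)

theorem RootedForest.goodContsChoice_of_compatible : ∀ (M : Choice 𝒩 𝒯),
    (∀ R ∈ M.subterms, F.Compatible R) → F.GoodContsChoice M
  | .zero, _ => trivial
  | .plus M L, h => ⟨goodContsChoice_of_compatible M fun R hR => h R (.inl (.inr hR)),
      goodContsChoice_of_compatible L fun R hR => h R (.inr hR)⟩
  | .pre _ P, h => ⟨goodConts_of_compatible P fun R hR => h R (.inr hR),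
      (h P (.inr P.mem_subterms_self)).good⟩

end

end

section

variable {𝒩 : Type u} {𝒯 : Type v}

/-! ### Typing of normal forms -/

theorem Proc.binders_factors_sublist : ∀ {P A : Proc 𝒩 𝒯}, A ∈ P.factors →
    A.binders.Sublist P.binders
  | .res x τ P, A, h => by simp [Proc.factors] at h; subst h; exact .refl _
  | .par P Q, A, h => by
    rcases List.mem_append.1 h with h | h
    · exact (binders_factors_sublist h).trans (List.sublist_append_left _ _)
    · exact (binders_factors_sublist h).trans (List.sublist_append_right _ _)
  | .sum .zero, A, h => by simp [Proc.factors] at h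
  | .sum (.plus M L), A, h => by simp [Proc.factors] at h; subst h; exact .refl _
  | .sum (.pre p P), A, h => by simp [Proc.factors] at h; subst h; exact .refl _
  | .repl M, A, h => by simp [Proc.factors] at h; subst h; exact .refl _

theorem Proc.binders_body_sublist : ∀ P : Proc 𝒩 𝒯, P.body.binders.Sublist P.binders
  | .res x _ P => P.binders_body_sublist.cons x
  | .par _ _ => .refl _
  | .sum _ => .refl _
  | .repl _ => .refl _

theorem Proc.exists_comp_eq {P A : Proc 𝒩 𝒯} (h : A ∈ P.comps) : ∃ i, P.comp i = A :=
  List.mem_iff_get.1 h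

variable [DecidableEq 𝒩] {F : RootedForest 𝒯}

theorem Env.extend_of_notMem (Γ : Env 𝒩 𝒯) : ∀ {X : List (𝒩 × Ty 𝒯)} {z : 𝒩}, z ∉ namesOf X →
    Γ.extend X z = Γ z
  | [], _, _ => rfl
  | p :: X, z, h => by
    simp only [namesOf_cons, Set.mem_insert_iff, not_or] at h
    exact (Function.update_of_ne h.1 _ _).trans (Env.extend_of_notMem Γ h.2)

theorem Env.extend_of_mem (Γ : Env 𝒩 𝒯) : ∀ {X : List (𝒩 × Ty 𝒯)}, (X.map Prod.fst).Nodup →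
    ∀ {z τ}, (z, τ) ∈ X → Γ.extend X z = some τ
  | p :: X, hX, z, τ, h => by
    rw [List.map_cons, List.nodup_cons] at hX
    rcases List.mem_cons.1 h with rfl | h
    · exact Function.update_self _ _ _
    · have hz : z ≠ p.1 := ne_of_mem_of_not_mem (List.mem_map_of_mem (f := Prod.fst) h) hX.1
      exact (Function.update_of_ne hz _ _).trans (Env.extend_of_mem Γ hX.2 h)

theorem Env.extend_update (Γ : Env 𝒩 𝒯) {x : 𝒩} {τ : Option (Ty 𝒯)} :
    ∀ {X : List (𝒩 × Ty 𝒯)}, x ∉ namesOf X →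
    Env.extend (Function.update Γ x τ) X = Function.update (Γ.extend X) x τ
  | [], _ => rfl
  | p :: X, h => by
    simp only [namesOf_cons, Set.mem_insert_iff, not_or] at h
    have : ∀ Δ : Env 𝒩 𝒯, Env.extend Δ (p :: X) =
        Function.update (Δ.extend X) p.1 (some p.2) := fun Δ => rfl
    rw [this, this, Env.extend_update Γ h.2, Function.update_comm h.1]

theorem RootedForest.wt_ress {P : Proc 𝒩 𝒯} : ∀ {X : List (𝒩 × Ty 𝒯)} {Γ : Env 𝒩 𝒯},
    (X.map Prod.fst).Nodup → (F.WT (Proc.ress X P) Γ ↔ F.WT P (Γ.extend X))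
  | [], _, _ => Iff.rfl
  | p :: X, Γ, h => by
    rw [List.map_cons, List.nodup_cons] at h
    have h₁ : Proc.ress (p :: X) P = .res p.1 p.2 (Proc.ress X P) := rfl
    have h₂ : Γ.extend (p :: X) = Function.update (Γ.extend X) p.1 (some p.2) := rfl
    rw [h₁, h₂, ← Γ.extend_update h.1]
    exact RootedForest.wt_ress h.2

theorem RootedForest.wt_of_factors {Γ : Env 𝒩 𝒯} : ∀ {P : Proc 𝒩 𝒯},
    (∀ A ∈ P.factors, F.WT A Γ) → F.WT P Γ
  | .res x τ P, h => h (.res x τ P) (by simp [Proc.factors])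
  | .par P Q, h => ⟨wt_of_factors fun A hA => h A (by simp [Proc.factors, hA]),
      wt_of_factors fun A hA => h A (by simp [Proc.factors, hA])⟩
  | .sum .zero, _ => trivial
  | .sum (.plus M L), h => h (.sum (.plus M L)) (by simp [Proc.factors])
  | .sum (.pre p P), h => h (.sum (.pre p P)) (by simp [Proc.factors])
  | .repl M, h => h (.repl M) (by simp [Proc.factors])

/-- Walks in the graph of a normal form are walks in the linkedness relation on its components. -/
theorem Proc.nameTied_of_walk {P : Proc 𝒩 𝒯} (hP : P.body.Flat) {u v : 𝒩}
    (h : Walk P.body.Co (namesOf P.restrs) u v) : ∃ i, u ∈ (P.comp i).fn ∧ P.NameTied v i := by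
  induction h with
  | edge h =>
    obtain ⟨A, hA, hu, hv⟩ := hP.co_iff.1 h
    obtain ⟨i, rfl⟩ := Proc.exists_comp_eq hA
    exact ⟨i, hu, i, hv, .refl⟩
  | step h hm _ ih =>
    obtain ⟨A, hA, hu, hw⟩ := hP.co_iff.1 h
    obtain ⟨i, rfl⟩ := Proc.exists_comp_eq hA
    obtain ⟨j, hj, k, hk, ht⟩ := ih
    exact ⟨i, hu, k, hk, ht.tail ⟨_, Finset.mem_inter.2 ⟨hj, hw⟩, hm⟩⟩

mutual

theorem RootedForest.TypesProc.wt (F : RootedForest 𝒯) : ∀ {Γ : Env 𝒩 𝒯} {P : Proc 𝒩 𝒯},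
    F.TypesProc Γ P → P.binders.Nodup → F.WT P Γ ∧ F.CoBaseBelow Γ P ∧ P.body.Flat
  | Γ, P, .par _ hseq hbase, hb => by
    have hX := hb.sublist P.restrs_sublist
    have key : ∀ A ∈ P.body.factors, F.WT A (Γ.extend P.restrs) ∧ A.Flat := by
      intro A hA
      obtain ⟨i, hi⟩ := Proc.exists_comp_eq hA
      have := RootedForest.TypesSeq.wt F (hseq i)
      rw [hi] at this
      exact this (hb.sublist ((Proc.binders_factors_sublist hA).trans P.binders_body_sublist))
    have hflat : P.body.Flat := Proc.flat_of_flat_factors fun A hA => (key A hA).2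
    refine ⟨?_, ?_, hflat⟩
    · rw [← P.ress_restrs_body]
      exact (RootedForest.wt_ress hX).2 (RootedForest.wt_of_factors fun A hA => (key A hA).1)
    · intro z t h σ hσ
      rw [← P.ress_restrs_body, Proc.coBase_ress hflat hX] at h
      obtain ⟨-, p, hp, rfl, hw⟩ := h
      obtain ⟨i, hz, hi⟩ := Proc.nameTied_of_walk hflat hw
      exact hbase i p hp hi z hz σ hσ

theorem RootedForest.TypesSeq.wt (F : RootedForest 𝒯) : ∀ {Γ : Env 𝒩 𝒯} {P : Proc 𝒩 𝒯},
    F.TypesSeq Γ P → P.binders.Nodup → F.WT P Γ ∧ P.Flat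
  | _, _, .sum h, hb => ⟨RootedForest.TypesChoice.wt F h hb, trivial⟩
  | _, _, .repl h, hb => ⟨RootedForest.TypesChoice.wt F h hb, trivial⟩

theorem RootedForest.TypesChoice.wt (F : RootedForest 𝒯) : ∀ {Γ : Env 𝒩 𝒯} {M : Choice 𝒩 𝒯},
    F.TypesChoice Γ M → M.binders.Nodup → F.WTChoice M Γ
  | _, _, .plus h₁ h₂, hb =>
    have hb' := List.nodup_append.1 hb
    ⟨RootedForest.TypesChoice.wt F h₁ hb'.1, RootedForest.TypesChoice.wt F h₂ hb'.2.1⟩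
  | _, _, .tau h, hb =>
    have h' := RootedForest.TypesProc.wt F h hb
    ⟨h'.1, h'.2.1⟩
  | _, _, .out ha hb' h, hb =>
    have h' := RootedForest.TypesProc.wt F h hb
    ⟨⟨_, _, ha, hb'⟩, h'.1, h'.2.1⟩
  | Γ, _, .inp (a := a) (x := x) (P := P) ha _ h hor, hb => by
    have hbP : P.binders.Nodup := (List.nodup_cons.1 hb).2
    have h' := RootedForest.TypesProc.wt F h hbP
    refine ⟨_, _, ha, h'.1, h'.2.1, hor.imp_right fun hmig z hza _ hz σ hσ => ?_⟩
    rw [← P.ress_restrs_body, Proc.co_ress (hbP.sublist P.restrs_sublist)] at hz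
    obtain ⟨i, hzi, hi⟩ := Proc.nameTied_of_walk h'.2.2 (hz.2.2.symm fun _ _ => Proc.Co.symm)
    exact hmig i hi z (by simp [hzi, hza]) σ hσ

end

/-! ### Graphs of reducts -/

/-- Renaming `x` to a name outside `Y` does not create walks through `Y`, as `x` is not identified
with an inner vertex. -/
theorem Walk.of_substName {G : 𝒩 → 𝒩 → Prop} {Y : Set 𝒩} {x b u v : 𝒩} (hb : b ∉ Y)
    (h : Walk (fun u v => ∃ u' v', G u' v' ∧ substName x b u' = u ∧ substName x b v' = v) Y u v) :
    ∃ u' v', Walk G Y u' v' ∧ substName x b u' = u ∧ substName x b v' = v := by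
  induction h with
  | edge h =>
    obtain ⟨u', v', h, hu, hv⟩ := h
    exact ⟨u', v', .edge h, hu, hv⟩
  | step h hm _ ih =>
    obtain ⟨u', w', h, hu, hw⟩ := h
    obtain ⟨w'', v', h', hw', hv⟩ := ih
    have e : ∀ z w, substName x b z = w → w ∈ Y → z = w := fun z w hz hw => by
      rcases substName_cases x b z with ⟨-, h⟩ | ⟨-, h⟩
      · exact (hb (h ▸ hz ▸ hw)).elim
      · exact h.symm.trans hz
    obtain rfl := e _ _ hw hm
    obtain rfl := e _ _ hw' hm
    exact ⟨u', v', .step h hm h', hu, hv⟩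

/-- A synchronisation on `a` that sends `b` for `x` preserves the existence of least elements. The
old names `W` have the graph `GP`, in which the free names `fS` of the sender and `fR` of the
receiver are cliques; the rest of the term has the graph `GC`, and the continuations of sender and
receiver have new names `Ys` and `Yr` and graphs `GS` and `GR`. -/
theorem RootedForest.HasLeast.comm {ty : 𝒩 → 𝒯} {W Ys Yr fS fR : Set 𝒩}
    {GP GC GS GR : 𝒩 → 𝒩 → Prop} {a b x : 𝒩}
    (hP : F.HasLeast ty W GP) (hS : F.HasLeast ty Ys GS) (hR : F.HasLeast ty Yr GR)
    (hPs : ∀ u v, GP u v → GP v u) (hSs : ∀ u v, GS u v → GS v u) (hRs : ∀ u v, GR u v → GR v u)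
    (hfS : ∀ u ∈ fS, ∀ v ∈ fS, GP u v) (hfR : ∀ u ∈ fR, ∀ v ∈ fR, GP u v)
    (hGC : ∀ u v, GC u v → GP u v) (haS : a ∈ fS) (haR : a ∈ fR) (hbS : b ∈ fS)
    (suppS : ∀ u v, GS u v → u ∈ fS ∨ u ∈ Ys)
    (suppR : ∀ u v, GR u v → u = x ∨ u ∈ fR ∨ u ∈ Yr)
    (hYs : ∀ y ∈ Ys, y ∉ W ∧ y ∉ fS ∧ y ∉ fR ∧ y ∉ Yr ∧ ∀ v, ¬ GC y v ∧ ¬ GC v y)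
    (hYr : ∀ y ∈ Yr, y ≠ x ∧ y ∉ W ∧ y ∉ fS ∧ y ∉ fR ∧ ∀ v, ¬ GC y v ∧ ¬ GC v y)
    (hltS : ∀ y ∈ Ys, ∀ z ∈ W, Walk GS Ys z y → F.lt (ty z) (ty y))
    (hltR : ∀ y ∈ Yr, ∀ z ∈ W, Walk GR Yr z y → F.lt (ty z) (ty y))
    (hltx : ∀ y ∈ Yr, b ∈ W → Walk GR Yr x y → F.lt (ty b) (ty y))
    (hor : (b ∈ W → a ∈ W ∧ ¬ F.lt (ty a) (ty b)) ∨
      ∀ v ∈ W, v ∈ fR → Walk GR Yr x v → v ≠ a → a ∈ W ∧ ¬ F.lt (ty a) (ty v)) :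
    F.HasLeast ty (W ∪ Ys ∪ Yr) fun u v => (GC u v ∨ GS u v) ∨
      ∃ u' v', GR u' v' ∧ substName x b u' = u ∧ substName x b v' = v := by
  set GR' : 𝒩 → 𝒩 → Prop := fun u v =>
    ∃ u' v', GR u' v' ∧ substName x b u' = u ∧ substName x b v' = v with hGR'
  have hbYs : b ∉ Ys := fun h => (hYs b h).2.1 hbS
  have hbYr : b ∉ Yr := fun h => (hYr b h).2.2.1 hbS
  have suppS' : ∀ u v, GS u v → v ∈ fS ∨ v ∈ Ys := fun u v h => suppS v u (hSs u v h)
  have suppR' : ∀ u v, GR' u v → u = b ∨ u ∈ fR ∨ u ∈ Yr := by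
    rintro _ _ ⟨u, v, h, rfl, rfl⟩
    rcases substName_cases x b u with ⟨-, e⟩ | ⟨hu, e⟩ <;> rw [e]
    · exact .inl rfl
    · exact .inr ((suppR u v h).resolve_left hu)
  have hGR's : ∀ u v, GR' u v → GR' v u :=
    fun u v ⟨u', v', h, hu, hv⟩ => ⟨v', u', hRs _ _ h, hv, hu⟩
  -- The old vertices, with the shortcuts through new ones.
  have h₀ : F.HasLeast ty W fun u v => (GC u v ∨ Walk GR' Yr u v) ∨ Walk GS Ys u v := by
    refine hP.join (a := a) (b := b) (N := {v | v ∈ fR ∧ Walk GR Yr x v}) hPs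
      (hfS a haS a haS) (hfS a haS b hbS) (fun v hv => hfR a haR v hv.1) ?_
      (hor.imp_right fun h v hv hvN => h v hv hvN.1 hvN.2)
    rintro u hu v hv ((h | h) | h)
    · exact .inl (hGC u v h)
    · obtain ⟨u', v', hw, rfl, rfl⟩ := h.of_substName hbYr
      have hmem : ∀ z w, Walk GR Yr z w → z ≠ x → z ∈ W → z ∈ fR := fun z w h hz hzW => by
        obtain ⟨w', hw'⟩ := h.exists_left
        rcases suppR z w' hw' with h | h | h
        · exact (hz h).elim
        · exact h
        · exact ((hYr z h).2.1 hzW).elim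
      have hw' := hw.symm hRs
      rcases substName_cases x b u' with ⟨hux, e⟩ | ⟨hux, e⟩ <;>
        rcases substName_cases x b v' with ⟨hvx, e'⟩ | ⟨hvx, e'⟩ <;> rw [e] at hu ⊢ <;>
        rw [e'] at hv ⊢
      · exact .inl (hfS b hbS b hbS)
      · exact .inr (.inl ⟨rfl, hmem v' _ hw' hvx hv, hux ▸ hw⟩)
      · exact .inr (.inr ⟨rfl, hmem u' _ hw hux hu, hvx ▸ hw'⟩)
      · exact .inl (hfR _ (hmem u' _ hw hux hu) _ (hmem v' _ hw' hvx hv))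
    · have hmem : ∀ z w, Walk GS Ys z w → z ∈ W → z ∈ fS := fun z w h hzW => by
        obtain ⟨w', hw'⟩ := h.exists_left
        exact (suppS z w' hw').resolve_right fun h => (hYs z h).1 hzW
      exact .inl (hfS _ (hmem u v h hu) _ (hmem v u (h.symm hSs) hv))
  have hR'Ys : ∀ u v, GR' u v → u ∉ Ys := fun u v h hu => by
    rcases suppR' u v h with rfl | h | h
    · exact hbYs hu
    · exact (hYs u hu).2.2.1 h
    · exact (hYs u hu).2.2.2.1 h
  have h₁ : F.HasLeast ty (W ∪ Ys) fun u v => (GC u v ∨ Walk GR' Yr u v) ∨ GS u v := by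
    refine h₀.attach hS ?_ fun y hy z hz h => hltS y hy z hz (h.symm hSs)
    rintro u v (h | h)
    · exact ⟨fun hu => ((hYs u hu).2.2.2.2 v).1 h, fun hv => ((hYs v hv).2.2.2.2 u).2 h⟩
    · obtain ⟨w, hw⟩ := h.exists_left
      obtain ⟨w', hw'⟩ := h.exists_right
      exact ⟨hR'Ys u w hw, hR'Ys v w' (hGR's _ _ hw')⟩
  have hR' : F.HasLeast ty Yr GR' := by
    have e : ∀ z w, substName x b z = w → w ∈ Yr → z = w := fun z w hz hw => by
      rcases substName_cases x b z with ⟨-, h⟩ | ⟨-, h⟩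
      · exact (hbYr (h ▸ hz ▸ hw)).elim
      · exact h.symm.trans hz
    refine hR.of_edges ?_
    rintro u hu v hv ⟨u', v', h, hu', hv'⟩
    rwa [e u' u hu' hu, e v' v hv' hv] at h
  have hSYr : ∀ u v, GS u v → u ∉ Yr := fun u v h hu =>
    (suppS u v h).elim (hYr u hu).2.2.1 fun h => (hYs u h).2.2.2.1 hu
  refine RootedForest.HasLeast.attach (h₁.of_edges ?_) hR' ?_ ?_
  · rintro u _ v _ ((h | h) | h)
    · exact .inl (.inl h)
    · exact .inr h
    · exact .inl (.inr h)
  · rintro u v (h | h)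
    · exact ⟨fun hu => ((hYr u hu).2.2.2.2 v).1 h, fun hv => ((hYr v hv).2.2.2.2 u).2 h⟩
    · exact ⟨hSYr u v h, hSYr v u (hSs u v h)⟩
  · rintro y hy z (hz | hz) h
    · obtain ⟨y', z', hw, hy', rfl⟩ := h.of_substName hbYr
      have hyy : y' = y := by
        rcases substName_cases x b y' with ⟨-, e⟩ | ⟨-, e⟩
        · exact (hbYr (e ▸ hy' ▸ hy)).elim
        · exact e.symm.trans hy'
      subst hyy
      have hw' := hw.symm hRs
      rcases substName_cases x b z' with ⟨rfl, e⟩ | ⟨-, e⟩ <;> rw [e] at hz ⊢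
      · exact hltx y' hy hz hw'
      · exact hltR y' hy z' hz hw'
    · obtain ⟨w, hw⟩ := h.exists_right
      exact (hR'Ys z w (hGR's _ _ hw) hz).elim

end

section

variable {𝒩 : Type u} {𝒯 : Type v}

/-! ### Reduction steps -/

theorem Proc.binders_ress (P : Proc 𝒩 𝒯) : ∀ X : List (𝒩 × Ty 𝒯),
    (Proc.ress X P).binders = X.map Prod.fst ++ P.binders
  | [] => rfl
  | p :: X => congrArg (p.1 :: ·) (Proc.binders_ress P X)

theorem Proc.binders_prod_cons (A : Proc 𝒩 𝒯) (L : List (Proc 𝒩 𝒯)) :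
    (Proc.prod (A :: L)).binders = A.binders ++ (Proc.prod L).binders := by
  cases L with
  | nil => exact (List.append_nil _).symm
  | cons B L => rfl

theorem Choice.binders_sums_cons (M : Choice 𝒩 𝒯) (L : List (Choice 𝒩 𝒯)) :
    (Choice.sums (M :: L)).binders = M.binders ++ (Choice.sums L).binders := by
  cases L with
  | nil => exact (List.append_nil _).symm
  | cons B L => rfl

theorem Proc.NFGrammar.of_ress {P : Proc 𝒩 𝒯} : ∀ {X : List (𝒩 × Ty 𝒯)},
    (Proc.ress X P).NFGrammar → P.NFGrammar
  | [], h => h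
  | p :: X, h => by
    have h' : (Proc.res p.1 p.2 (Proc.ress X P)).NFGrammar := h
    cases h' with
    | prod h => cases h
    | res _ _ h => exact Proc.NFGrammar.of_ress h

theorem Proc.NFProd.of_prod : ∀ {L : List (Proc 𝒩 𝒯)}, (Proc.prod L).NFProd → ∀ A ∈ L, A.NFProd
  | [], _, A, hA => by simp at hA
  | [B], h, A, hA => by
    obtain rfl := List.mem_singleton.1 hA
    exact h
  | B :: B' :: L, h, A, hA => by
    have h' : (Proc.par B (Proc.prod (B' :: L))).NFProd := h
    cases h' with
    | par h₁ h₂ =>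
      rcases List.mem_cons.1 hA with rfl | hA
      · exact h₁
      · exact h₂.of_prod A hA

theorem Proc.NFGrammar.of_prod {M : Choice 𝒩 𝒯} {L : List (Proc 𝒩 𝒯)}
    (h : (Proc.prod (.sum M :: L)).NFGrammar) : (M = .zero ∨ M.NFSum) ∧ ∀ A ∈ L, A.NFProd := by
  cases L with
  | nil =>
    refine ⟨?_, by simp⟩
    have h' : (Proc.sum M).NFGrammar := h
    cases h' with
    | nil => exact .inl rfl
    | prod h => cases h with | sum h => exact .inr h
  | cons B L =>
    have h' : (Proc.par (.sum M) (Proc.prod (B :: L))).NFGrammar := h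
    cases h' with
    | prod h =>
      cases h with
      | par h₁ h₂ =>
        cases h₁ with
        | sum h₁ => exact ⟨.inr h₁, h₂.of_prod⟩

theorem Choice.NFSum.of_sums {p : Prefix 𝒩} {P : Proc 𝒩 𝒯} {L : List (Choice 𝒩 𝒯)}
    (h : Choice.sums (.pre p P :: L) = .zero ∨ (Choice.sums (.pre p P :: L)).NFSum) :
    P.NFGrammar := by
  cases L with
  | nil =>
    have h' : Choice.pre p P = .zero ∨ (Choice.pre p P).NFSum := h
    rcases h' with h | h
    · cases h
    · cases h with | pre _ h => exact h
  | cons M L =>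
    have h' : Choice.plus (.pre p P) (Choice.sums (M :: L)) = .zero ∨
        (Choice.plus (.pre p P) (Choice.sums (M :: L))).NFSum := h
    rcases h' with h | h
    · cases h
    · cases h with
      | plus h _ => cases h with | pre _ h => exact h

variable [DecidableEq 𝒩] {F : RootedForest 𝒯}

theorem Choice.SC.sums_cons (M : Choice 𝒩 𝒯) (L : List (Choice 𝒩 𝒯)) :
    Choice.SC (Choice.sums (M :: L)) (.plus M (Choice.sums L)) := by
  cases L with
  | nil => exact (Choice.SC.plus_zero M).symm
  | cons B L => exact .refl _

theorem RootedForest.goodConts_ress {P : Proc 𝒩 𝒯} : ∀ {X : List (𝒩 × Ty 𝒯)},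
    F.GoodConts (Proc.ress X P) ↔ F.GoodConts P
  | [] => Iff.rfl
  | _ :: X => RootedForest.goodConts_ress (X := X)

theorem RootedForest.goodConts_prod : ∀ {L : List (Proc 𝒩 𝒯)},
    F.GoodConts (Proc.prod L) ↔ ∀ A ∈ L, F.GoodConts A
  | [] => by simp [Proc.prod, Proc.nil, RootedForest.GoodConts, RootedForest.GoodContsChoice]
  | A :: L => by
    rw [(Proc.SC.prod_cons A L).goodConts_iff]
    simp only [RootedForest.GoodConts, RootedForest.goodConts_prod (L := L), List.mem_cons,
      forall_eq_or_imp]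

theorem RootedForest.GoodConts.comps {P : Proc 𝒩 𝒯} (h : F.GoodConts P) :
    ∀ A ∈ P.comps, F.GoodConts A := by
  rw [← P.ress_restrs_body, RootedForest.goodConts_ress,
    (Proc.SC.factors P.body).goodConts_iff] at h
  exact RootedForest.goodConts_prod.1 h

theorem RootedForest.Good.leastOn_restrs {P : Proc 𝒩 𝒯} (h : F.Good P) (hP : P.body.Flat)
    (hb : P.binders.Nodup) : F.LeastOn P.restrs P.body := by
  rw [← P.ress_restrs_body] at h
  exact h.leastOn hP (hb.sublist P.restrs_sublist)

/-- Names that are not used cannot be in a connected set, so their labels do not matter. -/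
theorem RootedForest.leastOn_of_forall {X : List (𝒩 × Ty 𝒯)} {P : Proc 𝒩 𝒯}
    (hX : (X.map Prod.fst).Nodup)
    (h : ∀ ty : 𝒩 → 𝒯, (∀ p ∈ X, ty p.1 = p.2.base) → F.HasLeast ty (namesOf X) P.Co) :
    F.LeastOn X P := by
  classical
  intro ty hty Y hY hne hc
  let ty' : 𝒩 → 𝒯 := fun z => if h : ∃ τ, (z, τ) ∈ X then h.choose.base else ty z
  have hty' : ∀ p ∈ X, ty' p.1 = p.2.base := fun p hp => by
    have hex : ∃ τ, (p.1, τ) ∈ X := ⟨p.2, hp⟩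
    simp only [ty', dif_pos hex]
    rw [eq_of_mem_of_nodup hX hex.choose_spec hp]
  have heq : ∀ y ∈ Y, ty' y = ty y := fun y hy => by
    obtain ⟨τ, hτ⟩ := exists_of_mem_namesOf (hY hy)
    obtain ⟨w, hw⟩ := (hc y hy y hy).exists_left
    exact (hty' _ hτ).trans (hty _ hτ hw.mem_fn).symm
  obtain ⟨m, hm, hmin⟩ := h ty' hty' Y hY hne hc
  refine ⟨m, hm, fun y hy hym => ?_⟩
  rw [← heq m hm, ← heq y hy]
  exact hmin y hy hym

theorem Proc.mem_fn_of_co_body {P : Proc 𝒩 𝒯} {u v : 𝒩} (h : P.body.Co u v) :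
    u ∈ P.fn ∨ u ∈ namesOf P.restrs := Proc.mem_fn_of_mem_fn_body h.mem_fn

/-- Names that are joined to a new restriction of a typable continuation have smaller types. -/
theorem RootedForest.CoBaseBelow.of_walk {Γ : Env 𝒩 𝒯} {P : Proc 𝒩 𝒯} (h : F.CoBaseBelow Γ P)
    (hP : P.body.Flat) (hb : P.binders.Nodup) {p : 𝒩 × Ty 𝒯} (hp : p ∈ P.restrs) {z : 𝒩}
    (hz : z ∉ namesOf P.restrs) (hw : Walk P.body.Co (namesOf P.restrs) z p.1) :
    F.NameBelow Γ z p.2.base := by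
  refine h z p.2.base ?_
  rw [← P.ress_restrs_body, Proc.coBase_ress hP (hb.sublist P.restrs_sublist)]
  exact ⟨hz, p, hp, rfl, hw⟩

/-- An internal step preserves the existence of least elements: the restrictions of the
continuation are attached to the old graph. -/
theorem RootedForest.good_of_tau {W : List (𝒩 × Ty 𝒯)} {N : Proc 𝒩 𝒯} {C : List (Proc 𝒩 𝒯)}
    {Γ : Env 𝒩 𝒯} {B : Proc 𝒩 𝒯} (hB : B = .par (.sum (.pre .tau N)) (Proc.prod C))
    (hnd : (Proc.ress W B).binders.Nodup) (hdis : Disjoint (Proc.ress W B).fn (Proc.ress W B).bn)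
    (hN : N.body.Flat) (hC : ∀ A ∈ C, A.Flat) (hwt : F.WT (Proc.ress W B) Γ)
    (hg : F.GoodConts (Proc.ress W B)) (hgood : F.Good (Proc.ress W B)) :
    F.GoodConts (Proc.ress (W ++ N.restrs) (Proc.prod (N.comps ++ C))) ∧
      F.Good (Proc.ress (W ++ N.restrs) (Proc.prod (N.comps ++ C))) := by
  have hBflat : B.Flat := hB ▸ ⟨trivial, Proc.flat_prod hC⟩
  rw [Proc.binders_ress] at hnd
  obtain ⟨hWnd, hBnd, hWB⟩ := List.nodup_append.1 hnd
  -- A bound name of `B` is neither restricted by `W` nor free in `B`.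
  have hfresh : ∀ y ∈ B.binders, y ∉ namesOf W ∧ y ∉ B.fn := fun y hy => by
    have h₁ : y ∉ namesOf W := fun h => hWB y h y hy rfl
    refine ⟨h₁, fun h => Finset.disjoint_left.1 hdis (Proc.mem_fn_ress.2 ⟨h, h₁⟩) ?_⟩
    rw [Proc.bn, List.mem_toFinset, Proc.binders_ress]
    exact List.mem_append_right _ hy
  have hbind : B.binders = N.binders ++ (Proc.prod C).binders := by rw [hB]; rfl
  rw [hbind] at hBnd hfresh
  obtain ⟨hNnd, -, -⟩ := List.nodup_append.1 hBnd
  have hfn : B.fn = N.fn ∪ (Proc.prod C).fn := by rw [hB]; rfl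
  have hY : ∀ y ∈ namesOf N.restrs, y ∉ namesOf W ∧ y ∉ N.fn ∧ y ∉ (Proc.prod C).fn := by
    intro y hy
    have := hfresh y (List.mem_append_left _ (N.restrs_sublist.subset hy))
    rw [hfn, Finset.mem_union, not_or] at this
    exact this
  have hX : ((W ++ N.restrs).map Prod.fst).Nodup := by
    rw [List.map_append]
    exact List.nodup_append.2 ⟨hWnd, hNnd.sublist N.restrs_sublist, fun y hy z hz hyz =>
      (hY z hz).1 (hyz ▸ hy)⟩
  rw [RootedForest.goodConts_ress, hB] at hg
  have hw := (RootedForest.wt_ress hWnd).1 hwt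
  rw [hB] at hw
  refine ⟨?_, ?_⟩
  · rw [RootedForest.goodConts_ress, RootedForest.goodConts_prod]
    intro A hA
    rcases List.mem_append.1 hA with hA | hA
    · exact RootedForest.GoodConts.comps hg.1.1 A hA
    · exact RootedForest.goodConts_prod.1 hg.2 A hA
  · refine (RootedForest.leastOn_of_forall hX fun ty hty => ?_).good (Proc.flat_prod ?_) hX
    swap
    · intro A hA
      rcases List.mem_append.1 hA with hA | hA
      · exact hN.factors A hA
      · exact hC A hA
    have htyW : ∀ p ∈ W, ty p.1 = p.2.base := fun p hp => hty p (List.mem_append_left _ hp)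
    have htyN : ∀ p ∈ N.restrs, ty p.1 = p.2.base := fun p hp =>
      hty p (List.mem_append_right _ hp)
    have hlW := (hgood.leastOn hBflat hWnd) ty fun p hp _ => htyW p hp
    have hlN := (hg.1.2.leastOn_restrs hN hNnd) ty fun p hp _ => htyN p hp
    have hsupp : ∀ z w, Walk N.body.Co (namesOf N.restrs) z w → z ∈ namesOf W → z ∈ N.fn := by
      intro z w h hz
      obtain ⟨w', hw'⟩ := h.exists_left
      exact (Proc.mem_fn_of_co_body hw').resolve_right fun h => (hY z h).1 hz
    have hlW' : F.HasLeast ty (namesOf W) fun u v =>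
        (Proc.prod C).Co u v ∨ Walk N.body.Co (namesOf N.restrs) u v := by
      refine hlW.of_edges ?_
      rintro u hu v hv (h | h)
      · exact hB ▸ .inr h
      · exact hB ▸ .inl ⟨hsupp u v h hu, hsupp v u (h.symm fun _ _ => Proc.Co.symm) hv⟩
    rw [namesOf_append]
    refine (hlW'.attach hlN (fun u v h => ?_) fun y hy z hz h => ?_).of_edges ?_
    · exact ⟨fun hu => (hY u hu).2.2 h.mem_fn, fun hv => (hY v hv).2.2 h.mem_fn_right⟩
    · obtain ⟨τ, hτ⟩ := exists_of_mem_namesOf hy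
      obtain ⟨σ, hσ⟩ := exists_of_mem_namesOf hz
      rw [htyN _ hτ, htyW _ hσ]
      exact hw.1.2.of_walk hN hNnd hτ (fun h => (hY z h).1 hz)
        (h.symm fun _ _ => Proc.Co.symm) σ (Env.extend_of_mem Γ hWnd hσ)
    · rintro u _ v _ h
      rw [(Proc.SC.prod_append N.comps C).co_eq] at h
      have h' : N.body.Co u v ∨ (Proc.prod C).Co u v :=
        h.imp_left fun h => Proc.co_iff_factors.2 (Proc.co_prod.1 h)
      exact h'.symm

/-- A synchronisation preserves the existence of least elements. Safety is needed in case the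
channel `a` is not restricted by `W`. -/
theorem RootedForest.good_of_comm {W : List (𝒩 × Ty 𝒯)} {a b x : 𝒩} {Ns Nr : Proc 𝒩 𝒯}
    {Ms Mr : Choice 𝒩 𝒯} {C : List (Proc 𝒩 𝒯)} {Γ : Env 𝒩 𝒯} {B : Proc 𝒩 𝒯}
    (hB : B = .par (.sum (.plus (.pre (.out a b) Ns) Ms))
      (.par (.sum (.plus (.pre (.inp a x) Nr) Mr)) (Proc.prod C)))
    (hnd : (Proc.ress W B).binders.Nodup) (hdis : Disjoint (Proc.ress W B).fn (Proc.ress W B).bn)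
    (hNs : Ns.body.Flat) (hNr : Nr.body.Flat) (hC : ∀ A ∈ C, A.Flat)
    (hwt : F.WT (Proc.ress W B) Γ)
    (hsafe : ∀ t, (Proc.ress W B).UsedBase t → F.BaseBelow Γ (Proc.ress W B).fn t)
    (hg : F.GoodConts (Proc.ress W B)) (hgood : F.Good (Proc.ress W B)) :
    F.GoodConts (Proc.ress (W ++ Ns.restrs ++ Nr.restrs)
        (Proc.prod (Ns.comps ++ Nr.comps.map (Proc.subst x b) ++ C))) ∧
      F.Good (Proc.ress (W ++ Ns.restrs ++ Nr.restrs)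
        (Proc.prod (Ns.comps ++ Nr.comps.map (Proc.subst x b) ++ C))) := by
  have hBflat : B.Flat := hB ▸ ⟨trivial, trivial, Proc.flat_prod hC⟩
  rw [Proc.binders_ress] at hnd
  obtain ⟨hWnd, hBnd, hWB⟩ := List.nodup_append.1 hnd
  -- A bound name of `B` is neither restricted by `W` nor free in `B`.
  have hfresh : ∀ y ∈ B.binders, y ∉ namesOf W ∧ y ∉ B.fn := fun y hy => by
    have h₁ : y ∉ namesOf W := fun h => hWB y h y hy rfl
    refine ⟨h₁, fun h => Finset.disjoint_left.1 hdis (Proc.mem_fn_ress.2 ⟨h, h₁⟩) ?_⟩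
    rw [Proc.bn, List.mem_toFinset, Proc.binders_ress]
    exact List.mem_append_right _ hy
  set S : Choice 𝒩 𝒯 := .plus (.pre (.out a b) Ns) Ms with hS
  set R : Choice 𝒩 𝒯 := .plus (.pre (.inp a x) Nr) Mr with hR
  have hbind : B.binders = (Ns.binders ++ Ms.binders) ++
      (((x :: Nr.binders) ++ Mr.binders) ++ (Proc.prod C).binders) := by rw [hB]; rfl
  have hfn : B.fn = S.fn ∪ (R.fn ∪ (Proc.prod C).fn) := by rw [hB]; rfl
  have hCo : ∀ u v, B.Co u v ↔
      (u ∈ S.fn ∧ v ∈ S.fn) ∨ (u ∈ R.fn ∧ v ∈ R.fn) ∨ (Proc.prod C).Co u v := by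
    intro u v; rw [hB]; rfl
  have haS : a ∈ S.fn := by simp [hS, Choice.fn]
  have hbS : b ∈ S.fn := by simp [hS, Choice.fn]
  have haR : a ∈ R.fn := by simp [hR, Choice.fn]
  have hNsS : ∀ z ∈ Ns.fn, z ∈ S.fn := fun z hz => by simp [hS, Choice.fn, hz]
  have hNrR : ∀ z ∈ Nr.fn, z = x ∨ z ∈ R.fn := fun z hz => by
    by_cases h : z = x <;> simp [hR, Choice.fn, hz, h]
  rw [hbind] at hBnd
  obtain ⟨hSnd, hRCnd, hSR⟩ := List.nodup_append.1 hBnd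
  have hNsnd := (List.nodup_append.1 hSnd).1
  have hxNr := (List.nodup_append.1 (List.nodup_append.1 hRCnd).1).1
  obtain ⟨hxNr, hNrnd⟩ := List.nodup_cons.1 hxNr
  have hfresh' : ∀ y ∈ B.binders,
      y ∉ namesOf W ∧ y ∉ S.fn ∧ y ∉ R.fn ∧ y ∉ (Proc.prod C).fn := fun y hy => by
    have := hfresh y hy
    rw [hfn, Finset.mem_union, Finset.mem_union] at this
    tauto
  have hsubNs : ∀ y ∈ namesOf Ns.restrs, y ∈ Ns.binders := fun y hy => Ns.restrs_sublist.subset hy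
  have hsubNr : ∀ y ∈ namesOf Nr.restrs, y ∈ Nr.binders := fun y hy => Nr.restrs_sublist.subset hy
  have hYs : ∀ y ∈ namesOf Ns.restrs, y ∉ namesOf W ∧ y ∉ S.fn ∧ y ∉ R.fn ∧
      y ∉ (Proc.prod C).fn := fun y hy => hfresh' y (by rw [hbind]; simp [hsubNs y hy])
  have hYr : ∀ y ∈ namesOf Nr.restrs, y ∉ namesOf W ∧ y ∉ S.fn ∧ y ∉ R.fn ∧
      y ∉ (Proc.prod C).fn := fun y hy => hfresh' y (by rw [hbind]; simp [hsubNr y hy])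
  have hYsr : ∀ y ∈ namesOf Ns.restrs, y ∉ namesOf Nr.restrs := fun y hy hy' =>
    hSR y (by simp [hsubNs y hy]) y (by simp [hsubNr y hy']) rfl
  have hxW : x ∉ namesOf W := (hfresh' x (by rw [hbind]; simp)).1
  have hxYr : x ∉ namesOf Nr.restrs := fun h => hxNr (hsubNr x h)
  have hbNr : b ∉ Nr.binders := fun h => (hfresh' b (by rw [hbind]; simp [h])).2.1 hbS
  have hbcomp : ∀ A ∈ Nr.comps, b ∉ A.binders := fun A hA h =>
    hbNr (((Proc.binders_factors_sublist hA).trans Nr.binders_body_sublist).subset h)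
  have hX : ((W ++ Ns.restrs ++ Nr.restrs).map Prod.fst).Nodup := by
    rw [List.map_append, List.map_append]
    refine List.nodup_append.2 ⟨List.nodup_append.2 ⟨hWnd, hNsnd.sublist Ns.restrs_sublist, ?_⟩,
      hNrnd.sublist Nr.restrs_sublist, ?_⟩
    · exact fun y hy z hz hyz => (hYs z hz).1 (hyz ▸ hy)
    · intro y hy z hz hyz
      rcases List.mem_append.1 hy with hy | hy
      · exact (hYr z hz).1 (hyz ▸ hy)
      · exact hYsr y hy (hyz ▸ hz)
  rw [RootedForest.goodConts_ress, hB] at hg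
  obtain ⟨⟨⟨hgs, hgoods⟩, -⟩, ⟨⟨hgr, hgoodr⟩, -⟩, hgC⟩ := hg
  have hw := (RootedForest.wt_ress hWnd).1 hwt
  rw [hB] at hw
  obtain ⟨⟨⟨⟨t, σ, hΔa, hΔb⟩, -, hcbs⟩, -⟩, ⟨⟨t', σ', hΔa', -, hcbr, hmig⟩, -⟩, -⟩ := hw
  obtain ⟨rfl, rfl⟩ : t = t' ∧ σ = σ' := by
    rw [hΔa] at hΔa'
    simpa using hΔa'
  have hΔW : ∀ {z τ}, (z, τ) ∈ W → Γ.extend W z = some τ := fun h => Env.extend_of_mem Γ hWnd h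
  -- If the channel is not restricted by `W`, its base type is below those of the names in `W`.
  have haW : ∀ {z τ}, (z, τ) ∈ W → z ∈ B.fn → a ∉ namesOf W → F.lt t τ.base := by
    intro z τ hz hzB ha
    rw [Env.extend_of_notMem Γ ha] at hΔa
    exact hsafe _ (Proc.usedBase_ress hWnd _ hz hzB) a
      (Proc.mem_fn_ress.2 ⟨by rw [hfn]; simp [haS], ha⟩) _ hΔa
  have hCoR : ∀ {L : List (Proc 𝒩 𝒯)}, L = Nr.comps.map (Proc.subst x b) → ∀ u v,
      (Proc.prod L).Co u v →
      ∃ u' v', Nr.body.Co u' v' ∧ substName x b u' = u ∧ substName x b v' = v := by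
    rintro _ rfl u v h
    obtain ⟨_, hA, h⟩ := Proc.co_prod.1 h
    obtain ⟨A, hA', rfl⟩ := List.mem_map.1 hA
    obtain ⟨u', v', h, hu, hv⟩ := (A.co_subst (hbcomp A hA') u v).1 h
    exact ⟨u', v', Proc.co_iff_factors.2 ⟨A, hA', h⟩, hu, hv⟩
  refine ⟨?_, ?_⟩
  · rw [RootedForest.goodConts_ress, RootedForest.goodConts_prod]
    intro A hA
    simp only [List.mem_append, List.mem_map] at hA
    rcases hA with (hA | ⟨A, hA, rfl⟩) | hA
    · exact hgs.comps A hA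
    · exact F.goodConts_subst A (hbcomp A hA) (hgr.comps A hA)
    · exact RootedForest.goodConts_prod.1 hgC A hA
  refine (RootedForest.leastOn_of_forall hX fun ty hty => ?_).good (Proc.flat_prod ?_) hX
  swap
  · have hsubst : ∀ A : Proc 𝒩 𝒯, A.Flat → (A.subst x b).Flat := fun A => by
      induction A using Proc.factors.induct with
      | case1 P Q ih₁ ih₂ => exact fun h => ⟨ih₁ h.1, ih₂ h.2⟩
      | case2 => exact fun _ => trivial
      | case3 P h₁ h₂ =>
        intro h
        cases P with
        | res => exact h.elim
        | par => exact (h₁ _ _ rfl).elim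
        | sum M => trivial
        | repl M => trivial
    intro A hA
    simp only [List.mem_append, List.mem_map] at hA
    rcases hA with (hA | ⟨A, hA, rfl⟩) | hA
    · exact hNs.factors A hA
    · exact hsubst A (hNr.factors A hA)
    · exact hC A hA
  have htyW : ∀ {z τ}, (z, τ) ∈ W → ty z = τ.base :=
    fun {z τ} h => hty (z, τ) (by simp [h])
  have htys : ∀ {z τ}, (z, τ) ∈ Ns.restrs → ty z = τ.base :=
    fun {z τ} h => hty (z, τ) (by simp [h])
  have htyr : ∀ {z τ}, (z, τ) ∈ Nr.restrs → ty z = τ.base :=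
    fun {z τ} h => hty (z, τ) (by simp [h])
  have hlW := (hgood.leastOn hBflat hWnd) ty fun p hp _ => htyW hp
  have hls := (hgoods.leastOn_restrs hNs hNsnd) ty fun p hp _ => htys hp
  have hlr := (hgoodr.leastOn_restrs hNr hNrnd) ty fun p hp _ => htyr hp
  have hsymm : ∀ P : Proc 𝒩 𝒯, ∀ u v, P.Co u v → P.Co v u := fun _ _ _ => Proc.Co.symm
  rw [namesOf_append, namesOf_append]
  refine (hlW.comm hls hlr (GC := (Proc.prod C).Co) (a := a) (b := b) (x := x)
    (fS := {z | z ∈ S.fn}) (fR := {z | z ∈ R.fn}) (hsymm B) (hsymm _) (hsymm _)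
    (fun u hu v hv => (hCo u v).2 (.inl ⟨hu, hv⟩))
    (fun u hu v hv => (hCo u v).2 (.inr (.inl ⟨hu, hv⟩)))
    (fun u v h => (hCo u v).2 (.inr (.inr h))) haS haR hbS ?_ ?_ ?_ ?_ ?_ ?_ ?_ ?_).of_edges ?_
  · exact fun u v h => (Proc.mem_fn_of_co_body h).imp_left (hNsS u)
  · intro u v h
    rcases Proc.mem_fn_of_co_body h with h | h
    · exact (hNrR u h).imp_right .inl
    · exact .inr (.inr h)
  · intro y hy
    obtain ⟨h₁, h₂, h₃, h₄⟩ := hYs y hy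
    exact ⟨h₁, h₂, h₃, hYsr y hy, fun v => ⟨fun h => h₄ h.mem_fn, fun h => h₄ h.mem_fn_right⟩⟩
  · intro y hy
    obtain ⟨h₁, h₂, h₃, h₄⟩ := hYr y hy
    exact ⟨fun h => hxYr (h ▸ hy), h₁, h₂, h₃,
      fun v => ⟨fun h => h₄ h.mem_fn, fun h => h₄ h.mem_fn_right⟩⟩
  · intro y hy z hz h
    obtain ⟨τ, hτ⟩ := exists_of_mem_namesOf hy
    obtain ⟨ρ, hρ⟩ := exists_of_mem_namesOf hz
    rw [htys hτ, htyW hρ]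
    exact hcbs.of_walk hNs hNsnd hτ (fun h => (hYs z h).1 hz) h ρ (hΔW hρ)
  · intro y hy z hz h
    obtain ⟨τ, hτ⟩ := exists_of_mem_namesOf hy
    obtain ⟨ρ, hρ⟩ := exists_of_mem_namesOf hz
    rw [htyr hτ, htyW hρ]
    refine hcbr.of_walk hNr hNrnd hτ (fun h => (hYr z h).1 hz) h ρ ?_
    rw [Function.update_of_ne (ne_of_mem_of_not_mem hz hxW), hΔW hρ]
  · intro y hy hbW h
    obtain ⟨τ, hτ⟩ := exists_of_mem_namesOf hy
    obtain ⟨ρ, hρ⟩ := exists_of_mem_namesOf hbW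
    obtain rfl : ρ = σ := Option.some.inj ((hΔW hρ).symm.trans hΔb)
    rw [htyr hτ, htyW hρ]
    exact hcbr.of_walk hNr hNrnd hτ hxYr h ρ (Function.update_self _ _ _)
  · have htya : a ∈ namesOf W → ty a = t := fun ha => by
      obtain ⟨ρ, hρ⟩ := exists_of_mem_namesOf ha
      obtain rfl : ρ = .chan t σ := Option.some.inj ((hΔW hρ).symm.trans hΔa)
      exact htyW hρ
    refine hmig.imp (fun hle hbW => ?_) fun hmig v hv hvR hw hva => ?_
    · obtain ⟨ρ, hρ⟩ := exists_of_mem_namesOf hbW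
      obtain rfl : ρ = σ := Option.some.inj ((hΔW hρ).symm.trans hΔb)
      have ha : a ∈ namesOf W := by
        by_contra ha
        exact F.lt_irrefl _ (F.lt_of_le_of_lt hle (haW hρ (by rw [hfn]; simp [hbS]) ha))
      refine ⟨ha, fun h => ?_⟩
      rw [htya ha, htyW hρ] at h
      exact F.lt_irrefl _ (F.lt_of_le_of_lt hle h)
    · obtain ⟨ρ, hρ⟩ := exists_of_mem_namesOf hv
      have hco : Nr.Co x v := by
        rw [← Nr.ress_restrs_body, Proc.co_ress (hNrnd.sublist Nr.restrs_sublist)]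
        exact ⟨hxYr, fun h => (hYr v h).1 hv, hw⟩
      have hlt := hmig v hva (ne_of_mem_of_not_mem hv hxW) hco ρ (hΔW hρ)
      have ha : a ∈ namesOf W := by
        by_contra ha
        have hvB : v ∈ B.fn := by
          rw [hfn]
          exact Finset.mem_union_right _ (Finset.mem_union_left _ hvR)
        exact F.lt_irrefl _ (F.lt_trans hlt (haW hρ hvB ha))
      refine ⟨ha, fun h => ?_⟩
      rw [htya ha, htyW hρ] at h
      exact F.lt_irrefl _ (F.lt_trans hlt h)
  · rintro u _ v _ h
    rw [(Proc.SC.prod_append _ C).co_eq] at h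
    rcases h with h | h
    · rw [(Proc.SC.prod_append Ns.comps _).co_eq] at h
      rcases h with h | h
      · exact .inl (.inr (Proc.co_iff_factors.2 (Proc.co_prod.1 h)))
      · exact .inr (hCoR rfl u v h)
    · exact .inl (.inl h)

end

end HPi

theorem mainTheorem2 {𝒩 : Type*} [DecidableEq 𝒩] [Infinite 𝒩] {𝒯 : Type*} [Finite 𝒯]
    (F : HPi.RootedForest 𝒯) (P Q : HPi.Proc 𝒩 𝒯) (Γ : HPi.Env 𝒩 𝒯)
    (hP : P.IsNormalForm) (hQ : Q.IsNormalForm) (hPQ : P.Step Q)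
    (hsafe : F.Safe Γ P) (hty : F.TypesProc Γ P)
    (hshape : F.Shaped P) :
    F.Shaped Q := by
  open HPi in
  have hwt := (RootedForest.TypesProc.wt F hty hP.2.1).1
  have hsafe' : ∀ t, P.UsedBase t → F.BaseBelow Γ P.fn t := fun t ht => by
    obtain ⟨p, hp, rfl⟩ := ht.exists_mem_bnRes
    exact hsafe p hp
  have hg : F.GoodConts P := RootedForest.goodConts_of_compatible P hshape
  have hgood : F.Good P := (hshape P P.mem_subterms_self).good
  suffices h : F.GoodConts Q ∧ F.Good Q from hQ.shaped h.1 h.2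
  cases hPQ with
  | comm W a b x Ns Nr Ms Mr C P₀ hP₀ hnf hsc hsc' =>
    subst hP₀
    rw [hsc'.goodConts_iff, hsc'.good_iff]
    obtain ⟨hgr, hnd, hdis⟩ := hnf
    have hgr' := hgr.of_ress.of_prod
    have hNs : Ns.NFGrammar := Choice.NFSum.of_sums hgr'.1
    have hR := hgr'.2 _ List.mem_cons_self
    have hNr : Nr.NFGrammar := by
      cases hR with | sum h => exact Choice.NFSum.of_sums (.inr h)
    have hsc₁ : Proc.SC (.prod (.sum (.sums (.pre (.out a b) Ns :: Ms)) ::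
        .sum (.sums (.pre (.inp a x) Nr :: Mr)) :: C))
        (.par (.sum (.plus (.pre (.out a b) Ns) (.sums Ms)))
          (.par (.sum (.plus (.pre (.inp a x) Nr) (.sums Mr))) (Proc.prod C))) :=
      .par_congr (.sum_congr (.sums_cons _ _))
        ((Proc.SC.prod_cons _ _).trans (.par_congr (.sum_congr (.sums_cons _ _)) (.refl _)))
    have hsc₂ := hsc.trans (hsc₁.ress_congr W)
    have hbind : (Proc.ress W (.par (.sum (.plus (.pre (.out a b) Ns) (.sums Ms)))
          (.par (.sum (.plus (.pre (.inp a x) Nr) (.sums Mr))) (Proc.prod C)))).binders =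
        (Proc.ress W (.prod (.sum (.sums (.pre (.out a b) Ns :: Ms)) ::
          .sum (.sums (.pre (.inp a x) Nr :: Mr)) :: C))).binders := by
      rw [Proc.binders_ress, Proc.binders_ress, Proc.binders_prod_cons, Proc.binders_prod_cons]
      simp only [Proc.binders, Choice.binders_sums_cons]
      rfl
    refine RootedForest.good_of_comm rfl (hbind ▸ hnd) ?_ hNs.flat_body hNr.flat_body
      (fun A hA => (hgr'.2 A (List.mem_cons_of_mem _ hA)).flat) (hsc₂.wt_eq F ▸ hwt)
      (hsc₂.usedBase_eq ▸ hsc₂.fn_eq ▸ hsafe') (hsc₂.goodConts_iff.1 hg) (hsc₂.good_iff.1 hgood)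
    rw [Proc.bn, hbind, ← (hsc₁.ress_congr W).fn_eq]
    exact hdis
  | tau W N C P₀ hP₀ hnf hsc hsc' =>
    subst hP₀
    rw [hsc'.goodConts_iff, hsc'.good_iff]
    obtain ⟨hgr, hnd, hdis⟩ := hnf
    have hgr' := hgr.of_ress.of_prod
    have hN : N.NFGrammar := Choice.NFSum.of_sums (L := []) hgr'.1
    have hsc₁ := Proc.SC.prod_cons (.sum (.pre .tau N)) C
    have hsc₂ := hsc.trans (hsc₁.ress_congr W)
    have hbind : (Proc.ress W (.par (.sum (.pre .tau N)) (Proc.prod C))).binders =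
        (Proc.ress W (.prod (.sum (.pre .tau N) :: C))).binders := by
      rw [Proc.binders_ress, Proc.binders_ress, Proc.binders_prod_cons]
      rfl
    refine RootedForest.good_of_tau rfl (hbind ▸ hnd) ?_ hN.flat_body
      (fun A hA => (hgr'.2 A hA).flat) (hsc₂.wt_eq F ▸ hwt) (hsc₂.goodConts_iff.1 hg)
      (hsc₂.good_iff.1 hgood)
    rw [Proc.bn, hbind, ← (hsc₁.ress_congr W).fn_eq]
    exact hdis
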